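/- **Setting.** Let $X$ be a second countable topological space. A *conical polyhedral structure* $\Pi$ on $X$ is a finite covering of $X$ by closed subsets $\sigma$ (the cones), each with a finite-dimensional real vector space $M^\sigma$ of continuous functions $\sigma\to\mathbb R$, such that: the evaluation map $\sigma\to N^\sigma:=\operatorname{Hom}(M^\sigma,\mathbb R)$ is a homeomorphism onto a strictly convex, full-dimensional polyhedral cone; the preimage of each face of this cone is again a cone $\tau$ of $\Pi$ (a face of $\sigma$, written $\tau\prec\sigma$), with $M^\tau=\{u|_\tau : u\in M^\sigma\}$; the intersection of two cones is a union of common faces. A structure $\Pi'$ is a *subdivision* of $\Pi$ if every cone of $\Pi'$ lies in a cone of $\Pi$, the inclusion being linear; two structures are equivalent if they have a common subdivision. A *Euclidean conical space* is $X$ with an equivalence class of such structures, a finite-dimensional Euclidean space $N^X$ and a map $\iota:X\to N^X$ that is linear and injective on each cone of some structure $\Pi$ of the class; $R(X)$ is the set of all structures $\Pi$ of the class with this last property. Assume that $X$ has pure dimension $n$ (every maximal cone has dimension $n$); $\Pi(k)$ is the set of cones of dimension $k$. For $\tau\prec\sigma$ with $\tau\in\Pi(k-1)$, $\sigma\in\Pi(k)$,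 let $\hat v_{\sigma/\tau}$ be the unit vector of $\operatorname{span}\iota(\sigma)$ orthogonal to $\operatorname{span}\iota(\tau)$ and pointing in the direction of $\sigma$. A *$k$-dimensional Minkowski weight* on $\Pi\in R(X)$ is a function $c:\Pi\to\mathbb R$ vanishing outside $\Pi(k)$ with $\sum_{\sigma\in\Pi(k),\,\sigma\succ\tau}c(\sigma)\hat v_{\sigma/\tau}=0$ for all $\tau\in\Pi(k-1)$. Its pull-back to a subdivision $\Pi'$ takes at $\sigma'\in\Pi'(k)$ the value $c(\sigma)$ if the smallest cone $\sigma$ of $\Pi$ containing $\sigma'$ has dimension $k$, and is $0$ otherwise. Tropical $k$-cycles are the elements $[c]$ of the direct limit $Z_k(X)$ over $\Pi\in R(X)$ of the groups of $k$-dimensional Minkowski weights; a cycle is *positive* if it is represented by a non-negative Minkowski weight. $X$ is *balanced* if it is given a cycle $[X]\in Z_n(X)$ represented on some $\Pi\in R(X)$ by a Minkowski weight $b$ with $b(\sigma)>0$ for all $\sigma\in\Pi(n)$. A function $\phi:X\to\mathbb R$ is *piecewise linear* ($\phi\in\operatorname{PL}(X)$) if it is linear on each cone of some $\Pi\in R(X)$;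 then, for a cycle $[c]$ represented by $c$ on such a $\Pi$, $\phi\cdot[c]\in Z_{k-1}(X)$ is the class of the weight $\tau\mapsto\sum_{\sigma\in\Pi(k),\,\sigma\succ\tau}-\phi_\sigma(\hat v_{\sigma/\tau})\,c(\sigma)$ for $\tau\in\Pi(k-1)$, where $\phi_\sigma$ is a linear form with $\phi|_\sigma=\phi_\sigma\circ\iota|_\sigma$. Let $\operatorname{Conic}(X)$ be the space of all functions $f:X\to\mathbb R$ with $f(\lambda x)=\lambda f(x)$ for all $x\in X$, $\lambda\ge 0$, with the topology of pointwise convergence. Let $\mathbb S^X=\{x\in X:\|\iota(x)\|=1\}$, and let $C^0(\mathbb S^X)$ be the space of continuous functions on $\mathbb S^X$ with the topology of uniform convergence. An *admissible family of concave functions* is a set $\mathcal C\subseteq\operatorname{PL}(X)$ such that (i) $\phi_1\cdots\phi_r\cdot[X]\in Z_{n-r}(X)$ is positive for all $0\le r\le n$ and $\phi_1,\dots,\phi_r\in\mathcal C$; (ii) $\mathcal C$ is a convex cone (closed under sums and multiplication by positive reals); (iii) $\mathcal C-\mathcal C$ is dense in $C^0(\mathbb S^X)$. The space $\operatorname{Conic}(X)_{\mathcal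 C}$ of *$\mathcal C$-concave functions* is the closure of $\mathcal C$ in $\operatorname{Conic}(X)$. **Theorem.** Let $X$ be a balanced Euclidean conical space of pure dimension $n$ and $\mathcal C$ an admissible family of concave functions on $X$. Then every $f\in\operatorname{Conic}(X)_{\mathcal C}$ is continuous on $\mathbb S^X$, so that restriction to $\mathbb S^X$ gives an injective map $\operatorname{Conic}(X)_{\mathcal C}\to C^0(\mathbb S^X)$. The topology of pointwise convergence (induced by $\operatorname{Conic}(X)$) and the topology of uniform convergence (induced by $C^0(\mathbb S^X)$) on $\operatorname{Conic}(X)_{\mathcal C}$ agree. In particular $\operatorname{Conic}(X)_{\mathcal C}$ is metrizable, and it is a Fréchet–Urysohn space. -/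

import Mathlib

/-! ### Conical polyhedral structures -/

/-- Restriction of continuous functions along an inclusion `τ ⊆ σ` of subsets of `X`. -/
def restrictLin {X : Type*} [TopologicalSpace X] {τ σ : Set X} (h : τ ⊆ σ) :
    C(σ, ℝ) →ₗ[ℝ] C(τ, ℝ) where
  toFun u := ⟨fun x => u ⟨x.1, h x.2⟩, by fun_prop⟩
  map_add' _ _ := rfl
  map_smul' _ _ := rfl

/-- The evaluation map `σ → N^σ = Hom(M, ℝ)`, `v ↦ (u ↦ u(v))`. -/
def evalDual {X : Type*} [TopologicalSpace X] {σ : Set X} (M : Submodule ℝ C(σ, ℝ)) (v : σ) :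
    Module.Dual ℝ M where
  toFun u := u.1 v
  map_add' _ _ := rfl
  map_smul' _ _ := rfl

/-- `τ` is the preimage under the evaluation map of a face of the image of `σ` in `Hom(M, ℝ)`.
The linear forms on `Hom(M, ℝ)` are the elements of the finite dimensional space `M`, and a face
is the zero locus of a linear form that is non-negative on the cone (the zero form gives the
cone itself). -/
def IsFaceOf {X : Type*} [TopologicalSpace X] {σ : Set X} (M : Submodule ℝ C(σ, ℝ))
    (τ : Set X) : Prop :=
  ∃ u ∈ M, (∀ x : σ, 0 ≤ u x) ∧ τ = (fun x : σ => (x : X)) '' {x : σ | u x = 0}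

/-- A conical polyhedral structure on `X`: a finite covering by closed subsets (the cones), each
with a finite dimensional vector space of continuous functions (the linear functions). -/
structure ConicalStructure (X : Type*) [TopologicalSpace X] where
  /-- the set of cones -/
  cones : Set (Set X)
  finite_cones : cones.Finite
  isClosed_cone : ∀ σ ∈ cones, IsClosed σ
  covers : ⋃₀ cones = Set.univ
  /-- the linear functions on each cone -/
  M : ∀ σ : cones, Submodule ℝ C((σ : Set X), ℝ)
  finite_dim : ∀ σ : cones, FiniteDimensional ℝ (M σ)
  /-- The evaluation map is a homeomorphism onto its image. (The topology of the finite
  dimensional space `Hom(M, ℝ)` is that of pointwise convergence on `M`.) -/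
  isEmbedding_eval : ∀ σ : cones,
    Topology.IsEmbedding (fun (v : (σ : Set X)) (u : M σ) => evalDual (M σ) v u)
  /-- The image of the evaluation map is a polyhedral cone (one that is finitely generated),
  strictly convex, ... -/
  polyhedral : ∀ σ : cones, ∃ s : Finset (Module.Dual ℝ (M σ)),
    Set.range (evalDual (M σ)) = (PointedCone.hull ℝ (s : Set (Module.Dual ℝ (M σ))) :
      Set (Module.Dual ℝ (M σ)))
  strictly_convex : ∀ σ : cones, ∀ w : Module.Dual ℝ (M σ),
    w ∈ Set.range (evalDual (M σ)) → -w ∈ Set.range (evalDual (M σ)) → w = 0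
  /-- ... and of full dimension. -/
  full_dim : ∀ σ : cones, Submodule.span ℝ (Set.range (evalDual (M σ))) = ⊤
  /-- Faces are cones, with the restricted linear functions. -/
  face_mem : ∀ (σ : cones) (τ : Set X), IsFaceOf (M σ) τ →
    ∃ (hτ : τ ∈ cones) (h : τ ⊆ (σ : Set X)), M ⟨τ, hτ⟩ = (M σ).map (restrictLin h)
  /-- The intersection of two cones is a union of common faces. -/
  inter_faces : ∀ σ σ' : cones, ∃ F : Set (Set X),
    (∀ τ ∈ F, IsFaceOf (M σ) τ ∧ IsFaceOf (M σ') τ) ∧ (σ : Set X) ∩ (σ' : Set X) = ⋃₀ F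

namespace ConicalStructure

variable {X : Type*} [TopologicalSpace X]

noncomputable instance (P : ConicalStructure X) : Fintype P.cones := P.finite_cones.fintype

/-- The dimension of a cone. -/
noncomputable def dim (P : ConicalStructure X) (σ : P.cones) : ℕ := Module.finrank ℝ (P.M σ)

/-- `τ` is a face of `σ`. -/
def Face (P : ConicalStructure X) (τ σ : P.cones) : Prop := IsFaceOf (P.M σ) (τ : Set X)

/-- `P'` is a subdivision of `P`: every cone of `P'` is contained in a cone of `P`, the inclusion
being linear (linear functions restrict to linear functions). -/
def IsSubdivision (P' P : ConicalStructure X) : Prop :=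
  ∀ σ' : P'.cones, ∃ (σ : P.cones) (h : (σ' : Set X) ⊆ (σ : Set X)),
    (P.M σ).map (restrictLin h) ≤ P'.M σ'

/-- Two structures are equivalent if they have a common subdivision. -/
def Equivalent (P P' : ConicalStructure X) : Prop :=
  ∃ Q : ConicalStructure X, Q.IsSubdivision P ∧ Q.IsSubdivision P'

/-- Every maximal cone has dimension `n`. -/
def PureDim (P : ConicalStructure X) (n : ℕ) : Prop :=
  ∀ σ : P.cones, (∀ τ : P.cones, (σ : Set X) ⊆ (τ : Set X) → τ = σ) → P.dim σ = n

/-- `y = lam • x` in some cone of `P` (hence in every cone that contains `x`). -/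
def IsSMul (P : ConicalStructure X) (lam : ℝ) (x y : X) : Prop :=
  ∃ (σ : P.cones) (hx : x ∈ (σ : Set X)) (hy : y ∈ (σ : Set X)),
    ∀ u ∈ P.M σ, u ⟨y, hy⟩ = lam * u ⟨x, hx⟩

/-- `φ` is defined on `P`: it is linear on every cone of `P`. -/
def PL (P : ConicalStructure X) (φ : X → ℝ) : Prop :=
  ∀ σ : P.cones, ∃ u ∈ P.M σ, ∀ x : (σ : Set X), φ x = u x

/-- `ι` is linear and injective on every cone of `P`. -/
def IsQuasiEmbedding (P : ConicalStructure X) {N : Type*} [AddCommGroup N] [Module ℝ N]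
    (ι : X → N) : Prop :=
  ∀ σ : P.cones,
    (∃ L : Module.Dual ℝ (P.M σ) →ₗ[ℝ] N, ∀ x : (σ : Set X), ι x = L (evalDual (P.M σ) x)) ∧
    Set.InjOn ι (σ : Set X)

open Classical in
/-- Pull-back to a subdivision `P'` of a `k`-dimensional weight `c` on `P`. Its value at a cone
`σ'` is `c σ` if the smallest cone `σ` of `P` containing `σ'` has the dimension of `σ'`, and `0`
otherwise (the sum has at most one term). -/
noncomputable def pullback (P P' : ConicalStructure X) (c : P.cones → ℝ) (σ' : P'.cones) : ℝ :=
  ∑ σ ∈ Finset.univ.filter (fun σ : P.cones => (σ' : Set X) ⊆ (σ : Set X) ∧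
      (∀ τ : P.cones, (σ' : Set X) ⊆ (τ : Set X) → (σ : Set X) ⊆ (τ : Set X)) ∧
      P.dim σ = P'.dim σ'), c σ

end ConicalStructure

/-! ### Euclidean conical spaces and tropical cycles -/

/-- A Euclidean conical space with quasi-embedding `ι` in the Euclidean vector space `N`. The
equivalence class of conical structures is recorded by a representative `base` on whose cones
`ι` is linear and injective. -/
structure EuclideanConicalSpace (X : Type*) [TopologicalSpace X]
    (N : Type*) [NormedAddCommGroup N] [InnerProductSpace ℝ N] where
  base : ConicalStructure X
  ι : X → N
  quasi : base.IsQuasiEmbedding ι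

namespace EuclideanConicalSpace

variable {X : Type*} [TopologicalSpace X] {N : Type*} [NormedAddCommGroup N]
  [InnerProductSpace ℝ N]

/-- `P` is a conical complex on the quasi-embedded conical space, i.e. `P ∈ R(X)`. -/
def IsComplex (E : EuclideanConicalSpace X N) (P : ConicalStructure X) : Prop :=
  E.base.Equivalent P ∧ P.IsQuasiEmbedding E.ι

/-- The space is of pure dimension `n`. -/
def PureDim (E : EuclideanConicalSpace X N) (n : ℕ) : Prop := E.base.PureDim n

/-- `v` is the Euclidean normal vector of `σ` relative to its facet `τ`: the unit vector in the
span of `σ`, orthogonal to `τ` and pointing in the direction of `σ`. -/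
def IsNormalVec (E : EuclideanConicalSpace X N) (σ τ : Set X) (v : N) : Prop :=
  v ∈ Submodule.span ℝ (E.ι '' σ) ∧ ‖v‖ = 1 ∧ (∀ x ∈ τ, inner ℝ v (E.ι x) = 0) ∧
    ∀ x ∈ σ, 0 ≤ inner ℝ v (E.ι x)

/-- The Euclidean normal vector of `σ` relative to its facet `τ`. -/
noncomputable def normalVec (E : EuclideanConicalSpace X N) (σ τ : Set X) : N :=
  Classical.epsilon (E.IsNormalVec σ τ)

/-- A linear form `φ_σ` on `N` with `φ = φ_σ ∘ ι` on `σ` (its values on the span of `ι(σ)` are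
determined by `φ`). -/
noncomputable def linExt (E : EuclideanConicalSpace X N) (φ : X → ℝ) (σ : Set X) :
    Module.Dual ℝ N :=
  Classical.epsilon fun l => ∀ x ∈ σ, φ x = l (E.ι x)

open Classical in
/-- `c` is a `k`-dimensional Euclidean Minkowski weight on `P`. -/
def IsMinkowski (E : EuclideanConicalSpace X N) (P : ConicalStructure X) (k : ℕ)
    (c : P.cones → ℝ) : Prop :=
  (∀ σ : P.cones, P.dim σ ≠ k → c σ = 0) ∧
  ∀ τ : P.cones, P.dim τ + 1 = k →
    ∑ σ : P.cones with P.dim σ = k ∧ P.Face τ σ, c σ • E.normalVec σ τ = 0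

open Classical in
/-- The tropical intersection product `φ · c` of a piecewise linear function `φ` defined on `P`
with a `k`-dimensional Minkowski weight `c`; it is a `(k - 1)`-dimensional weight. -/
noncomputable def inter (E : EuclideanConicalSpace X N) (P : ConicalStructure X) (k : ℕ)
    (φ : X → ℝ) (c : P.cones → ℝ) (τ : P.cones) : ℝ :=
  if P.dim τ + 1 = k then
    ∑ σ : P.cones with P.dim σ = k ∧ P.Face τ σ, -(E.linExt φ σ (E.normalVec σ τ)) * c σ
  else 0

/-- The iterated product `φ₁ · (φ₂ · (⋯ (φ_r · c)))` with an `n`-dimensional weight `c`,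
for `r ≤ n`. -/
noncomputable def interList (E : EuclideanConicalSpace X N) (P : ConicalStructure X) (n : ℕ)
    (c : P.cones → ℝ) : List (X → ℝ) → (P.cones → ℝ)
  | [] => c
  | φ :: l => E.inter P (n - l.length) φ (E.interList P n c l)

/-- Minkowski weights `c` on `P` and `c'` on `P'` define the same tropical cycle, that is, the
same element of the direct limit of the groups of Minkowski weights over all conical complexes:
their pull-backs to some common subdivision agree. -/
def SameCycle (E : EuclideanConicalSpace X N) (P : ConicalStructure X) (c : P.cones → ℝ)
    (P' : ConicalStructure X) (c' : P'.cones → ℝ) : Prop :=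
  ∃ Q : ConicalStructure X, E.IsComplex Q ∧ Q.IsSubdivision P ∧ Q.IsSubdivision P' ∧
    P.pullback Q c = P'.pullback Q c'

/-- The tropical `k`-cycle of the weight `c` is positive: it is represented by a non-negative
Minkowski weight. -/
def IsPositiveCycle (E : EuclideanConicalSpace X N) (k : ℕ) (P : ConicalStructure X)
    (c : P.cones → ℝ) : Prop :=
  ∃ (P' : ConicalStructure X) (c' : P'.cones → ℝ), E.IsComplex P' ∧ E.IsMinkowski P' k c' ∧
    (∀ σ, 0 ≤ c' σ) ∧ E.SameCycle P c P' c'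

/-- A balancing condition `[X]`: a tropical `n`-cycle represented by a Minkowski weight on some
complex that is strictly positive on all `n`-dimensional cones. -/
structure Balancing (E : EuclideanConicalSpace X N) (n : ℕ) where
  complex : ConicalStructure X
  isComplex : E.IsComplex complex
  weight : complex.cones → ℝ
  isMinkowski : E.IsMinkowski complex n weight
  pos : ∀ σ : complex.cones, complex.dim σ = n → 0 < weight σ

/-- `φ` is a piecewise linear function on the space. -/
def IsPL (E : EuclideanConicalSpace X N) (φ : X → ℝ) : Prop :=
  ∃ P : ConicalStructure X, E.IsComplex P ∧ P.PL φ

/-- The tropical cycle `φ₁ ⋯ φ_r · [X]` is positive. It is computed on a complex on which all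
`φᵢ` are defined and `[X]` is represented by a weight. -/
def ProductPositive (E : EuclideanConicalSpace X N) {n : ℕ} (B : E.Balancing n)
    (l : List (X → ℝ)) : Prop :=
  ∃ (P : ConicalStructure X) (c : P.cones → ℝ), E.IsComplex P ∧ E.IsMinkowski P n c ∧
    E.SameCycle B.complex B.weight P c ∧ (∀ φ ∈ l, P.PL φ) ∧
    E.IsPositiveCycle (n - l.length) P (E.interList P n c l)

/-! ### Conical functions -/

/-- The unit sphere `S^X`. -/
def sphere (E : EuclideanConicalSpace X N) : Set X := {x | ‖E.ι x‖ = 1}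

/-- The space `Conic(X)` of conical functions; as a subtype of `X → ℝ` it carries the topology of
pointwise convergence. -/
def Conic (E : EuclideanConicalSpace X N) : Set (X → ℝ) :=
  {f | ∀ (lam : ℝ) (x y : X), 0 ≤ lam → E.base.IsSMul lam x y → f y = lam * f x}

/-- Admissible families of concave functions. -/
structure IsAdmissible (E : EuclideanConicalSpace X N) {n : ℕ} (B : E.Balancing n)
    (C : Set (X → ℝ)) : Prop where
  isPL : ∀ φ ∈ C, E.IsPL φ
  positive : ∀ l : List (X → ℝ), (∀ φ ∈ l, φ ∈ C) → l.length ≤ n → E.ProductPositive B l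
  add_mem : ∀ φ ∈ C, ∀ ψ ∈ C, φ + ψ ∈ C
  smul_mem : ∀ a : ℝ, 0 < a → ∀ φ ∈ C, a • φ ∈ C
  /-- `C - C` is dense in the continuous functions on the sphere, for uniform convergence. -/
  dense : ∀ g : C(E.sphere, ℝ), ∀ ε : ℝ, 0 < ε → ∃ φ ∈ C, ∃ ψ ∈ C,
    ∀ x : E.sphere, |(φ x - ψ x) - g x| < ε

/-- The space of `C`-concave conical functions: the closure of `C` in `Conic(X)`, for pointwise
convergence. -/
def ConicConcave (E : EuclideanConicalSpace X N) (C : Set (X → ℝ)) : Set E.Conic :=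
  closure {f : E.Conic | (f : X → ℝ) ∈ C}

/-- Restriction of a `C`-concave function to the sphere, with values in the space of functions on
the sphere with the topology of uniform convergence. -/
def toSphere (E : EuclideanConicalSpace X N) (C : Set (X → ℝ)) (f : E.ConicConcave C) :
    UniformFun E.sphere ℝ :=
  UniformFun.ofFun fun x => (f : E.Conic).1 x

end EuclideanConicalSpace

/-! The core is local equicontinuity. If finitely many values of a function φ in the family are
known up to an error, then the oscillation of φ near a point is bounded independently of φ
(`exists_eventually_abs_sub_le`). By compactness of the sphere, closeness at finitely many points
forces uniform closeness, and this passes to the closure. In the other direction, the value of a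
conical function at a point is a multiple of its value at a point of the sphere.

The positivity that drives this is that of φ · [X]. A generic linear projection `p` to ℝⁿ is
injective on the spans of the top-dimensional cones, so `j = p ∘ ι` resembles a finite branched
covering, with multiplicity weight times |det p| on each sheet. Balancing says that the total
multiplicity does not jump at a wall; positivity of φ · [X] says that the weighted sum of φ over the
fibres is concave across it (`exists_isConcaveAcrossWalls`). Following a generic line through the
walls yields midpoint concavity over any region of X that is separated from the rest over that line
(`IsConcaveAcrossWalls.sum_fiberValue_le`).

Lower bound: with a single top cone as region, φ is concave on it, hence superadditive by
homogeneity. Points near x₀ are (1 - r) x₀ plus a small combination of generators, so φ ≥ φ(x₀) - ε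
nearby (`exists_eventually_sub_le`). Upper bound: the region is the star of x₀, and the line starts
near the image of x₁ and has its midpoint near the image of x₀. All sheets stay above φ(x₀) - ε and
the midpoint values are close to φ(x₀), so no sheet can be much larger at x₁
(`exists_eventually_le`). The constants depend only on [X], because top cones of any complex inherit
span and weight from the balancing complex (`SameCycle.exists_eq`). -/

section

open Topology Filter

/-! ### Finitely generated cones -/

/-- Carathéodory's theorem for cones. -/
theorem exists_linearIndepOn_of_mem_hull {W : Type*} [AddCommGroup W] [Module ℝ W]
    (s : Finset W) {v : W} (hv : v ∈ PointedCone.hull ℝ (s : Set W)) :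
    ∃ t ⊆ s, LinearIndepOn ℝ id (t : Set W) ∧
      ∃ a : W → ℝ, (∀ i ∈ t, 0 ≤ a i) ∧ v = ∑ i ∈ t, a i • i := by
  classical
  have key : ∀ k : ℕ, ∀ t ⊆ s, t.card = k → ∀ a : W → ℝ, (∀ i ∈ t, 0 ≤ a i) →
      v = ∑ i ∈ t, a i • i → ∃ t ⊆ s, LinearIndepOn ℝ id (t : Set W) ∧
      ∃ a : W → ℝ, (∀ i ∈ t, 0 ≤ a i) ∧ v = ∑ i ∈ t, a i • i := by
    intro k
    induction k with
    | zero =>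
      intro t hts ht a ha hva
      rw [Finset.card_eq_zero] at ht
      subst ht
      exact ⟨∅, by simp, by simp, a, ha, hva⟩
    | succ k ih =>
      intro t hts ht a ha hva
      by_cases hli : LinearIndepOn ℝ id (t : Set W)
      · exact ⟨t, hts, hli, a, ha, hva⟩
      have : ∃ r : W → ℝ, ∑ i ∈ t, r i • i = 0 ∧ ∃ i ∈ t, 0 < r i := by
        rw [linearIndepOn_finset_iff] at hli
        push Not at hli
        obtain ⟨r, hr, i, hi, hri⟩ := hli
        simp only [id] at hr
        rcases lt_or_gt_of_ne hri with h | h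
        · exact ⟨fun i => - r i, by simp [hr], i, hi, by linarith⟩
        · exact ⟨r, hr, i, hi, h⟩
      obtain ⟨r, hr, i1, hi1, hri1⟩ := this
      -- Moving along the dependency `r`, the coefficient at the minimiser of `a i / r i` is the
      -- first to reach zero; the others are still non-negative.
      obtain ⟨i0, hi0, hmin⟩ := Finset.exists_min_image (t.filter fun i => 0 < r i)
        (fun i => a i / r i) ⟨i1, by simp [hi1, hri1]⟩
      rw [Finset.mem_filter] at hi0
      have hq : 0 ≤ a i0 / r i0 := div_nonneg (ha _ hi0.1) hi0.2.le
      refine ih (t.erase i0) ((Finset.erase_subset _ _).trans hts)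
        (by rw [Finset.card_erase_of_mem hi0.1, ht]; rfl) (fun i => a i - a i0 / r i0 * r i) ?_ ?_
      · intro i hi
        have hit := Finset.mem_of_mem_erase hi
        by_cases hri : 0 < r i
        · have := hmin i (by simp [hit, hri])
          rw [le_div_iff₀ hri] at this
          linarith
        · have := mul_nonneg hq (neg_nonneg.2 (not_lt.1 hri))
          have := ha i hit
          linarith
      · have h0 : (fun i => a i - a i0 / r i0 * r i) i0 • i0 = 0 := by
          have : r i0 ≠ 0 := hi0.2.ne'
          have : a i0 - a i0 / r i0 * r i0 = 0 := by field_simp; ring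
          simp only [this, zero_smul]
        rw [← add_zero (∑ i ∈ t.erase i0, _), ← h0,
          Finset.sum_erase_add (f := fun i => (a i - a i0 / r i0 * r i) • i) _ hi0.1]
        simp only [sub_smul, Finset.sum_sub_distrib, mul_smul, ← Finset.smul_sum, hr, smul_zero,
          sub_zero]
        exact hva
  rw [PointedCone.mem_hull_set] at hv
  obtain ⟨c, hc, hc0, rfl⟩ := hv
  exact key _ c.support (by exact_mod_cast hc) rfl c (fun i _ => hc0 i) rfl

variable {W : Type*} [NormedAddCommGroup W] [NormedSpace ℝ W] [FiniteDimensional ℝ W]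

/-- The cone over a linearly independent set, in coordinates. -/
theorem exists_coordinates {t : Finset W} (ht : LinearIndepOn ℝ id (t : Set W)) :
    ∃ g : W →L[ℝ] (t → ℝ), ∀ a : W → ℝ, ∀ i : t, g (∑ i ∈ t, a i • i) i = a i := by
  have hinj : LinearMap.ker (Fintype.linearCombination ℝ (fun i : t => (i : W))) = ⊥ :=
    LinearMap.ker_eq_bot.2 ht.fintypeLinearCombination_injective
  obtain ⟨g, hg⟩ := LinearMap.exists_leftInverse_of_injective _ hinj
  refine ⟨LinearMap.toContinuousLinearMap g, fun a i => ?_⟩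
  have h1 : ∑ i ∈ t, a i • i = Fintype.linearCombination ℝ (fun i : t => (i : W)) (fun i => a i) := by
    rw [Fintype.linearCombination_apply, Finset.univ_eq_attach,
      Finset.sum_attach t (fun i => a i • i)]
  rw [h1]
  exact congrFun (LinearMap.congr_fun hg (fun i => a i)) i

theorem isClosed_nonneg_combinations {t : Finset W} (ht : LinearIndepOn ℝ id (t : Set W)) :
    IsClosed {v : W | ∃ a : W → ℝ, (∀ i ∈ t, 0 ≤ a i) ∧ v = ∑ i ∈ t, a i • i} := by
  classical
  obtain ⟨g, hg⟩ := exists_coordinates ht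
  have : {v : W | ∃ a : W → ℝ, (∀ i ∈ t, 0 ≤ a i) ∧ v = ∑ i ∈ t, a i • i} =
      {v : W | (∀ i : t, 0 ≤ g v i) ∧ v = ∑ i : t, g v i • (i : W)} := by
    ext v
    constructor
    · rintro ⟨a, ha, rfl⟩
      refine ⟨fun i => by rw [hg]; exact ha i i.2, ?_⟩
      simp only [hg]
      rw [Finset.univ_eq_attach, Finset.sum_attach t (fun i => a i • i)]
    · rintro ⟨h1, h2⟩
      refine ⟨fun i => if h : i ∈ t then g v ⟨i, h⟩ else 0, fun i hi => by simp [hi, h1], ?_⟩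
      conv_lhs => rw [h2]
      rw [← Finset.sum_attach t, Finset.univ_eq_attach]
      exact Finset.sum_congr rfl fun i _ => by simp
  rw [this]
  have hc : ∀ i : t, Continuous fun v => g v i := fun i => (continuous_apply i).comp g.continuous
  apply IsClosed.inter
  · have : {v : W | ∀ i : t, 0 ≤ g v i} = ⋂ i : t, {v | 0 ≤ g v i} := by ext; simp
    have hcl : IsClosed {v : W | ∀ i : t, 0 ≤ g v i} := by
      rw [this]
      exact isClosed_iInter fun i => isClosed_le continuous_const (hc i)
    exact hcl
  · exact isClosed_eq continuous_id (continuous_finsetSum _ fun i _ => (hc i).smul continuous_const)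

theorem nonneg_combination_mem_hull {W : Type*} [AddCommGroup W] [Module ℝ W]
    {s t : Finset W} (hts : t ⊆ s) {a : W → ℝ}
    (ha : ∀ i ∈ t, 0 ≤ a i) : ∑ i ∈ t, a i • i ∈ PointedCone.hull ℝ (s : Set W) :=
  Submodule.sum_mem _ fun i hi => PointedCone.smul_mem _ (ha i hi)
    (PointedCone.subset_hull (hts hi))

/-- By Carathéodory the hull is a finite union of simplicial cones, each closed because its
coordinates are continuous. -/
theorem isClosed_hull_finset (s : Finset W) :
    IsClosed (PointedCone.hull ℝ (s : Set W) : Set W) := by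
  classical
  have : (PointedCone.hull ℝ (s : Set W) : Set W) =
      ⋃ t ∈ (s.powerset.filter fun t : Finset W => LinearIndepOn ℝ id (t : Set W)),
        {v : W | ∃ a : W → ℝ, (∀ i ∈ t, 0 ≤ a i) ∧ v = ∑ i ∈ t, a i • i} := by
    ext v
    simp only [Finset.mem_filter, Finset.mem_powerset, Set.mem_iUnion, SetLike.mem_coe]
    constructor
    · intro hv
      obtain ⟨t, hts, hli, h⟩ := exists_linearIndepOn_of_mem_hull s hv
      exact ⟨t, ⟨hts, hli⟩, h⟩
    · rintro ⟨t, ⟨hts, -⟩, a, ha, rfl⟩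
      exact nonneg_combination_mem_hull hts ha
  rw [this]
  refine isClosed_biUnion_finset fun t ht => isClosed_nonneg_combinations ?_
  exact (Finset.mem_filter.1 ht).2

/-- Near `x₀`, the points of a finitely generated cone are small conical perturbations of
multiples of `x₀` slightly smaller than `x₀`. -/
theorem eventually_eq_smul_add_small (s : Finset W) (x₀ : W) {η : ℝ}
    (hη : 0 < η) :
    ∀ᶠ x in 𝓝[(PointedCone.hull ℝ (s : Set W) : Set W)] x₀, ∃ r, 0 ≤ r ∧ r ≤ η ∧ r ≤ 1 ∧
      ∃ b : W → ℝ, (∀ i ∈ s, 0 ≤ b i ∧ b i ≤ η) ∧ x = (1 - r) • x₀ + ∑ i ∈ s, b i • i := by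
  classical
  have main : ∀ t ⊆ s, LinearIndepOn ℝ id (t : Set W) →
      ∀ᶠ x in 𝓝 x₀, (∃ a : W → ℝ, (∀ i ∈ t, 0 ≤ a i) ∧ x = ∑ i ∈ t, a i • i) →
        ∃ r, 0 ≤ r ∧ r ≤ η ∧ r ≤ 1 ∧
      ∃ b : W → ℝ, (∀ i ∈ s, 0 ≤ b i ∧ b i ≤ η) ∧ x = (1 - r) • x₀ + ∑ i ∈ s, b i • i := by
    intro t hts hli
    by_cases hx₀ : ∃ a : W → ℝ, (∀ i ∈ t, 0 ≤ a i) ∧ x₀ = ∑ i ∈ t, a i • i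
    swap
    · filter_upwards [(isClosed_nonneg_combinations hli).isOpen_compl.mem_nhds hx₀] with x hx h
      exact absurd h hx
    obtain ⟨a, ha, hxa⟩ := hx₀
    obtain ⟨g, hg⟩ := exists_coordinates hli
    have hS : 0 ≤ ∑ i ∈ t, a i := Finset.sum_nonneg ha
    -- At `x₀` the leftover coefficient of `i` is `r * a i`: below `η` by the third bound, and
    -- positive where `a i > 0`, so both persist nearby. Where `a i = 0` the leftover is the
    -- coefficient of `x` itself.
    obtain ⟨r, hr0, hrη, hr1, hra⟩ : ∃ r, 0 < r ∧ r ≤ η ∧ r ≤ 1 ∧ ∀ i ∈ t, r * a i < η := by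
      refine ⟨min 1 (min η (η / (2 * (1 + ∑ i ∈ t, a i)))), by positivity,
        (min_le_right _ _).trans (min_le_left _ _), min_le_left _ _, fun i hi => ?_⟩
      have h1 : a i ≤ ∑ i ∈ t, a i := Finset.single_le_sum ha hi
      calc _ ≤ η / (2 * (1 + ∑ i ∈ t, a i)) * a i :=
            mul_le_mul_of_nonneg_right ((min_le_right _ _).trans (min_le_right _ _)) (ha i hi)
        _ < η := by
            rw [div_mul_eq_mul_div, div_lt_iff₀ (by positivity)]
            nlinarith
    have hgi : ∀ i : t, Tendsto (fun x => g x i - (1 - r) * a i) (𝓝 x₀) (𝓝 (r * a i)) := by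
      intro i
      have h1 : Continuous fun x => g x i - (1 - r) * a i :=
        ((continuous_apply i).comp g.continuous).sub continuous_const
      have h2 := h1.tendsto x₀
      have h3 : g x₀ i = a i := by rw [hxa, hg]
      rw [h3] at h2
      convert h2 using 2
      ring
    have e1 : ∀ᶠ x in 𝓝 x₀, ∀ i : t, g x i - (1 - r) * a i < η :=
      eventually_all.2 fun i => (hgi i).eventually (gt_mem_nhds (hra i i.2))
    have e2 : ∀ᶠ x in 𝓝 x₀, ∀ i : t, 0 < a i → 0 < g x i - (1 - r) * a i := by
      refine eventually_all.2 fun i => ?_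
      by_cases h : 0 < a i
      · exact ((hgi i).eventually (lt_mem_nhds (mul_pos hr0 h))).mono fun _ h _ => h
      · exact Eventually.of_forall fun _ h' => absurd h' h
    filter_upwards [e1, e2] with x h1 h2
    rintro ⟨c, hc, rfl⟩
    simp only [hg] at h1 h2
    refine ⟨r, hr0.le, hrη, hr1, fun i => if i ∈ t then c i - (1 - r) * a i else 0, ?_, ?_⟩
    · intro i hi
      by_cases hit : i ∈ t
      · simp only [hit, if_true]
        refine ⟨?_, (h1 ⟨i, hit⟩).le⟩
        rcases (ha i hit).lt_or_eq with h | h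
        · exact (h2 ⟨i, hit⟩ h).le
        · rw [← h]; simpa using hc i hit
      · simp [hit, hη.le]
    · rw [← Finset.sum_subset hts (fun i _ hit => by simp [hit]), hxa, Finset.smul_sum,
        ← Finset.sum_add_distrib]
      refine Finset.sum_congr rfl fun i hi => ?_
      simp only [hi, if_true, smul_smul, ← add_smul]
      congr 1
      ring
  have main' : ∀ᶠ x in 𝓝 x₀, ∀ t ∈ s.powerset, LinearIndepOn ℝ id (t : Set W) →
      (∃ a : W → ℝ, (∀ i ∈ t, 0 ≤ a i) ∧ x = ∑ i ∈ t, a i • i) →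
        ∃ r, 0 ≤ r ∧ r ≤ η ∧ r ≤ 1 ∧
      ∃ b : W → ℝ, (∀ i ∈ s, 0 ≤ b i ∧ b i ≤ η) ∧ x = (1 - r) • x₀ + ∑ i ∈ s, b i • i := by
    rw [Filter.eventually_all_finset]
    intro t ht
    by_cases hli : LinearIndepOn ℝ id (t : Set W)
    · exact (main t (Finset.mem_powerset.1 ht) hli).mono fun x hx _ => hx
    · exact Eventually.of_forall fun x h => absurd h hli
  rw [eventually_nhdsWithin_iff]
  filter_upwards [main'] with x hx hxs
  obtain ⟨t, hts, hli, h⟩ := exists_linearIndepOn_of_mem_hull s hxs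
  exact hx t (Finset.mem_powerset.2 hts) hli h

theorem PointedCone.exists_sub_of_mem_span {W : Type*} [AddCommGroup W] [Module ℝ W]
    (K : PointedCone ℝ W) {v : W} (hv : v ∈ Submodule.span ℝ (K : Set W)) :
    ∃ a ∈ K, ∃ b ∈ K, v = a - b := by
  induction hv using Submodule.span_induction with
  | mem x hx => exact ⟨x, hx, 0, K.zero_mem, by simp⟩
  | zero => exact ⟨0, K.zero_mem, 0, K.zero_mem, by simp⟩
  | add x y _ _ hx hy =>
    obtain ⟨a, ha, b, hb, rfl⟩ := hx
    obtain ⟨a', ha', b', hb', rfl⟩ := hy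
    exact ⟨a + a', K.add_mem ha ha', b + b', K.add_mem hb hb', by abel⟩
  | smul r x _ hx =>
    obtain ⟨a, ha, b, hb, rfl⟩ := hx
    rcases le_total 0 r with h | h
    · exact ⟨r • a, K.smul_mem h ha, r • b, K.smul_mem h hb, by rw [smul_sub]⟩
    · exact ⟨(-r) • b, K.smul_mem (neg_nonneg.2 h) hb, (-r) • a, K.smul_mem (neg_nonneg.2 h) ha,
        by simp only [neg_smul, smul_sub]; abel⟩

/-- A point of a finitely generated cone lies either in its relative interior or in a proper
face. -/
theorem relint_or_face {K : PointedCone ℝ W} {s : Finset W}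
    (hK : K = PointedCone.hull ℝ (s : Set W)) {z : W} (hz : z ∈ K) :
    (∀ d ∈ Submodule.span ℝ (K : Set W), ∃ ε : ℝ, 0 < ε ∧ z + ε • d ∈ K) ∨
    ∃ l : W →ₗ[ℝ] ℝ, (∀ k ∈ K, 0 ≤ l k) ∧ l z = 0 ∧ ∃ k ∈ K, 0 < l k := by
  classical
  -- The dichotomy is whether adding `-z` to the generators gives all of the span. If so, `d = -c z
  -- + k` and the step `1 / (1 + c)` stays in `K`. If not, a separating form is non-negative on `K`
  -- and on `-z`, hence zero at `z`, and negative at `d`, hence not zero on `K`.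
  by_cases h : ∀ d ∈ Submodule.span ℝ (K : Set W),
      d ∈ PointedCone.hull ℝ ((insert (-z) s : Finset W) : Set W)
  · left
    intro d hd
    have h1 := h d hd
    rw [Finset.coe_insert, PointedCone.hull, Submodule.mem_span_insert] at h1
    obtain ⟨c, k, hk, rfl⟩ := h1
    change k ∈ PointedCone.hull ℝ (s : Set W) at hk
    rw [← hK] at hk
    have hc : 0 ≤ (c : ℝ) := c.2
    refine ⟨1 / (1 + c), by positivity, ?_⟩
    have : z + (1 / (1 + (c : ℝ))) • (c • -z + k) =
        (1 / (1 + (c : ℝ))) • z + (1 / (1 + (c : ℝ))) • k := by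
      have e : (c • -z : W) = (c : ℝ) • -z := rfl
      rw [e, smul_add, ← add_assoc]
      congr 1
      rw [smul_neg, smul_neg, ← sub_eq_add_neg, smul_smul]
      nth_rewrite 1 [← one_smul ℝ z]
      rw [← sub_smul]
      congr 1
      field_simp
      ring
    rw [this]
    exact K.add_mem (K.smul_mem (by positivity) hz) (K.smul_mem (by positivity) hk)
  · right
    push Not at h
    obtain ⟨d, hd, hdn⟩ := h
    let C : ProperCone ℝ W := ⟨PointedCone.hull ℝ ((insert (-z) s : Finset W) : Set W),
      isClosed_hull_finset _⟩
    obtain ⟨f, hf, hfd⟩ := C.hyperplane_separation_point (x₀ := d) hdn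
    have hfs : ∀ k ∈ K, 0 ≤ f k := by
      intro k hk
      apply hf
      rw [hK] at hk
      exact Submodule.span_mono (by simp) hk
    refine ⟨f.toLinearMap, hfs, ?_, ?_⟩
    · have h1 : 0 ≤ f (-z) := hf _ (PointedCone.subset_hull (by simp))
      rw [map_neg] at h1
      exact le_antisymm (by simpa using h1) (hfs z hz)
    · by_contra hcon
      push Not at hcon
      obtain ⟨a, ha, b, hb, rfl⟩ := K.exists_sub_of_mem_span hd
      have h1 : f b ≤ 0 := hcon b hb
      have h2 := hfs a ha
      rw [map_sub] at hfd
      linarith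

/-- On the ray `k + θ k'` each subspace is hit at most once, as two hits would put both `k` and `k'`
into it; infinitely many `θ > 0` are available. -/
theorem PointedCone.exists_forall_notMem {W : Type*} [AddCommGroup W] [Module ℝ W]
    (K : PointedCone ℝ W) {S : Set (Submodule ℝ W)} (hS : S.Finite)
    (h : ∀ V ∈ S, ¬ (K : Set W) ⊆ V) : ∃ k ∈ K, ∀ V ∈ S, k ∉ V := by
  induction S, hS using Set.Finite.induction_on with
  | empty => exact ⟨0, K.zero_mem, by simp⟩
  | @insert V S hV hS ih =>
    obtain ⟨k, hk, hkS⟩ := ih fun V' hV' => h V' (Set.mem_insert_of_mem _ hV')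
    obtain ⟨k', hk', hkV⟩ := Set.not_subset.1 (h V (Set.mem_insert _ _))
    have hfin : (⋃ V' ∈ insert V S, {θ : ℝ | k + θ • k' ∈ V'}).Finite := by
      refine (hS.insert V).biUnion fun V' hV' => Set.Subsingleton.finite ?_
      intro θ hθ θ' hθ'
      by_contra hne
      have h1 : (θ - θ') • k' ∈ V' := by
        have := V'.sub_mem hθ hθ'
        rwa [add_sub_add_left_eq_sub, ← sub_smul] at this
      have h2 : k' ∈ V' := (V'.smul_mem_iff (sub_ne_zero.2 hne)).1 h1
      rcases hV' with rfl | hV'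
      · exact hkV h2
      · refine hkS V' hV' ?_
        have := V'.sub_mem hθ (V'.smul_mem θ h2)
        rwa [add_sub_cancel_right] at this
    obtain ⟨θ, hθ, hθn⟩ := (Set.Ioi_infinite (0 : ℝ)).exists_notMem_finite hfin
    refine ⟨k + θ • k', K.add_mem hk (K.smul_mem (le_of_lt hθ) hk'), fun V' hV' hmem => hθn ?_⟩
    exact Set.mem_biUnion hV' hmem

end

section

open Topology Filter

/-! ### Generic projections, generic lines and multiplicities -/

/-- One coordinate at a time: some form `l` vanishes identically on no nonzero `V`, since finitely
many proper annihilators do not cover the dual, and intersecting with `ker l` lowers every positive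
dimension. -/
theorem exists_linearMap_injOn {N : Type*} [AddCommGroup N] [Module ℝ N] [FiniteDimensional ℝ N]
    (n : ℕ) {S : Set (Submodule ℝ N)} (hS : S.Finite) (hn : ∀ V ∈ S, Module.finrank ℝ V ≤ n) :
    ∃ p : N →ₗ[ℝ] (Fin n → ℝ), ∀ V ∈ S, ∀ v ∈ V, p v = 0 → v = 0 := by
  induction n generalizing S with
  | zero =>
    refine ⟨0, fun V hV v hv _ => ?_⟩
    have : V = ⊥ := Submodule.finrank_eq_zero.1 (Nat.le_zero.1 (hn V hV))
    rw [this] at hv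
    exact hv
  | succ n ih =>
    obtain ⟨l, -, hl⟩ := (⊤ : PointedCone ℝ (Module.Dual ℝ N)).exists_forall_notMem
      (S := Submodule.dualAnnihilator '' (S \ {⊥})) ((hS.subset Set.sdiff_subset).image _) (by
        rintro _ ⟨V, ⟨hV, hV0⟩, rfl⟩ h
        apply hV0
        refine Subspace.dualAnnihilator_inj.1 ?_
        rw [Submodule.dualAnnihilator_bot, eq_top_iff]
        exact fun x _ => h trivial)
    obtain ⟨p, hp⟩ := ih (S := (fun V => V ⊓ LinearMap.ker l) '' S) (hS.image _) (by
      rintro _ ⟨V, hV, rfl⟩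
      by_cases hV0 : V = ⊥
      · subst hV0
        have h0 : Module.finrank ℝ (⊥ ⊓ LinearMap.ker l : Submodule ℝ N) = 0 := by
          rw [bot_inf_eq, finrank_bot]
        exact h0.le.trans (Nat.zero_le n)
      · have h1 := hl _ ⟨V, ⟨hV, hV0⟩, rfl⟩
        have h2 : V ⊓ LinearMap.ker l < V := by
          refine inf_lt_left.2 fun h => h1 ?_
          rw [Submodule.mem_dualAnnihilator]
          exact fun w hw => h hw
        have h3 := Submodule.finrank_lt_finrank_of_lt h2
        have h4 := hn V hV
        simp only
        omega)
    refine ⟨LinearMap.pi (Fin.cons l fun i => LinearMap.proj i ∘ₗ p), fun V hV v hv h => ?_⟩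
    have h0 : l v = 0 := by simpa using congrFun h 0
    refine hp _ ⟨V, hV, rfl⟩ v ⟨hv, h0⟩ ?_
    ext i
    simpa using congrFun h i.succ

theorem dense_forall_add_notMem {W : Type*} [NormedAddCommGroup W] [NormedSpace ℝ W]
    [FiniteDimensional ℝ W] {S : Set (W × Submodule ℝ W)} (hS : S.Finite)
    (h : ∀ q ∈ S, q.2 ≠ ⊤) : Dense {a : W | ∀ q ∈ S, a + q.1 ∉ q.2} := by
  have : {a : W | ∀ q ∈ S, a + q.1 ∉ q.2} = ⋂ q ∈ S, {a : W | a + q.1 ∉ q.2} := by ext; simp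
  rw [this]
  have hcont : ∀ q : W × Submodule ℝ W, Continuous fun a : W => a + q.1 :=
    fun q => continuous_id.add continuous_const
  refine dense_biInter_of_isOpen (fun q _ => ?_) hS.countable fun q hq => ?_
  · exact (q.2.closed_of_finiteDimensional.isOpen_compl).preimage (hcont q)
  · have h1 : Dense ((q.2 : Set W)ᶜ) := by
      rw [← interior_eq_empty_iff_dense_compl]
      by_contra hne
      exact h q hq (Submodule.eq_top_of_nonempty_interior' _ (Set.nonempty_iff_ne_empty.2 hne))
    exact h1.preimage (Homeomorph.addRight q.1).isOpenMap

/-- The line `t ↦ a + t b` is generic on `[0, 2]` for a family of proper subspaces: `b` lies in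
none of them, the line avoids those of codimension at least two, and the points with parameter
`0`, `1`, `2` lie in none of them. -/
structure IsGenericLine {W : Type*} [AddCommGroup W] [Module ℝ W] (S : Set (Submodule ℝ W))
    (a b : W) : Prop where
  dir : ∀ H ∈ S, b ∉ H
  avoid : ∀ H ∈ S, Module.finrank ℝ H + 2 ≤ Module.finrank ℝ W → ∀ t : ℝ, a + t • b ∉ H
  zero : ∀ H ∈ S, a ∉ H
  one : ∀ H ∈ S, a + b ∉ H
  two : ∀ H ∈ S, a + (2 : ℝ) • b ∉ H

/-- The substitution of `2 - t` for `t`; it lets the half from the midpoint to the far end be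
treated like the first half. -/
theorem IsGenericLine.reverse {W : Type*} [AddCommGroup W] [Module ℝ W]
    {S : Set (Submodule ℝ W)} {a b : W} (h : IsGenericLine S a b) :
    IsGenericLine S (a + (2 : ℝ) • b) (-b) where
  dir H hH hb := h.dir H hH (by simpa using hb)
  avoid H hH hd t ht := h.avoid H hH hd (2 - t) (by
    convert ht using 1; rw [sub_smul, smul_neg]; abel)
  zero := h.two
  one H hH := by convert h.one H hH using 2; rw [two_smul]; abel
  two H hH := by convert h.zero H hH using 2; rw [smul_neg]; abel

/-- The direction `b` is fixed before `a`. A line in direction `b` meets `H` only if `a ∈ H ⊔ span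
{b}`, which is still proper when `H` has codimension at least two. -/
theorem exists_isGenericLine {W : Type*} [NormedAddCommGroup W] [NormedSpace ℝ W]
    [FiniteDimensional ℝ W] {S : Set (Submodule ℝ W)} (hS : S.Finite) (h : ∀ H ∈ S, H ≠ ⊤)
    {U V : Set W} (hU : IsOpen U) (hV : IsOpen V) (hU0 : U.Nonempty) (hV0 : V.Nonempty) :
    ∃ a b, IsGenericLine S a b ∧ a ∈ U ∧ a + b ∈ V := by
  obtain ⟨u, hu⟩ := hU0
  obtain ⟨v, hv⟩ := hV0
  have h1 : IsOpen {b : W | u + b ∈ V} := hV.preimage (continuous_const.add continuous_id)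
  obtain ⟨b, hb1, hb2⟩ := (dense_forall_add_notMem (S := (fun H => ((0 : W), H)) '' S)
    (hS.image _) (by rintro _ ⟨H, hH, rfl⟩; exact h H hH)).exists_mem_open h1 ⟨v - u, by simpa⟩
  have h2 : IsOpen (U ∩ {a : W | a + b ∈ V}) :=
    hU.inter (hV.preimage (continuous_id.add continuous_const))
  obtain ⟨a, ha1, ha2⟩ := (dense_forall_add_notMem
    (S := (fun q : W × Submodule ℝ W => q) '' (({0, b, (2 : ℝ) • b} : Set W) ×ˢ S) ∪
      (fun H => ((0 : W), H ⊔ Submodule.span ℝ {b})) ''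
        {H ∈ S | Module.finrank ℝ H + 2 ≤ Module.finrank ℝ W})
    (((Set.Finite.prod (by simp) hS).image _).union ((hS.subset (Set.sep_subset _ _)).image _)) (by
      rintro _ (⟨⟨x, H⟩, ⟨-, hH⟩, rfl⟩ | ⟨H, ⟨hH, hd⟩, rfl⟩)
      · exact h H hH
      · intro htop
        have h3 := Submodule.finrank_add_le_finrank_add_finrank H (Submodule.span ℝ {b})
        have h4 : Module.finrank ℝ (Submodule.span ℝ {b}) ≤ 1 := by
          simpa using finrank_span_le_card (R := ℝ) ({b} : Set W)
        simp only at htop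
        rw [htop, finrank_top] at h3
        omega)).exists_mem_open h2 ⟨u, hu, hb2⟩
  have hb : ∀ H ∈ S, b ∉ H := fun H hH => by simpa using hb1 _ ⟨H, hH, rfl⟩
  have hax : ∀ x ∈ ({0, b, (2 : ℝ) • b} : Set W), ∀ H ∈ S, a + x ∉ H := fun x hx H hH =>
    ha1 (x, H) (Or.inl ⟨(x, H), ⟨hx, hH⟩, rfl⟩)
  refine ⟨a, b, ⟨hb, ?_, ?_, hax _ (by simp), hax _ (by simp)⟩, ha2.1, ha2.2⟩
  · intro H hH hd t ht
    refine ha1 (0, H ⊔ Submodule.span ℝ {b}) (Or.inr ⟨H, ⟨hH, hd⟩, rfl⟩) ?_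
    have := Submodule.add_mem_sup ht (Submodule.smul_mem _ (-t)
      (Submodule.mem_span_singleton_self (R := ℝ) b))
    simpa using this
  · intro H hH
    simpa using hax 0 (by simp) H hH

/-- The multiplicity of a linear map on a subspace: the absolute value of its determinant in an
orthonormal basis. -/
theorem exists_multiplicity {N : Type*} [NormedAddCommGroup N] [InnerProductSpace ℝ N]
    [FiniteDimensional ℝ N] {n : ℕ} (p : N →ₗ[ℝ] (Fin n → ℝ)) (V : Submodule ℝ N)
    (hV : Module.finrank ℝ V = n) (hp : ∀ v ∈ V, p v = 0 → v = 0) :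
    ∃ m : ℝ, 0 < m ∧ ∀ e : Fin n → N, Orthonormal ℝ e → (∀ i, e i ∈ V) →
      |Matrix.detRowAlternating fun i => p (e i)| = m := by
  let e₀ : OrthonormalBasis (Fin n) ℝ V := (stdOrthonormalBasis ℝ V).reindex (finCongr hV)
  let T : V →ₗ[ℝ] (Fin n → ℝ) := p ∘ₗ V.subtype
  let ω : V [⋀^Fin n]→ₗ[ℝ] ℝ := Matrix.detRowAlternating.compLinearMap T
  -- Two orthonormal bases differ by determinant `±1`.
  have hω : ∀ f : OrthonormalBasis (Fin n) ℝ V, |ω f| = |ω e₀| := by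
    intro f
    have h1 : ω f = (ω e₀ • e₀.toBasis.det) f := by
      conv_lhs => rw [AlternatingMap.eq_smul_basis_det e₀.toBasis ω]
      simp
    rw [h1]
    rcases e₀.det_to_matrix_orthonormalBasis_real f with h | h <;> simp [h]
  refine ⟨|ω e₀|, ?_, ?_⟩
  · rw [abs_pos]
    intro h0
    have hinj : Function.Injective T := by
      rw [← LinearMap.ker_eq_bot, LinearMap.ker_eq_bot']
      intro v hv
      exact Subtype.ext (hp v v.2 hv)
    have hli : LinearIndependent ℝ (fun i => T (e₀ i)) :=
      e₀.toBasis.linearIndependent.map' T (LinearMap.ker_eq_bot.2 hinj) |> fun h => by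
        simpa [Function.comp_def] using h
    have h1 := Matrix.linearIndependent_rows_iff_isUnit (A := Matrix.of fun i => T (e₀ i)) |>.1 hli
    rw [Matrix.isUnit_iff_isUnit_det] at h1
    exact h1.ne_zero h0
  · intro e he heV
    have he' : Orthonormal ℝ (fun i => (⟨e i, heV i⟩ : V)) :=
      ⟨fun i => he.1 i, fun i j hij => he.2 hij⟩
    have hspan : ⊤ ≤ Submodule.span ℝ (Set.range fun i => (⟨e i, heV i⟩ : V)) := by
      rw [he'.linearIndependent.span_eq_top_of_card_eq_finrank' (by simp [hV])]
    rw [← hω (OrthonormalBasis.mk he' hspan)]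
    congr 1
    simp [ω, T]

end

section

open Topology Filter

/-! ### Conical structures through a quasi-embedding -/

namespace ConicalStructure

set_option linter.unusedSectionVars false

variable {X : Type*} [TopologicalSpace X] {P Q : ConicalStructure X}
  {W : Type*} [NormedAddCommGroup W] [NormedSpace ℝ W] [FiniteDimensional ℝ W] {j : X → W}

/-- Every vector of the dual is a difference of two points of the full-dimensional cone, so
injectivity on the cone gives injectivity of the linear map. -/
theorem exists_injective_linearMap (hP : P.IsQuasiEmbedding j) (σ : P.cones) :
    ∃ L : Module.Dual ℝ (P.M σ) →ₗ[ℝ] W, Function.Injective L ∧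
      ∀ x : (σ : Set X), j x = L (evalDual (P.M σ) x) := by
  obtain ⟨⟨L, hL⟩, hinj⟩ := hP σ
  refine ⟨L, ?_, hL⟩
  rw [← LinearMap.ker_eq_bot, LinearMap.ker_eq_bot']
  intro w hw
  obtain ⟨s, hs⟩ := P.polyhedral σ
  have hw' : w ∈ Submodule.span ℝ (PointedCone.hull ℝ (s : Set (Module.Dual ℝ (P.M σ))) :
      Set (Module.Dual ℝ (P.M σ))) := by
    rw [← hs, P.full_dim σ]
    trivial
  obtain ⟨a, ha, b, hb, rfl⟩ := PointedCone.exists_sub_of_mem_span _ hw'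
  rw [← SetLike.mem_coe, ← hs] at ha hb
  obtain ⟨x, rfl⟩ := ha
  obtain ⟨y, rfl⟩ := hb
  rw [map_sub, ← hL, ← hL, sub_eq_zero] at hw
  rw [Subtype.ext (hinj x.2 y.2 hw), sub_self]

/-- Together with `exists_mem_of_form` this identifies the linear functions on a cone with
restrictions of linear forms on `W`, so that faces and topology can be read off from the image of
the cone. -/
theorem exists_form (hP : P.IsQuasiEmbedding j) (σ : P.cones) {u : C((σ : Set X), ℝ)}
    (hu : u ∈ P.M σ) : ∃ l : W →ₗ[ℝ] ℝ, ∀ x : (σ : Set X), u x = l (j x) := by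
  obtain ⟨L, hL, hj⟩ := exists_injective_linearMap hP σ
  obtain ⟨g, hg⟩ := LinearMap.exists_leftInverse_of_injective L (LinearMap.ker_eq_bot.2 hL)
  refine ⟨Module.Dual.eval ℝ _ ⟨u, hu⟩ ∘ₗ g, fun x => ?_⟩
  rw [hj, LinearMap.comp_apply, ← LinearMap.comp_apply, ← LinearMap.comp_apply,
    LinearMap.comp_assoc, hg]
  rfl

theorem exists_mem_of_form (hP : P.IsQuasiEmbedding j) (σ : P.cones) (l : W →ₗ[ℝ] ℝ) :
    ∃ u ∈ P.M σ, ∀ x : (σ : Set X), u x = l (j x) := by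
  have := P.finite_dim σ
  obtain ⟨L, hL, hj⟩ := exists_injective_linearMap hP σ
  refine ⟨((Module.evalEquiv ℝ (P.M σ)).symm (l ∘ₗ L)).1,
    ((Module.evalEquiv ℝ (P.M σ)).symm (l ∘ₗ L)).2, fun x => ?_⟩
  have := Module.apply_evalEquiv_symm_apply ℝ (P.M σ) (evalDual (P.M σ) x) (l ∘ₗ L)
  rw [LinearMap.comp_apply, ← hj] at this
  exact this

theorem exists_image_eq_hull (hP : P.IsQuasiEmbedding j) (σ : P.cones) :
    ∃ s : Finset W, j '' σ = (PointedCone.hull ℝ (s : Set W) : Set W) := by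
  classical
  obtain ⟨L, hL, hj⟩ := exists_injective_linearMap hP σ
  obtain ⟨s, hs⟩ := P.polyhedral σ
  refine ⟨s.image L, ?_⟩
  have h1 : j '' σ = L '' Set.range (evalDual (P.M σ)) := by
    rw [← Set.range_comp, Set.image_eq_range]
    exact congrArg Set.range (funext hj)
  rw [h1, hs, Finset.coe_image]
  have h2 := Submodule.map_span (L.restrictScalars NNReal) (s : Set (Module.Dual ℝ (P.M σ)))
  exact congrArg (fun K : Submodule NNReal W => (K : Set W)) h2

/-- Generators of the image of a cone. -/
noncomputable def gens (hP : P.IsQuasiEmbedding j) (σ : P.cones) : Finset W :=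
  (exists_image_eq_hull hP σ).choose

/-- The image of a cone under a quasi-embedding. -/
noncomputable def imageCone (hP : P.IsQuasiEmbedding j) (σ : P.cones) : PointedCone ℝ W :=
  PointedCone.hull ℝ (gens hP σ : Set W)

theorem coe_imageCone (hP : P.IsQuasiEmbedding j) (σ : P.cones) :
    (imageCone hP σ : Set W) = j '' σ :=
  (exists_image_eq_hull hP σ).choose_spec.symm

theorem mem_imageCone (hP : P.IsQuasiEmbedding j) {σ : P.cones} {w : W} :
    w ∈ imageCone hP σ ↔ ∃ x ∈ (σ : Set X), j x = w := by
  rw [← SetLike.mem_coe, coe_imageCone]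
  rfl

theorem apply_mem_imageCone (hP : P.IsQuasiEmbedding j) {σ : P.cones} {x : X}
    (hx : x ∈ (σ : Set X)) : j x ∈ imageCone hP σ :=
  (mem_imageCone hP).2 ⟨x, hx, rfl⟩

theorem isClosed_imageCone (hP : P.IsQuasiEmbedding j) (σ : P.cones) :
    IsClosed (imageCone hP σ : Set W) :=
  isClosed_hull_finset _

theorem injOn_cone (hP : P.IsQuasiEmbedding j) (σ : P.cones) : Set.InjOn j σ := (hP σ).2

theorem continuous_restrict_cone (hP : P.IsQuasiEmbedding j) (σ : P.cones) :
    Continuous fun x : (σ : Set X) => j x := by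
  let b := Module.finBasis ℝ W
  have h1 : Continuous fun x : (σ : Set X) => b.equivFunL (j x) := by
    refine continuous_pi fun i => ?_
    obtain ⟨u, -, hu⟩ := exists_mem_of_form hP σ (b.coord i)
    exact u.continuous.congr hu
  exact (b.equivFunL.symm.continuous.comp h1).congr fun x => b.equivFunL.symm_apply_apply _

/-- The evaluation map, an embedding, factors continuously through `j`. -/
theorem isEmbedding_restrict_cone (hP : P.IsQuasiEmbedding j) (σ : P.cones) :
    IsEmbedding fun x : (σ : Set X) => j x := by
  choose l hl using fun u : P.M σ => exists_form hP σ u.2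
  refine IsEmbedding.of_comp (continuous_restrict_cone hP σ)
    (g := fun (w : W) (u : P.M σ) => l u w) ?_ ?_
  · exact continuous_pi fun u => (l u).continuous_of_finiteDimensional
  · convert P.isEmbedding_eval σ using 1
    funext x u
    exact (hl u x).symm

theorem isClosedEmbedding_restrict_cone (hP : P.IsQuasiEmbedding j) (σ : P.cones) :
    IsClosedEmbedding fun x : (σ : Set X) => j x := by
  refine ⟨isEmbedding_restrict_cone hP σ, ?_⟩
  have : Set.range (fun x : (σ : Set X) => j x) = j '' σ := by rw [Set.image_eq_range]
  rw [this, ← coe_imageCone hP]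
  exact isClosed_imageCone hP σ

theorem continuous_of_forall_cone {Y : Type*} [TopologicalSpace Y] {f : X → Y}
    (h : ∀ σ : P.cones, Continuous fun x : (σ : Set X) => f x) : Continuous f := by
  have hlf : LocallyFinite (fun σ : P.cones => (σ : Set X)) := locallyFinite_of_finite _
  refine hlf.continuous ?_ (fun σ => P.isClosed_cone σ σ.2)
    fun σ => continuousOn_iff_continuous_domRestrict.2 (h σ)
  rw [← P.covers, Set.sUnion_eq_iUnion]

theorem exists_mem_cone (P : ConicalStructure X) (x : X) : ∃ σ : P.cones, x ∈ (σ : Set X) := by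
  have : x ∈ ⋃₀ P.cones := by rw [P.covers]; trivial
  obtain ⟨σ, hσ, hx⟩ := this
  exact ⟨⟨σ, hσ⟩, hx⟩

theorem continuous_quasiEmbedding (hP : P.IsQuasiEmbedding j) : Continuous j :=
  continuous_of_forall_cone (continuous_restrict_cone hP)

theorem PL.exists_form {φ : X → ℝ} (hφ : P.PL φ) (hP : P.IsQuasiEmbedding j) (σ : P.cones) :
    ∃ l : W →ₗ[ℝ] ℝ, ∀ x ∈ (σ : Set X), φ x = l (j x) := by
  obtain ⟨u, hu, h⟩ := hφ σ
  obtain ⟨l, hl⟩ := ConicalStructure.exists_form hP σ hu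
  exact ⟨l, fun x hx => (h ⟨x, hx⟩).trans (hl ⟨x, hx⟩)⟩

theorem PL.continuous {φ : X → ℝ} (hφ : P.PL φ) : Continuous φ :=
  continuous_of_forall_cone fun σ => by
    obtain ⟨u, -, h⟩ := hφ σ
    exact u.continuous.congr fun x => (h x).symm

/-- The linear span of the image of a set. -/
def spanImage (j : X → W) (σ : Set X) : Submodule ℝ W := Submodule.span ℝ (j '' σ)

theorem apply_mem_spanImage {σ : Set X} {x : X} (hx : x ∈ σ) : j x ∈ spanImage j σ :=
  Submodule.subset_span ⟨x, hx, rfl⟩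

theorem spanImage_mono {σ τ : Set X} (h : σ ⊆ τ) : spanImage j σ ≤ spanImage j τ :=
  Submodule.span_mono (Set.image_mono h)

theorem spanImage_eq (hP : P.IsQuasiEmbedding j) (σ : P.cones) :
    spanImage j σ = Submodule.span ℝ (imageCone hP σ : Set W) := by
  rw [coe_imageCone]
  rfl

theorem finrank_spanImage (hP : P.IsQuasiEmbedding j) (σ : P.cones) :
    Module.finrank ℝ (spanImage j (σ : Set X)) = P.dim σ := by
  have := P.finite_dim σ
  obtain ⟨L, hL, hj⟩ := exists_injective_linearMap hP σ
  have h1 : spanImage j (σ : Set X) = LinearMap.range L := by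
    have : j '' σ = L '' Set.range (evalDual (P.M σ)) := by
      rw [← Set.range_comp, Set.image_eq_range]
      exact congrArg Set.range (funext hj)
    rw [spanImage, this, Submodule.span_image, P.full_dim, Submodule.map_top]
  rw [h1, LinearMap.finrank_range_of_inj hL, Subspace.dual_finrank_eq]
  rfl

theorem dim_le_dim (hP : P.IsQuasiEmbedding j) (hQ : Q.IsQuasiEmbedding j) {σ : P.cones}
    {q : Q.cones} (h : (q : Set X) ⊆ σ) : Q.dim q ≤ P.dim σ := by
  rw [← finrank_spanImage hP, ← finrank_spanImage hQ]
  exact Submodule.finrank_mono (spanImage_mono h)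

theorem spanImage_eq_of_dim_le (hP : P.IsQuasiEmbedding j) (hQ : Q.IsQuasiEmbedding j)
    {σ : P.cones} {q : Q.cones} (h : (q : Set X) ⊆ σ) (hd : P.dim σ ≤ Q.dim q) :
    spanImage j (q : Set X) = spanImage j (σ : Set X) :=
  Submodule.eq_of_le_of_finrank_le (spanImage_mono h)
    (by rw [finrank_spanImage hP, finrank_spanImage hQ]; exact hd)

theorem isFaceOf_iff (hP : P.IsQuasiEmbedding j) {σ : P.cones} {τ : Set X} :
    IsFaceOf (P.M σ) τ ↔
      ∃ l : W →ₗ[ℝ] ℝ, (∀ x ∈ (σ : Set X), 0 ≤ l (j x)) ∧ τ = {x ∈ (σ : Set X) | l (j x) = 0} := by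
  have himg : ∀ v : ↥(σ : Set X) → ℝ, ∀ l : W →ₗ[ℝ] ℝ, (∀ x : (σ : Set X), v x = l (j x)) →
      (fun x : (σ : Set X) => (x : X)) '' {x | v x = 0} = {x ∈ (σ : Set X) | l (j x) = 0} := by
    intro v l h
    ext x
    constructor
    · rintro ⟨y, hy, rfl⟩
      exact ⟨y.2, by rw [← h]; exact hy⟩
    · rintro ⟨hx, hl⟩
      exact ⟨⟨x, hx⟩, by change v _ = 0; rw [h]; exact hl, rfl⟩
  constructor
  · rintro ⟨u, hu, h0, rfl⟩
    obtain ⟨l, hl⟩ := exists_form hP σ hu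
    exact ⟨l, fun x hx => by rw [← hl ⟨x, hx⟩]; exact h0 _, himg _ l hl⟩
  · rintro ⟨l, h0, rfl⟩
    obtain ⟨u, hu, h⟩ := exists_mem_of_form hP σ l
    exact ⟨u, hu, fun x => by rw [h]; exact h0 _ x.2, (himg _ l h).symm⟩

theorem isFaceOf_subset {σ : P.cones} {τ : Set X} (h : IsFaceOf (P.M σ) τ) : τ ⊆ σ := by
  obtain ⟨u, -, -, rfl⟩ := h
  rintro _ ⟨y, -, rfl⟩
  exact y.2

theorem Face.subset {σ τ : P.cones} (h : P.Face τ σ) : (τ : Set X) ⊆ σ := isFaceOf_subset h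

theorem isFaceOf_mem {σ : P.cones} {τ : Set X} (h : IsFaceOf (P.M σ) τ) : τ ∈ P.cones :=
  (P.face_mem σ τ h).1

/-- The spans coincide, so the form cutting out `τ` vanishes on all of `σ`. -/
theorem Face.eq_of_dim_le (hP : P.IsQuasiEmbedding j) {σ τ : P.cones} (h : P.Face τ σ)
    (hd : P.dim σ ≤ P.dim τ) : τ = σ := by
  have hs := spanImage_eq_of_dim_le hP hP h.subset hd
  obtain ⟨l, -, hτ⟩ := (isFaceOf_iff hP).1 h
  refine Subtype.ext (h.subset.antisymm fun x hx => ?_)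
  rw [hτ]
  refine ⟨hx, ?_⟩
  have h1 : spanImage j (τ : Set X) ≤ LinearMap.ker l := by
    rw [spanImage, Submodule.span_le]
    rintro _ ⟨y, hy, rfl⟩
    rw [hτ] at hy
    exact hy.2
  exact h1 (hs ▸ apply_mem_spanImage hx)

theorem exists_common_face {σ σ' : P.cones} {x : X} (hx : x ∈ (σ : Set X))
    (hx' : x ∈ (σ' : Set X)) : ∃ ρ : P.cones, x ∈ (ρ : Set X) ∧ P.Face ρ σ ∧ P.Face ρ σ' := by
  obtain ⟨F, hF, h⟩ := P.inter_faces σ σ'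
  have : x ∈ ⋃₀ F := h ▸ ⟨hx, hx'⟩
  obtain ⟨ρ, hρ, hxρ⟩ := this
  exact ⟨⟨ρ, isFaceOf_mem (hF ρ hρ).1⟩, hxρ, hF ρ hρ⟩

/-- A point of a cone lies in its relative interior or in a proper face. -/
theorem relint_or_mem_face (hP : P.IsQuasiEmbedding j) {σ : P.cones} {x : X}
    (hx : x ∈ (σ : Set X)) :
    (∀ d ∈ spanImage j (σ : Set X), ∃ ε : ℝ, 0 < ε ∧ j x + ε • d ∈ imageCone hP σ) ∨
    ∃ τ : P.cones, P.Face τ σ ∧ x ∈ (τ : Set X) ∧ P.dim τ < P.dim σ := by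
  rw [spanImage_eq hP]
  refine (relint_or_face (K := imageCone hP σ) rfl (apply_mem_imageCone hP hx)).imp_right ?_
  rintro ⟨l, hl, hl0, k, hk, hlk⟩
  have hf : IsFaceOf (P.M σ) {x ∈ (σ : Set X) | l (j x) = 0} :=
    (isFaceOf_iff hP).2 ⟨l, fun y hy => hl _ (apply_mem_imageCone hP hy), rfl⟩
  refine ⟨⟨_, isFaceOf_mem hf⟩, hf, ⟨hx, hl0⟩, ?_⟩
  by_contra hd
  obtain ⟨y, hy, rfl⟩ := (mem_imageCone hP).1 hk
  have := Face.eq_of_dim_le hP (show P.Face ⟨_, isFaceOf_mem hf⟩ σ from hf) (not_lt.1 hd)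
  have hy' : y ∈ {x ∈ (σ : Set X) | l (j x) = 0} := by
    have h2 := congrArg Subtype.val this
    simp only at h2
    rw [h2]
    exact hy
  exact hlk.ne' hy'.2

theorem exists_mem_forall_notMem (hP : P.IsQuasiEmbedding j) (σ : P.cones)
    {S : Set (Submodule ℝ W)} (hS : S.Finite) (h : ∀ V ∈ S, Module.finrank ℝ V < P.dim σ) :
    ∃ x ∈ (σ : Set X), ∀ V ∈ S, j x ∉ V := by
  obtain ⟨k, hk, hkS⟩ := (imageCone hP σ).exists_forall_notMem hS (by
    intro V hV hsub
    have h1 : spanImage j (σ : Set X) ≤ V := by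
      rw [spanImage_eq hP]
      exact Submodule.span_le.2 hsub
    have h2 := Submodule.finrank_mono h1
    rw [finrank_spanImage hP] at h2
    exact absurd h2 (not_le.2 (h V hV)))
  obtain ⟨x, hx, rfl⟩ := (mem_imageCone hP).1 hk
  exact ⟨x, hx, hkS⟩

/-- A cone has a point that lies on no cone of smaller dimension. -/
theorem exists_mem_generic (hP : P.IsQuasiEmbedding j) (σ : P.cones) :
    ∃ x ∈ (σ : Set X), ∀ ρ : P.cones, x ∈ (ρ : Set X) → P.dim σ ≤ P.dim ρ := by
  obtain ⟨x, hx, h⟩ := exists_mem_forall_notMem hP σ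
    (S := (fun ρ : P.cones => spanImage j (ρ : Set X)) '' {ρ | P.dim ρ < P.dim σ})
    ((Set.toFinite _).image _) (by
      rintro _ ⟨ρ, hρ, rfl⟩
      simp only [finrank_spanImage hP]
      exact hρ)
  refine ⟨x, hx, fun ρ hxρ => ?_⟩
  by_contra hd
  exact h _ ⟨ρ, not_le.1 hd, rfl⟩ (apply_mem_spanImage hxρ)

theorem IsSubdivision.isQuasiEmbedding (h : Q.IsSubdivision P) (hP : P.IsQuasiEmbedding j) :
    Q.IsQuasiEmbedding j := by
  intro q
  obtain ⟨σ, hqσ, hM⟩ := h q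
  obtain ⟨⟨L, hL⟩, hinj⟩ := hP σ
  refine ⟨?_, hinj.mono hqσ⟩
  let r : P.M σ →ₗ[ℝ] Q.M q :=
    ((restrictLin hqσ).domRestrict (P.M σ)).codRestrict (Q.M q)
      fun u => hM (Submodule.mem_map_of_mem u.2)
  refine ⟨L ∘ₗ r.dualMap, fun x => ?_⟩
  rw [hL ⟨x, hqσ x.2⟩]
  rfl

/-- Every cone is covered by the cones of the same dimension of a subdivision. -/
theorem IsSubdivision.exists_mem_subset (h : Q.IsSubdivision P) (hP : P.IsQuasiEmbedding j)
    {σ : P.cones} {x : X} (hx : x ∈ (σ : Set X)) :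
    ∃ q : Q.cones, x ∈ (q : Set X) ∧ (q : Set X) ⊆ σ ∧ Q.dim q = P.dim σ := by
  have hQ := h.isQuasiEmbedding hP
  -- A cone `q` through `y` lies in some `σ'`; the form cutting the common face of `σ` and `σ'` at
  -- `y` out of `σ'` also cuts a face of `q`, which contains `y` and lies in `σ`.
  have hcov : ∀ y ∈ (σ : Set X), ∃ q : Q.cones, y ∈ (q : Set X) ∧ (q : Set X) ⊆ σ := by
    intro y hy
    obtain ⟨q, hyq⟩ := Q.exists_mem_cone y
    obtain ⟨σ', hqσ', hM⟩ := h q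
    obtain ⟨ρ, hyρ, hρσ, hρσ'⟩ := exists_common_face hy (hqσ' hyq)
    obtain ⟨l, hl, hρ⟩ := (isFaceOf_iff hP).1 hρσ'
    have hf : IsFaceOf (Q.M q) {x ∈ (q : Set X) | l (j x) = 0} :=
      (isFaceOf_iff hQ).2 ⟨l, fun z hz => hl z (hqσ' hz), rfl⟩
    refine ⟨⟨_, isFaceOf_mem hf⟩, ⟨hyq, ?_⟩, fun z hz => hρσ.subset ?_⟩
    · rw [hρ] at hyρ
      exact hyρ.2
    · rw [hρ]
      exact ⟨hqσ' hz.1, hz.2⟩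
  by_contra! hcon
  have hlt : ∀ q : Q.cones, x ∈ (q : Set X) → (q : Set X) ⊆ σ → Q.dim q < P.dim σ :=
    fun q hxq hq => lt_of_le_of_ne (dim_le_dim hP hQ hq) (hcon q hxq hq)
  -- For generic `y` and small `s > 0`, the point `x + s y` avoids the spans of all smaller cones of
  -- `Q`, so it lies in a cone of full dimension inside `σ`. The union of those is closed, hence
  -- contains `x`.
  obtain ⟨y, hy, hyS⟩ := exists_mem_forall_notMem hP σ
    (S := (fun q : Q.cones => spanImage j (q : Set X)) '' {q | Q.dim q < P.dim σ})
    ((Set.toFinite _).image _) (by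
      rintro _ ⟨q, hq, rfl⟩
      simp only [finrank_spanImage hQ]
      exact hq)
  have hz : ∀ s : ℝ, 0 ≤ s → ∃ z ∈ (σ : Set X), j z = j x + s • j y := fun s hs =>
    (mem_imageCone hP).1 ((imageCone hP σ).add_mem (apply_mem_imageCone hP hx)
      ((imageCone hP σ).smul_mem hs (apply_mem_imageCone hP hy)))
  have hfin : (⋃ V ∈ (fun q : Q.cones => spanImage j (q : Set X)) '' {q | Q.dim q < P.dim σ},
      {s : ℝ | j x + s • j y ∈ V}).Finite := by
    refine ((Set.toFinite _).image _).biUnion fun V hV => Set.Subsingleton.finite ?_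
    intro s hs s' hs'
    by_contra hne
    have h1 : (s - s') • j y ∈ V := by
      have := V.sub_mem hs hs'
      rwa [add_sub_add_left_eq_sub, ← sub_smul] at this
    exact hyS V hV ((V.smul_mem_iff (sub_ne_zero.2 hne)).1 h1)
  have hcl : IsClosed (⋃ q ∈ {q : Q.cones | (q : Set X) ⊆ σ ∧ Q.dim q = P.dim σ}, (q : Set X)) :=
    (Set.toFinite _).isClosed_biUnion fun q _ => Q.isClosed_cone q q.2
  have hxn : x ∉ ⋃ q ∈ {q : Q.cones | (q : Set X) ⊆ σ ∧ Q.dim q = P.dim σ}, (q : Set X) := by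
    simp only [Set.mem_iUnion, not_exists]
    rintro q ⟨hq1, hq2⟩ hxq
    exact hcon q hxq hq1 hq2
  have hnhd : ((fun y : (σ : Set X) => (y : X)) ⁻¹'
      (⋃ q ∈ {q : Q.cones | (q : Set X) ⊆ σ ∧ Q.dim q = P.dim σ}, (q : Set X))ᶜ) ∈
      𝓝 (⟨x, hx⟩ : (σ : Set X)) :=
    (hcl.isOpen_compl.preimage continuous_subtype_val).mem_nhds hxn
  rw [(isEmbedding_restrict_cone hP σ).nhds_eq_comap, Filter.mem_comap] at hnhd
  obtain ⟨U, hU, hUsub⟩ := hnhd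
  have htend : Tendsto (fun s : ℝ => j x + s • j y) (𝓝[>] 0) (𝓝 (j x)) := by
    have : Continuous fun s : ℝ => j x + s • j y := by fun_prop
    simpa using (this.tendsto 0).mono_left nhdsWithin_le_nhds
  have hev : ∀ᶠ s : ℝ in 𝓝[>] 0, s ∉ ⋃ V ∈ (fun q : Q.cones => spanImage j (q : Set X)) ''
      {q | Q.dim q < P.dim σ}, {s : ℝ | j x + s • j y ∈ V} := by
    -- The parameter `0` is removed because `x` itself may lie in a small span.
    have := (hfin.subset (Set.sdiff_subset (t := {0}))).isClosed.isOpen_compl.mem_nhds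
      (x := (0 : ℝ)) (by simp)
    filter_upwards [nhdsWithin_le_nhds this, self_mem_nhdsWithin] with s hs h0 hmem
    exact hs ⟨hmem, ne_of_gt h0⟩
  obtain ⟨s, hs0, hsU, hsV⟩ :=
    (((eventually_mem_nhdsWithin (s := Set.Ioi (0 : ℝ)) (a := 0))).and
      ((htend.eventually hU).and hev)).exists
  obtain ⟨z, hzσ, hjz⟩ := hz s (le_of_lt hs0)
  obtain ⟨q, hzq, hqσ⟩ := hcov z hzσ
  have hd : Q.dim q = P.dim σ := by
    by_contra hne
    refine hsV (Set.mem_biUnion ⟨q, lt_of_le_of_ne (dim_le_dim hP hQ hqσ) hne, rfl⟩ ?_)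
    change j x + s • j y ∈ spanImage j (q : Set X)
    rw [← hjz]
    exact apply_mem_spanImage hzq
  have : (⟨z, hzσ⟩ : (σ : Set X)) ∈ (fun x : (σ : Set X) => j x) ⁻¹' U := by
    change j z ∈ U
    rw [hjz]
    exact hsU
  exact hUsub this (Set.mem_biUnion ⟨hqσ, hd⟩ hzq)

/-- A generic point of `q` lies on no smaller cone of `P`, so the common face of `σ` and `τ` there
is `σ` itself. This makes `σ` the smallest cone containing `q`. -/
theorem subset_of_subset_of_dim_eq (hP : P.IsQuasiEmbedding j) (hQ : Q.IsQuasiEmbedding j)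
    {σ τ : P.cones} {q : Q.cones} (hq : (q : Set X) ⊆ σ) (hd : Q.dim q = P.dim σ)
    (hτ : (q : Set X) ⊆ τ) : (σ : Set X) ⊆ τ := by
  obtain ⟨x, hx, h⟩ := exists_mem_forall_notMem hQ q
    (S := (fun ρ : P.cones => spanImage j (ρ : Set X)) '' {ρ | P.dim ρ < P.dim σ})
    ((Set.toFinite _).image _) (by
      rintro _ ⟨ρ, hρ, rfl⟩
      simp only [finrank_spanImage hP, hd]
      exact hρ)
  obtain ⟨ρ, hxρ, hρσ, hρτ⟩ := exists_common_face (hq hx) (hτ hx)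
  have : ρ = σ := by
    refine hρσ.eq_of_dim_le hP ?_
    by_contra hlt
    exact h _ ⟨ρ, not_le.1 hlt, rfl⟩ (apply_mem_spanImage hxρ)
  exact this ▸ hρτ.subset

theorem pullback_eq (hP : P.IsQuasiEmbedding j) (hQ : Q.IsQuasiEmbedding j)
    {σ : P.cones} {q : Q.cones} (hq : (q : Set X) ⊆ σ) (hd : Q.dim q = P.dim σ)
    (c : P.cones → ℝ) : P.pullback Q c q = c σ := by
  classical
  rw [pullback]
  have : (Finset.univ.filter (fun σ : P.cones => (q : Set X) ⊆ (σ : Set X) ∧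
      (∀ τ : P.cones, (q : Set X) ⊆ (τ : Set X) → (σ : Set X) ⊆ (τ : Set X)) ∧
      P.dim σ = Q.dim q)) = {σ} := by
    ext τ
    simp only [Finset.mem_filter, Finset.mem_univ, true_and, Finset.mem_singleton]
    constructor
    · rintro ⟨h1, h2, -⟩
      exact Subtype.ext ((h2 σ hq).antisymm (subset_of_subset_of_dim_eq hP hQ hq hd h1))
    · rintro rfl
      exact ⟨hq, fun τ' hτ' => subset_of_subset_of_dim_eq hP hQ hq hd hτ', hd.symm⟩
  convert Finset.sum_singleton c σ using 2

end ConicalStructure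

end

section

open Topology Filter

/-! ### Complexes on a Euclidean conical space -/

namespace EuclideanConicalSpace

open ConicalStructure

set_option linter.unusedSectionVars false

variable {X : Type*} [TopologicalSpace X] {N : Type*} [NormedAddCommGroup N]
  [InnerProductSpace ℝ N] [FiniteDimensional ℝ N] {E : EuclideanConicalSpace X N}
  {P P' : ConicalStructure X} {n : ℕ}

theorem PureDim.base_exists_superset (hn : E.PureDim n) (σ : E.base.cones) :
    ∃ τ : E.base.cones, (σ : Set X) ⊆ τ ∧ E.base.dim τ = n := by
  obtain ⟨τ, hτ, hmax⟩ := Set.Finite.exists_maximalFor (fun τ : E.base.cones => (τ : Set X))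
    {τ : E.base.cones | (σ : Set X) ⊆ τ} (Set.toFinite _) ⟨σ, fun _ h => h⟩
  exact ⟨τ, hτ, hn τ fun τ' h => Subtype.ext
    ((hmax (hτ.trans h) h).antisymm h)⟩

theorem PureDim.base_dim_le (hn : E.PureDim n) (σ : E.base.cones) : E.base.dim σ ≤ n := by
  obtain ⟨τ, hτ, hd⟩ := hn.base_exists_superset σ
  exact hd ▸ dim_le_dim E.quasi E.quasi hτ

/-- Pure dimension is stated for `base` and reaches other complexes through the common subdivision.
-/
theorem PureDim.dim_le (hn : E.PureDim n) (hP : E.IsComplex P) (σ : P.cones) : P.dim σ ≤ n := by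
  obtain ⟨⟨Q, hQ1, hQ2⟩, hPι⟩ := hP
  obtain ⟨x, hx, -⟩ := exists_mem_generic hPι σ
  obtain ⟨q, -, -, hd⟩ := hQ2.exists_mem_subset hPι hx
  obtain ⟨τ, hτ, -⟩ := hQ1 q
  rw [← hd]
  exact (dim_le_dim E.quasi (hQ2.isQuasiEmbedding hPι) hτ).trans (hn.base_dim_le τ)

theorem PureDim.exists_mem (hn : E.PureDim n) (hP : E.IsComplex P) (x : X) :
    ∃ σ : P.cones, x ∈ (σ : Set X) ∧ P.dim σ = n := by
  have hle := hn.dim_le hP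
  obtain ⟨⟨Q, hQ1, hQ2⟩, hPι⟩ := hP
  obtain ⟨τ, hxτ⟩ := E.base.exists_mem_cone x
  obtain ⟨τ', hττ', hd'⟩ := hn.base_exists_superset τ
  obtain ⟨q, hxq, -, hd⟩ := hQ1.exists_mem_subset E.quasi (hττ' hxτ)
  obtain ⟨σ, hσ, -⟩ := hQ2 q
  refine ⟨σ, hσ hxq, le_antisymm (hle σ) ?_⟩
  rw [← hd', ← hd]
  exact dim_le_dim hPι (hQ2.isQuasiEmbedding hPι) hσ

theorem PureDim.exists_superset (hn : E.PureDim n) (hP : E.IsComplex P) (σ : P.cones) :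
    ∃ σ' : P.cones, (σ : Set X) ⊆ σ' ∧ P.dim σ' = n := by
  obtain ⟨x, hx, h⟩ := exists_mem_generic hP.2 σ
  obtain ⟨σ', hx', hd⟩ := hn.exists_mem hP x
  obtain ⟨ρ, hxρ, h1, h2⟩ := exists_common_face hx hx'
  exact ⟨σ', (h1.eq_of_dim_le hP.2 (h ρ hxρ)) ▸ h2.subset, hd⟩

/-- The normalised Riesz representative, in the span of `σ`, of a form cutting out `τ`; it is
nonzero since `τ` is a proper face. -/
theorem isNormalVec_normalVec (hP : P.IsQuasiEmbedding E.ι) {σ τ : P.cones} (h : P.Face τ σ)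
    (hd : P.dim τ < P.dim σ) : E.IsNormalVec σ τ (E.normalVec σ τ) := by
  refine Classical.epsilon_spec (p := E.IsNormalVec σ τ) ?_
  obtain ⟨l, hl, hτ⟩ := (isFaceOf_iff hP).1 h
  let V := spanImage E.ι (σ : Set X)
  let f : StrongDual ℝ V := LinearMap.toContinuousLinearMap (l ∘ₗ V.subtype)
  let w : V := (InnerProductSpace.toDual ℝ V).symm f
  have hw : ∀ x ∈ (σ : Set X), inner ℝ (w : N) (E.ι x) = l (E.ι x) := by
    intro x hx
    have := InnerProductSpace.toDual_symm_apply (𝕜 := ℝ) (x := (⟨E.ι x, apply_mem_spanImage hx⟩ : V))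
      (y := f)
    exact this
  have hw0 : (w : N) ≠ 0 := by
    intro h0
    have : (σ : Set X) ⊆ τ := by
      intro x hx
      rw [hτ]
      refine ⟨hx, ?_⟩
      rw [← hw x hx, h0, inner_zero_left]
    exact absurd (dim_le_dim hP hP this) (not_le.2 hd)
  have hpos : 0 < ‖(w : N)‖ := norm_pos_iff.2 hw0
  refine ⟨‖(w : N)‖⁻¹ • (w : N), V.smul_mem _ w.2, ?_, ?_, ?_⟩
  · rw [norm_smul, norm_inv, norm_norm, inv_mul_cancel₀ hpos.ne']
  · intro x hx
    have hx' := hx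
    rw [hτ] at hx'
    rw [real_inner_smul_left, hw x hx'.1, hx'.2, mul_zero]
  · intro x hx
    rw [real_inner_smul_left, hw x hx]
    exact mul_nonneg (inv_nonneg.2 hpos.le) (hl x hx)

theorem linExt_spec (hP : P.IsQuasiEmbedding E.ι) {φ : X → ℝ} (hφ : P.PL φ) (σ : P.cones) :
    ∀ x ∈ (σ : Set X), φ x = E.linExt φ σ (E.ι x) :=
  Classical.epsilon_spec (p := fun l : Module.Dual ℝ N => ∀ x ∈ (σ : Set X), φ x = l (E.ι x))
    (hφ.exists_form hP σ)

/-- Every cone contains a cone of equal dimension of the common subdivision, where the pull-back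
takes the value `c σ`; non-negativity thus passes from one representative to all. -/
theorem IsPositiveCycle.nonneg {k : ℕ} {c : P.cones → ℝ} (hP : P.IsQuasiEmbedding E.ι)
    (h : E.IsPositiveCycle k P c) (σ : P.cones) : 0 ≤ c σ := by
  obtain ⟨P', c', -, -, hc', Q, hQ, hQP, -, heq⟩ := h
  obtain ⟨x, hx, -⟩ := exists_mem_generic hP σ
  obtain ⟨q, -, hq, hd⟩ := hQP.exists_mem_subset hP hx
  rw [← pullback_eq hP hQ.2 hq hd c, heq]
  exact Finset.sum_nonneg fun τ _ => hc' τ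

/-- Both weights are read off as pull-backs at one top cone of the common subdivision. With `P` the
balancing complex, this bounds multiplicities independently of `P'`. -/
theorem SameCycle.exists_eq (hn : E.PureDim n) (hP : E.IsComplex P) (hP' : E.IsComplex P')
    {c : P.cones → ℝ} {c' : P'.cones → ℝ} (h : E.SameCycle P c P' c') {σ' : P'.cones} {x : X}
    (hx : x ∈ (σ' : Set X)) (hd : P'.dim σ' = n) :
    ∃ σ : P.cones, x ∈ (σ : Set X) ∧ P.dim σ = n ∧
      spanImage E.ι (σ : Set X) = spanImage E.ι (σ' : Set X) ∧ c σ = c' σ' := by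
  obtain ⟨Q, hQ, hQP, hQP', heq⟩ := h
  obtain ⟨q, hxq, hq, hdq⟩ := hQP'.exists_mem_subset hP'.2 hx
  obtain ⟨σ, hσ, -⟩ := hQP q
  have h1 : P.dim σ = n := le_antisymm (hn.dim_le hP σ) (by
    rw [← hd, ← hdq]; exact dim_le_dim hP.2 hQ.2 hσ)
  have h2 : Q.dim q = P.dim σ := by rw [hdq, hd, h1]
  refine ⟨σ, hσ hxq, h1, ?_, ?_⟩
  · rw [← spanImage_eq_of_dim_le hP.2 hQ.2 hσ h2.ge, ← spanImage_eq_of_dim_le hP'.2 hQ.2 hq hdq.ge]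
  · rw [← pullback_eq hP.2 hQ.2 hσ h2 c, heq, pullback_eq hP'.2 hQ.2 hq hdq c']

/-- Every cone lies in one of dimension `n`, so injectivity of `p` on the top spans suffices. -/
theorem isQuasiEmbedding_comp {W : Type*} [AddCommGroup W] [Module ℝ W] (hn : E.PureDim n)
    (hP : E.IsComplex P) {p : N →ₗ[ℝ] W}
    (hp : ∀ σ : P.cones, P.dim σ = n → ∀ v ∈ spanImage E.ι (σ : Set X), p v = 0 → v = 0) :
    P.IsQuasiEmbedding (p ∘ E.ι) := by
  intro σ
  obtain ⟨⟨L, hL⟩, hinj⟩ := hP.2 σ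
  refine ⟨⟨p ∘ₗ L, fun x => by simp [hL]⟩, fun x hx y hy hxy => hinj hx hy ?_⟩
  obtain ⟨σ', hσ', hd⟩ := hn.exists_superset hP σ
  refine sub_eq_zero.1 (hp σ' hd _ (Submodule.sub_mem _ (apply_mem_spanImage (hσ' hx))
    (apply_mem_spanImage (hσ' hy))) ?_)
  rw [map_sub, sub_eq_zero]
  exact hxy

end EuclideanConicalSpace

end

section

open Topology Filter

/-! ### Lines crossing the cones -/

namespace ConicalStructure

set_option linter.unusedSectionVars false

variable {X : Type*} [TopologicalSpace X] {P : ConicalStructure X}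
  {W : Type*} [NormedAddCommGroup W] [NormedSpace ℝ W] [FiniteDimensional ℝ W] {j : X → W}

/-- The spans of the images of the cones of positive codimension. -/
def walls (P : ConicalStructure X) (j : X → W) : Set (Submodule ℝ W) :=
  (fun ρ : P.cones => spanImage j (ρ : Set X)) '' {ρ | P.dim ρ < Module.finrank ℝ W}

theorem finite_walls : (P.walls j).Finite := (Set.toFinite _).image _

theorem ne_top_of_mem_walls (hP : P.IsQuasiEmbedding j) : ∀ H ∈ P.walls j, H ≠ ⊤ := by
  rintro _ ⟨ρ, hρ, rfl⟩ h
  simp only at h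
  have h1 : P.dim ρ < Module.finrank ℝ W := hρ
  rw [← finrank_spanImage hP, h, finrank_top] at h1
  exact lt_irrefl _ h1

theorem spanImage_mem_walls {ρ : P.cones} (h : P.dim ρ < Module.finrank ℝ W) :
    spanImage j (ρ : Set X) ∈ P.walls j := ⟨ρ, h, rfl⟩

theorem spanImage_eq_top (hP : P.IsQuasiEmbedding j) {σ : P.cones}
    (hd : P.dim σ = Module.finrank ℝ W) : spanImage j (σ : Set X) = ⊤ :=
  Submodule.eq_top_of_finrank_eq (by rw [finrank_spanImage hP, hd])

/-- The cone `τ` meets the open segment from `a` to `a + b`. -/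
def Crosses (P : ConicalStructure X) (j : X → W) (a b : W) (τ : P.cones) : Prop :=
  ∃ t : ℝ, 0 < t ∧ t < 1 ∧ ∃ x ∈ (τ : Set X), j x = a + t • b

/-- `l` is a linear form defining the facet `τ` of `σ`. -/
def IsFacetForm (P : ConicalStructure X) (j : X → W) (σ τ : P.cones) (l : W →ₗ[ℝ] ℝ) : Prop :=
  (∀ x ∈ (σ : Set X), 0 ≤ l (j x)) ∧ ∀ w, l w = 0 ↔ w ∈ spanImage j (τ : Set X)

open Classical in
/-- A generic segment enters a cone of full dimension through one facet, unless it starts in the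
cone or misses it. -/
theorem card_entering (hP : P.IsQuasiEmbedding j) {σ : P.cones}
    (hd : P.dim σ = Module.finrank ℝ W) {a b : W} (hdir : ∀ H ∈ P.walls j, b ∉ H)
    (havoid : ∀ H ∈ P.walls j, Module.finrank ℝ H + 2 ≤ Module.finrank ℝ W →
      ∀ t : ℝ, a + t • b ∉ H)
    (hone : ∀ H ∈ P.walls j, a + b ∉ H) (l : P.cones → W →ₗ[ℝ] ℝ)
    (hl : ∀ τ : P.cones, P.dim τ + 1 = Module.finrank ℝ W → P.Face τ σ →
      P.IsFacetForm j σ τ (l τ)) :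
    ((Finset.univ.filter fun τ : P.cones => (P.dim τ + 1 = Module.finrank ℝ W ∧ P.Face τ σ) ∧
      P.Crosses j a b τ ∧ 0 < l τ b).card : ℝ) =
      (if ∃ t : ℝ, 0 ≤ t ∧ t ≤ 1 ∧ a + t • b ∈ imageCone hP σ then 1 else 0) -
      if a ∈ imageCone hP σ then 1 else 0 := by
  -- The facet form increases along the line and vanishes at the crossing, so no earlier point of
  -- the line lies in `σ`: an entering crossing happens at the first point in `σ`.
  have hbefore : ∀ τ : P.cones, P.dim τ + 1 = Module.finrank ℝ W → P.Face τ σ → 0 < l τ b →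
      ∀ t : ℝ, ∀ x ∈ (τ : Set X), j x = a + t • b → ∀ t', a + t' • b ∈ imageCone hP σ → t ≤ t' := by
    intro τ hdτ hτ hpos t x hx hjx t' ht'
    obtain ⟨y, hy, hjy⟩ := (mem_imageCone hP).1 ht'
    have h1 := (hl τ hdτ hτ).1 y hy
    have h2 := ((hl τ hdτ hτ).2 (j x)).2 (apply_mem_spanImage hx)
    have h3 : l τ (j y) = l τ (j x) + (t' - t) * l τ b := by
      rw [hjy, hjx]
      simp only [map_add, map_smul, smul_eq_mul]
      ring
    rw [h3, h2, zero_add] at h1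
    by_contra hcon
    have := mul_neg_of_neg_of_pos (sub_neg.2 (not_le.1 hcon)) hpos
    linarith
  by_cases ha : a ∈ imageCone hP σ
  · have hI : ∃ t : ℝ, 0 ≤ t ∧ t ≤ 1 ∧ a + t • b ∈ imageCone hP σ :=
      ⟨0, le_rfl, zero_le_one, by simpa using ha⟩
    rw [if_pos hI, if_pos ha, sub_self, Nat.cast_eq_zero, Finset.card_eq_zero,
      Finset.filter_eq_empty_iff]
    rintro τ - ⟨⟨hdτ, hτ⟩, ⟨t, ht0, -, x, hx, hjx⟩, hpos⟩
    have := hbefore τ hdτ hτ hpos t x hx hjx 0 (by simpa using ha)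
    linarith
  by_cases hI : ∃ t : ℝ, 0 ≤ t ∧ t ≤ 1 ∧ a + t • b ∈ imageCone hP σ
  swap
  · rw [if_neg hI, if_neg ha, sub_self, Nat.cast_eq_zero, Finset.card_eq_zero,
      Finset.filter_eq_empty_iff]
    rintro τ - ⟨⟨hdτ, hτ⟩, ⟨t, ht0, ht1, x, hx, hjx⟩, hpos⟩
    exact hI ⟨t, ht0.le, ht1.le, hjx ▸ apply_mem_imageCone hP (hτ.subset hx)⟩
  rw [if_pos hI, if_neg ha, sub_zero, Nat.cast_eq_one, Finset.card_eq_one]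
  have hcl : IsCompact (Set.Icc (0 : ℝ) 1 ∩ {t : ℝ | a + t • b ∈ imageCone hP σ}) := by
    refine isCompact_Icc.inter_right ?_
    exact (isClosed_imageCone hP σ).preimage (by fun_prop : Continuous fun t : ℝ => a + t • b)
  obtain ⟨t₀, ⟨ht₀, hz⟩, hmin⟩ := hcl.exists_isLeast (by
    obtain ⟨t, h0, h1, h⟩ := hI
    exact ⟨t, ⟨h0, h1⟩, h⟩)
  have hpos₀ : 0 < t₀ := by
    refine lt_of_le_of_ne ht₀.1 ?_
    rintro rfl
    exact ha (by simpa using hz)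
  -- Parameters below `0` are included: by convexity such a point would force the parameter `t₀ / 2`
  -- into `σ`.
  have hmin' : ∀ ε : ℝ, 0 < ε → a + (t₀ - ε) • b ∉ imageCone hP σ := by
    have : ∀ ε : ℝ, 0 < ε → ε ≤ t₀ → a + (t₀ - ε) • b ∉ imageCone hP σ := by
      intro ε hε hε' hmem
      have := hmin ⟨⟨by linarith, by linarith [ht₀.2]⟩, hmem⟩
      linarith
    intro ε hε hmem
    by_cases hle : ε ≤ t₀
    · exact this ε hε hle hmem
    · refine this (t₀ / 2) (by positivity) (by linarith) ?_
      have hlt : t₀ < ε := not_le.1 hle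
      have h1 := (imageCone hP σ).add_mem
        ((imageCone hP σ).smul_mem (show 0 ≤ 1 - t₀ / 2 / ε by
          rw [sub_nonneg, div_le_one hε]; linarith) hz)
        ((imageCone hP σ).smul_mem (show 0 ≤ t₀ / 2 / ε by positivity) hmem)
      convert h1 using 1
      have h2 : t₀ / 2 = t₀ / 2 / ε * ε := by field_simp
      have : a + (t₀ - t₀ / 2) • b = a + (t₀ - t₀ / 2 / ε * ε) • b := by rw [← h2]
      rw [this]
      module
  obtain ⟨x, hx, hjx⟩ := (mem_imageCone hP).1 hz
  -- The line avoids codimension two, so at the entry point only facets and top cones occur; hence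
  -- `x` is in the relative interior of a facet.
  have hgen : ∀ ρ : P.cones, x ∈ (ρ : Set X) → Module.finrank ℝ W ≤ P.dim ρ + 1 := by
    intro ρ hxρ
    by_contra hlt
    refine havoid (spanImage j (ρ : Set X)) (spanImage_mem_walls (by omega)) ?_ t₀ ?_
    · rw [finrank_spanImage hP]; omega
    · rw [← hjx]; exact apply_mem_spanImage hxρ
  obtain ⟨τ, hτ, hxτ, hdτ⟩ := (relint_or_mem_face hP hx).resolve_left (by
    intro hrel
    obtain ⟨ε, hε, hmem⟩ := hrel (-b) (by rw [spanImage_eq_top hP hd]; trivial)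
    refine hmin' ε hε ?_
    convert hmem using 1
    rw [hjx]
    module)
  have hdτ' : P.dim τ + 1 = Module.finrank ℝ W := by
    have := hgen τ hxτ
    omega
  have hbτ : l τ b ≠ 0 := fun h0 =>
    hdir _ (spanImage_mem_walls (by omega)) (((hl τ hdτ' hτ).2 b).1 h0)
  have hlb : 0 < l τ b := by
    by_contra hneg
    have hneg : l τ b < 0 := lt_of_le_of_ne (not_lt.1 hneg) hbτ
    obtain ⟨k, hk, hkτ⟩ : ∃ k ∈ (σ : Set X), 0 < l τ (j k) := by
      by_contra! hcon
      have h1 : spanImage j (σ : Set X) ≤ spanImage j (τ : Set X) := by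
        refine Submodule.span_le.2 ?_
        rintro _ ⟨y, hy, rfl⟩
        exact ((hl τ hdτ' hτ).2 _).1 (le_antisymm (hcon y hy) ((hl τ hdτ' hτ).1 y hy))
      have h2 := Submodule.finrank_mono h1
      rw [finrank_spanImage hP, finrank_spanImage hP] at h2
      omega
    have hrelτ := (relint_or_mem_face hP hxτ).resolve_right (by
      rintro ⟨ρ, -, hxρ, hdρ⟩
      have := hgen ρ hxρ
      omega)
    -- With this `α` the vector `-b - α j k` is killed by `l τ`, so it is a direction in `τ`. A
    -- small move along it, followed by adding `ε α j k`, stays in `σ` and lands before `t₀`.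
    set α := - l τ b / l τ (j k) with hα
    have hα0 : 0 < α := div_pos (by linarith) hkτ
    obtain ⟨ε, hε, hmem⟩ := hrelτ (-b - α • j k) (((hl τ hdτ' hτ).2 _).1 (by
      simp only [map_sub, map_neg, map_smul, smul_eq_mul, hα]
      field_simp
      ring))
    obtain ⟨y, hy, hjy⟩ := (mem_imageCone hP).1 hmem
    refine hmin' ε hε ?_
    have h1 := (imageCone hP σ).add_mem (apply_mem_imageCone hP (hτ.subset hy))
      ((imageCone hP σ).smul_mem (show 0 ≤ ε * α by positivity) (apply_mem_imageCone hP hk))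
    convert h1 using 1
    rw [hjy, hjx]
    module
  have ht₁ : t₀ < 1 := by
    refine lt_of_le_of_ne ht₀.2 ?_
    rintro rfl
    refine hone _ (spanImage_mem_walls (ρ := τ) (by omega)) ?_
    rw [one_smul] at hjx
    exact hjx ▸ apply_mem_spanImage hxτ
  refine ⟨τ, ?_⟩
  ext τ'
  simp only [Finset.mem_filter, Finset.mem_univ, true_and, Finset.mem_singleton]
  constructor
  · rintro ⟨⟨hd', hτ'⟩, ⟨t, ht0, ht1, y, hy, hjy⟩, hpos⟩
    have h1 : t ≤ t₀ := hbefore τ' hd' hτ' hpos t y hy hjy t₀ hz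
    have h2 : t₀ ≤ t := hmin ⟨⟨ht0.le, ht1.le⟩, by
      change a + t • b ∈ imageCone hP σ
      exact hjy ▸ apply_mem_imageCone hP (hτ'.subset hy)⟩
    have h3 : y = x := (injOn_cone hP σ) (hτ'.subset hy) hx (by
      rw [hjy, hjx, le_antisymm h1 h2])
    subst h3
    obtain ⟨ρ, hyρ, hρ, hρ'⟩ := exists_common_face hy hxτ
    have h4 := hgen ρ hyρ
    rw [← hρ.eq_of_dim_le hP (by omega), ← hρ'.eq_of_dim_le hP (by omega)]
  · rintro rfl
    exact ⟨⟨hdτ', hτ⟩, ⟨t₀, hpos₀, ht₁, x, hxτ, hjx⟩, hlb⟩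

end ConicalStructure

end

/-! ### From wall crossings to midpoint concavity of fibre sums. -/

section

open Topology Filter

namespace ConicalStructure

set_option linter.unusedSectionVars false

variable {X : Type*} [TopologicalSpace X] {P : ConicalStructure X}
  {W : Type*} [NormedAddCommGroup W] [NormedSpace ℝ W] [FiniteDimensional ℝ W] {j : X → W}

theorem crosses_reverse {a b : W} {τ : P.cones} :
    P.Crosses j (a + b) (-b) τ ↔ P.Crosses j a b τ := by
  constructor
  · rintro ⟨t, h0, h1, x, hx, h⟩
    exact ⟨1 - t, by linarith, by linarith, x, hx, by rw [h]; module⟩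
  · rintro ⟨t, h0, h1, x, hx, h⟩
    exact ⟨1 - t, by linarith, by linarith, x, hx, by rw [h]; module⟩

open Classical in
/-- The sign of a real number, as a difference of indicators. -/
noncomputable def signOf (r : ℝ) : ℝ := (if 0 < r then 1 else 0) - if 0 < -r then 1 else 0

open Classical in
/-- The change of the indicator of a cone along a generic segment is the sum of the signs of the
crossings of its facets. -/
theorem sum_signOf_crossings (hP : P.IsQuasiEmbedding j) {σ : P.cones}
    (hd : P.dim σ = Module.finrank ℝ W) {a b : W} (hdir : ∀ H ∈ P.walls j, b ∉ H)
    (havoid : ∀ H ∈ P.walls j, Module.finrank ℝ H + 2 ≤ Module.finrank ℝ W →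
      ∀ t : ℝ, a + t • b ∉ H)
    (hzero : ∀ H ∈ P.walls j, a ∉ H) (hone : ∀ H ∈ P.walls j, a + b ∉ H)
    (l : P.cones → W →ₗ[ℝ] ℝ)
    (hl : ∀ τ : P.cones, P.dim τ + 1 = Module.finrank ℝ W → P.Face τ σ →
      P.IsFacetForm j σ τ (l τ)) :
    ((if a + b ∈ imageCone hP σ then 1 else 0) - if a ∈ imageCone hP σ then 1 else 0 : ℝ) =
      ∑ τ : P.cones, if (P.dim τ + 1 = Module.finrank ℝ W ∧ P.Face τ σ) ∧ P.Crosses j a b τ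
        then signOf (l τ b) else 0 := by
  have h1 := card_entering hP hd hdir havoid hone l hl
  -- Crossings of negative sign are the entrances of the reversed segment. In the difference of the
  -- two counts, the indicator of meeting `σ` at all cancels.
  have h2 := card_entering hP hd (a := a + b) (b := -b)
    (fun H hH h => hdir H hH (by simpa using h))
    (fun H hH hc t h => havoid H hH hc (1 - t) (by convert h using 1; module))
    (fun H hH => by simpa using hzero H hH) l hl
  simp only [crosses_reverse] at h2
  have h3 : (∃ t : ℝ, 0 ≤ t ∧ t ≤ 1 ∧ a + b + t • -b ∈ imageCone hP σ) ↔
      ∃ t : ℝ, 0 ≤ t ∧ t ≤ 1 ∧ a + t • b ∈ imageCone hP σ := by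
    constructor
    · rintro ⟨t, h0, h1, h⟩
      exact ⟨1 - t, by linarith, by linarith, by convert h using 1; module⟩
    · rintro ⟨t, h0, h1, h⟩
      exact ⟨1 - t, by linarith, by linarith, by convert h using 1; module⟩
  simp only [h3] at h2
  rw [Finset.card_filter] at h1 h2
  push_cast at h1 h2
  have h4 : (∑ τ : P.cones, if (P.dim τ + 1 = Module.finrank ℝ W ∧ P.Face τ σ) ∧ P.Crosses j a b τ
        then signOf (l τ b) else 0 : ℝ) =
      (∑ τ : P.cones, if (P.dim τ + 1 = Module.finrank ℝ W ∧ P.Face τ σ) ∧ P.Crosses j a b τ ∧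
        0 < l τ b then (1 : ℝ) else 0) -
      ∑ τ : P.cones, if (P.dim τ + 1 = Module.finrank ℝ W ∧ P.Face τ σ) ∧ P.Crosses j a b τ ∧
        0 < l τ (-b) then (1 : ℝ) else 0 := by
    rw [← Finset.sum_sub_distrib]
    refine Finset.sum_congr rfl fun τ _ => ?_
    by_cases h : (P.dim τ + 1 = Module.finrank ℝ W ∧ P.Face τ σ) ∧ P.Crosses j a b τ
    · simp only [h, signOf, map_neg, true_and, if_true, and_self]
    · have h' : ∀ q : Prop, ¬ ((P.dim τ + 1 = Module.finrank ℝ W ∧ P.Face τ σ) ∧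
          P.Crosses j a b τ ∧ q) := fun q hq => h ⟨hq.1, hq.2.1⟩
      simp only [h, h', if_false, sub_zero]
  rw [h4, h1, h2]
  ring

open Classical in
/-- The push-forward of the piecewise linear function `φ` with multiplicities `m` is concave across
the walls of `P`. -/
structure IsConcaveAcrossWalls (P : ConicalStructure X) (j : X → W) (φ : X → ℝ) (m : P.cones → ℝ)
    (l : P.cones → P.cones → W →ₗ[ℝ] ℝ) (Φ : P.cones → W →ₗ[ℝ] ℝ) : Prop where
  facet : ∀ σ τ : P.cones, P.dim σ = Module.finrank ℝ W → P.dim τ + 1 = Module.finrank ℝ W →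
    P.Face τ σ → P.IsFacetForm j σ τ (l σ τ)
  form : ∀ σ : P.cones, ∀ x ∈ (σ : Set X), φ x = Φ σ (j x)
  -- Since `κ` is any real, the inequality contains the balancing identity: the signed
  -- multiplicities at a wall add up to zero.
  wall : ∀ τ : P.cones, P.dim τ + 1 = Module.finrank ℝ W → ∀ b, b ∉ spanImage j (τ : Set X) →
    ∀ x ∈ (τ : Set X), ∀ t : ℝ, 0 ≤ t → ∀ κ : ℝ,
    0 ≤ ∑ σ : P.cones, if P.dim σ = Module.finrank ℝ W ∧ P.Face τ σ then
      m σ * signOf (l σ τ b) * (Φ σ (j x - t • b) - κ) else 0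

variable {φ : X → ℝ} {m : P.cones → ℝ} {l : P.cones → P.cones → W →ₗ[ℝ] ℝ}
  {Φ : P.cones → W →ₗ[ℝ] ℝ}

-- The indicator changes are expanded into crossings and the sums exchanged; each crossed wall then
-- contributes its `wall` sum, as `j x - t b = a`. Closure of `S` across crossed walls ensures that
-- these sums are complete. The result compares the pieces active at `a + b` with those active at
-- `a`, all evaluated at `a`.
open Classical in
theorem IsConcaveAcrossWalls.sum_nonneg (h : P.IsConcaveAcrossWalls j φ m l Φ)
    (hP : P.IsQuasiEmbedding j) {a b : W} (hab : IsGenericLine (P.walls j) a b)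
    (S : Set P.cones) (hS : ∀ σ ∈ S, ∀ τ : P.cones, P.Face τ σ → P.Crosses j a b τ →
      ∀ σ' : P.cones, P.dim σ' = Module.finrank ℝ W → P.Face τ σ' → σ' ∈ S) (κ : ℝ) :
    0 ≤ ∑ σ : P.cones, if σ ∈ S ∧ P.dim σ = Module.finrank ℝ W then m σ *
      ((if a + b ∈ imageCone hP σ then 1 else 0) - if a ∈ imageCone hP σ then 1 else 0) *
        (Φ σ a - κ) else 0 := by
  have h1 : ∀ σ : P.cones, (if σ ∈ S ∧ P.dim σ = Module.finrank ℝ W then m σ *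
      ((if a + b ∈ imageCone hP σ then 1 else 0) - if a ∈ imageCone hP σ then 1 else 0) *
        (Φ σ a - κ) else 0) = ∑ τ : P.cones,
        if P.dim τ + 1 = Module.finrank ℝ W ∧ P.Crosses j a b τ then
          (if σ ∈ S ∧ P.dim σ = Module.finrank ℝ W ∧ P.Face τ σ then
            m σ * signOf (l σ τ b) * (Φ σ a - κ) else 0) else 0 := by
    intro σ
    by_cases hσ : σ ∈ S ∧ P.dim σ = Module.finrank ℝ W
    · rw [if_pos hσ, sum_signOf_crossings hP hσ.2 hab.dir hab.avoid hab.zero hab.one (l σ)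
        (fun τ hτ hf => h.facet σ τ hσ.2 hτ hf), Finset.mul_sum, Finset.sum_mul]
      refine Finset.sum_congr rfl fun τ _ => ?_
      by_cases h1 : P.dim τ + 1 = Module.finrank ℝ W <;> by_cases h2 : P.Face τ σ <;>
        by_cases h3 : P.Crosses j a b τ <;> simp [h1, h2, h3, hσ.1, hσ.2]
    · rw [if_neg hσ]
      refine (Finset.sum_eq_zero fun τ _ => ?_).symm
      have h' : ¬ (σ ∈ S ∧ P.dim σ = Module.finrank ℝ W ∧ P.Face τ σ) :=
        fun h => hσ ⟨h.1, h.2.1⟩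
      rw [if_neg h', ite_self]
  rw [Finset.sum_congr rfl fun σ _ => h1 σ, Finset.sum_comm]
  refine Finset.sum_nonneg fun τ _ => ?_
  by_cases hτ : P.dim τ + 1 = Module.finrank ℝ W ∧ P.Crosses j a b τ
  swap
  · simp [hτ]
  simp only [if_pos hτ]
  by_cases hex : ∃ σ : P.cones, σ ∈ S ∧ P.Face τ σ
  · obtain ⟨σ₀, hσ₀, hf₀⟩ := hex
    obtain ⟨t, ht0, -, x, hx, hjx⟩ := hτ.2
    have h2 := h.wall τ hτ.1 b (hab.dir _ (spanImage_mem_walls (by omega))) x hx t ht0.le κ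
    have h3 : j x - t • b = a := by rw [hjx]; abel
    rw [h3] at h2
    refine h2.trans (Finset.sum_le_sum fun σ _ => ?_)
    by_cases hσ : P.dim σ = Module.finrank ℝ W ∧ P.Face τ σ
    · rw [if_pos hσ, if_pos ⟨hS σ₀ hσ₀ τ hf₀ hτ.2 σ hσ.1 hσ.2, hσ⟩]
    · rw [if_neg hσ, if_neg fun h => hσ h.2]
  · refine (Finset.sum_eq_zero fun σ _ => if_neg fun h => hex ⟨σ, h.1, h.2.2⟩).ge

/-- Points of a cone over a segment of a line stay on one side of a separation. -/
theorem mem_of_separation (hP : P.IsQuasiEmbedding j) (σ : P.cones) {a b : W} {Z Z' : Set X}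
    (hZ : IsClosed Z) (hZ' : IsClosed Z') (hcov : (σ : Set X) ⊆ Z ∪ Z')
    (hdisj : ∀ x ∈ Z ∩ Z', ∀ t ∈ Set.Icc (0 : ℝ) 2, j x ≠ a + t • b)
    {x y : X} (hx : x ∈ (σ : Set X)) (hy : y ∈ (σ : Set X)) {s t : ℝ} (hs : s ∈ Set.Icc (0 : ℝ) 2)
    (ht : t ∈ Set.Icc (0 : ℝ) 2) (hjx : j x = a + s • b) (hjy : j y = a + t • b) (hxZ : x ∈ Z) :
    y ∈ Z := by
  let T : Set ℝ := Set.Icc (0 : ℝ) 2 ∩ {t : ℝ | a + t • b ∈ imageCone hP σ}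
  -- The parameters over which `σ` meets the line form an interval. Its lift `g` to `σ` is
  -- continuous, and the separation makes the preimage of `Z` clopen.
  have hT : Convex ℝ T := by
    refine (convex_Icc 0 2).inter ?_
    intro t ht s hs p q hp hq hpq
    have h1 := (imageCone hP σ).convex ht hs hp hq hpq
    change a + (p • t + q • s) • b ∈ imageCone hP σ
    have h2 : a + (p • t + q • s) • b = p • (a + t • b) + q • (a + s • b) := by
      obtain rfl : p = 1 - q := by linarith
      simp only [smul_eq_mul]
      module
    rw [h2]
    exact h1
  have : PreconnectedSpace T := Subtype.preconnectedSpace hT.isPreconnected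
  choose g hgσ hg using fun t : T => (mem_imageCone hP).1 t.2.2
  have hgc : Continuous g := by
    have h1 : Continuous fun t : T => (⟨g t, hgσ t⟩ : (σ : Set X)) := by
      rw [(isEmbedding_restrict_cone hP σ).continuous_iff]
      have h2 : Continuous fun t : T => a + (t : ℝ) • b := by fun_prop
      exact h2.congr fun t => (hg t).symm
    exact continuous_subtype_val.comp h1
  have hclopen : IsClopen (g ⁻¹' Z) := by
    refine ⟨hZ.preimage hgc, ?_⟩
    have h1 : g ⁻¹' Z = (g ⁻¹' Z')ᶜ := by
      ext t
      constructor
      · exact fun h h' => hdisj (g t) ⟨h, h'⟩ t t.2.1 (hg t)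
      · exact fun h => (hcov (hgσ t)).resolve_right h
    rw [h1]
    exact (hZ'.preimage hgc).isOpen_compl
  have hsT : s ∈ T := ⟨hs, by change a + s • b ∈ imageCone hP σ; exact hjx ▸ apply_mem_imageCone hP hx⟩
  have htT : t ∈ T := ⟨ht, by change a + t • b ∈ imageCone hP σ; exact hjy ▸ apply_mem_imageCone hP hy⟩
  have hgs : g ⟨s, hsT⟩ = x := injOn_cone hP σ (hgσ _) hx (by rw [hg, hjx])
  have hgt : g ⟨t, htT⟩ = y := injOn_cone hP σ (hgσ _) hy (by rw [hg, hjy])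
  rcases isClopen_iff.1 hclopen with h | h
  · have : (⟨s, hsT⟩ : T) ∈ g ⁻¹' Z := by change g _ ∈ Z; rw [hgs]; exact hxZ
    rw [h] at this
    exact absurd this (Set.notMem_empty _)
  · have : (⟨t, htT⟩ : T) ∈ g ⁻¹' Z := by rw [h]; trivial
    rw [← hgt]
    exact this

open Classical in
/-- The value at `y` of the contribution of the cone `σ` to the push-forward of the restriction
of `φ - κ` to `Z`. -/
noncomputable def fiberValue (j : X → W) (Φ : P.cones → W →ₗ[ℝ] ℝ) (Z : Set X) (κ : ℝ)
    (σ : P.cones) (y : W) : ℝ :=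
  if ∃ x ∈ (σ : Set X), x ∈ Z ∧ j x = y then Φ σ y - κ else 0

open Classical in
/-- The push-forward of `φ - κ`, restricted to a region that is separated over a generic segment,
satisfies the midpoint concavity inequality on this segment. -/
theorem IsConcaveAcrossWalls.sum_fiberValue_le (h : P.IsConcaveAcrossWalls j φ m l Φ)
    (hP : P.IsQuasiEmbedding j) {a b : W} (hab : IsGenericLine (P.walls j) a b)
    {Z Z' : Set X} (hZ : IsClosed Z) (hZ' : IsClosed Z')
    (hcov : ∀ x, x ∈ Z ∪ Z')
    (hdisj : ∀ x ∈ Z ∩ Z', ∀ t ∈ Set.Icc (0 : ℝ) 2, j x ≠ a + t • b) (κ : ℝ) :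
    ∑ σ : P.cones, (if P.dim σ = Module.finrank ℝ W then m σ *
      (fiberValue j Φ Z κ σ a + fiberValue j Φ Z κ σ (a + (2 : ℝ) • b) -
        2 * fiberValue j Φ Z κ σ (a + b)) else 0) ≤ 0 := by
  -- Over the segment, a cone of `S` lies entirely in `Z`, so `S` is closed under passing through
  -- crossed walls.
  let S : Set P.cones := {σ | ∃ x ∈ (σ : Set X), x ∈ Z ∧ ∃ t ∈ Set.Icc (0 : ℝ) 2, j x = a + t • b}
  have hsep : ∀ σ ∈ S, ∀ y ∈ (σ : Set X), ∀ t ∈ Set.Icc (0 : ℝ) 2, j y = a + t • b → y ∈ Z := by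
    rintro σ ⟨x, hx, hxZ, s, hs, hjx⟩ y hy t ht hjy
    exact mem_of_separation hP σ hZ hZ' (fun z _ => hcov z) hdisj hx hy hs ht hjx hjy hxZ
  have hclosed : ∀ σ ∈ S, ∀ τ : P.cones, P.Face τ σ → ∀ x ∈ (τ : Set X), ∀ t ∈ Set.Icc (0 : ℝ) 2,
      j x = a + t • b → ∀ σ' : P.cones, P.Face τ σ' → σ' ∈ S :=
    fun σ hσ τ hτ x hx t ht hjx σ' hσ' =>
      ⟨x, hσ'.subset hx, hsep σ hσ x (hτ.subset hx) t ht hjx, t, ht, hjx⟩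
  have h1 := h.sum_nonneg hP hab S (by
    rintro σ hσ τ hτ ⟨t, h0, h1, x, hx, hjx⟩ σ' - hσ'
    exact hclosed σ hσ τ hτ x hx t ⟨h0.le, by linarith⟩ hjx σ' hσ') κ
  have h2 := h.sum_nonneg hP hab.reverse S (by
    rintro σ hσ τ hτ ⟨t, h0, h1, x, hx, hjx⟩ σ' - hσ'
    exact hclosed σ hσ τ hτ x hx (2 - t) ⟨by linarith, by linarith⟩ (by rw [hjx]; module)
      σ' hσ') κ
  have hval : ∀ σ, ∀ t ∈ Set.Icc (0 : ℝ) 2, ∀ y, y = a + t • b → fiberValue j Φ Z κ σ y =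
      if σ ∈ S then (if y ∈ imageCone hP σ then 1 else 0) * (Φ σ y - κ) else 0 := by
    rintro σ t ht _ rfl
    rw [fiberValue]
    by_cases hex : ∃ x ∈ (σ : Set X), x ∈ Z ∧ j x = a + t • b
    · obtain ⟨x, hx, hxZ, hjx⟩ := hex
      rw [if_pos ⟨x, hx, hxZ, hjx⟩, if_pos (show σ ∈ S from ⟨x, hx, hxZ, t, ht, hjx⟩),
        if_pos (hjx ▸ apply_mem_imageCone hP hx), one_mul]
    · rw [if_neg hex]
      by_cases hσ : σ ∈ S
      · rw [if_pos hσ, if_neg, zero_mul]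
        intro hmem
        obtain ⟨x, hx, hjx⟩ := (mem_imageCone hP).1 hmem
        exact hex ⟨x, hx, hsep σ hσ x hx t ht hjx, hjx⟩
      · rw [if_neg hσ]
  have h3 : a + (2 : ℝ) • b + -b = a + b := by module
  rw [h3] at h2
  have h4 := add_nonneg h1 h2
  rw [← Finset.sum_add_distrib] at h4
  rw [← neg_nonneg, ← Finset.sum_neg_distrib]
  refine h4.trans_eq (Finset.sum_congr rfl fun σ _ => ?_)
  rw [hval σ 0 (by simp) a (by simp), hval σ 2 (by simp) _ rfl,
    hval σ 1 (by norm_num) (a + b) (by simp)]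
  -- The two halves evaluate the pieces active at `a + b` at `a` and at `a + 2b`; by linearity these
  -- add up to twice the value at `a + b`.
  have hlin : Φ σ (a + (2 : ℝ) • b) = 2 * Φ σ (a + b) - Φ σ a := by
    simp only [map_add, map_smul, smul_eq_mul]
    ring
  by_cases hσ : σ ∈ S <;> by_cases hd : P.dim σ = Module.finrank ℝ W <;>
    simp only [hσ, hd, and_self, and_true, and_false, if_true, if_false,
      hlin] <;> ring

end ConicalStructure

end

/-! ### From positive intersection products to concavity across walls. -/

section

open Topology Filter

namespace ConicalStructure

/-- Used with `r = ν τ (p v)`: multiplicity times sign becomes linear in the normal vector `v`, so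
that balancing can be applied. -/
theorem abs_mul_signOf (r s : ℝ) : |r| * signOf (r * s) = r * signOf s := by
  unfold signOf
  rcases lt_trichotomy r 0 with hr | rfl | hr
  · rw [abs_of_neg hr]
    rcases lt_trichotomy s 0 with hs | rfl | hs
    · have h := mul_pos_of_neg_of_neg hr hs
      simp only [neg_pos, h, h.le.not_gt, hs, hs.le.not_gt, if_true, if_false]
      ring
    · simp
    · have h := mul_neg_of_neg_of_pos hr hs
      simp only [neg_pos, h, h.le.not_gt, hs, hs.le.not_gt, if_true, if_false]
      ring
  · simp
  · rw [abs_of_pos hr]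
    simp only [mul_pos_iff_of_pos_left hr, ← mul_neg]

theorem signOf_mul_self (s : ℝ) : signOf s * s = |s| := by
  unfold signOf
  rcases lt_trichotomy s 0 with hs | rfl | hs
  · simp [hs, hs.le.not_gt, abs_of_neg hs]
  · simp
  · simp [hs, hs.le.not_gt, abs_of_pos hs]

end ConicalStructure

namespace EuclideanConicalSpace

set_option linter.unusedSectionVars false

open ConicalStructure

variable {X : Type*} [TopologicalSpace X] {N : Type*} [NormedAddCommGroup N]
  [InnerProductSpace ℝ N] [FiniteDimensional ℝ N] {E : EuclideanConicalSpace X N}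
  {P : ConicalStructure X}

theorem spanImage_comp {W : Type*} [NormedAddCommGroup W] [NormedSpace ℝ W]
    [FiniteDimensional ℝ W] (p : N →ₗ[ℝ] W) (ι : X → N) (σ : Set X) :
    spanImage (p ∘ ι) σ = (spanImage ι σ).map p := by
  rw [spanImage, spanImage, Submodule.map_span, Set.image_comp]

/-- By dimension count the span of `σ` is that of `τ` plus the line of the unit normal, which is
orthogonal to `τ`. -/
theorem span_eq_sup_normalVec (hP : P.IsQuasiEmbedding E.ι) {σ τ : P.cones} (h : P.Face τ σ)
    (hd : P.dim τ + 1 = P.dim σ) {w : N} (hw : w ∈ spanImage E.ι (σ : Set X)) :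
    w - inner ℝ (E.normalVec σ τ) w • E.normalVec σ τ ∈ spanImage E.ι (τ : Set X) := by
  obtain ⟨hv, hv1, hv0, -⟩ := isNormalVec_normalVec hP h (by omega)
  set v := E.normalVec σ τ
  have horth : ∀ u ∈ spanImage E.ι (τ : Set X), inner ℝ v u = 0 := by
    have : spanImage E.ι (τ : Set X) ≤ LinearMap.ker (innerₛₗ ℝ v) := by
      refine Submodule.span_le.2 ?_
      rintro _ ⟨x, hx, rfl⟩
      exact hv0 x hx
    exact this
  have hvv : inner ℝ v v = 1 := by rw [real_inner_self_eq_norm_sq, hv1, one_pow]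
  have hlt : spanImage E.ι (τ : Set X) < spanImage E.ι (τ : Set X) ⊔ Submodule.span ℝ {v} := by
    refine lt_of_le_of_ne le_sup_left fun heq => ?_
    have hmem : v ∈ spanImage E.ι (τ : Set X) := by
      rw [heq]
      exact Submodule.mem_sup_right (Submodule.mem_span_singleton_self v)
    rw [horth v hmem] at hvv
    exact zero_ne_one hvv
  have hsup : spanImage E.ι (τ : Set X) ⊔ Submodule.span ℝ {v} = spanImage E.ι (σ : Set X) := by
    refine Submodule.eq_of_le_of_finrank_le (sup_le (spanImage_mono h.subset) ?_) ?_
    · rw [Submodule.span_singleton_le_iff_mem]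
      exact hv
    · have := Submodule.finrank_lt_finrank_of_lt hlt
      rw [finrank_spanImage hP] at this ⊢
      omega
  rw [← hsup, Submodule.mem_sup] at hw
  obtain ⟨u, hu, z, hz, rfl⟩ := hw
  obtain ⟨r, rfl⟩ := Submodule.mem_span_singleton.1 hz
  rw [inner_add_right, horth u hu, real_inner_smul_right, hvv]
  simpa using hu

open Classical in
/-- A piecewise linear function with non-negative intersection product is concave across walls
after a generic linear projection. -/
theorem exists_isConcaveAcrossWalls {k : ℕ} (hn : E.PureDim (k + 1)) (hP : E.IsComplex P)
    {c : P.cones → ℝ} (hc : E.IsMinkowski P (k + 1) c) {φ : X → ℝ} (hφ : P.PL φ)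
    (hpos : ∀ τ, 0 ≤ E.inter P (k + 1) φ c τ)
    (p : N →ₗ[ℝ] (Fin (k + 1) → ℝ))
    (hp : ∀ σ : P.cones, P.dim σ = k + 1 → ∀ v ∈ spanImage E.ι (σ : Set X), p v = 0 → v = 0)
    (mu : Submodule ℝ N → ℝ)
    (hmu : ∀ σ : P.cones, P.dim σ = k + 1 → 0 < mu (spanImage E.ι (σ : Set X)) ∧
      ∀ e : Fin (k + 1) → N, Orthonormal ℝ e → (∀ i, e i ∈ spanImage E.ι (σ : Set X)) →
        |Matrix.detRowAlternating fun i => p (e i)| = mu (spanImage E.ι (σ : Set X))) :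
    ∃ l Φ, P.IsConcaveAcrossWalls (p ∘ E.ι) φ (fun σ => c σ * mu (spanImage E.ι (σ : Set X)))
      l Φ := by
  have hW : Module.finrank ℝ (Fin (k + 1) → ℝ) = k + 1 := by simp
  have hj : P.IsQuasiEmbedding (p ∘ E.ι) := isQuasiEmbedding_comp hn hP hp
  choose Φ hΦ using hφ.exists_form hj
  have hf : ∀ τ : P.cones, ∃ f : Fin k → N, P.dim τ = k → Orthonormal ℝ f ∧
      spanImage E.ι (τ : Set X) = Submodule.span ℝ (Set.range f) := by
    intro τ
    by_cases hd : P.dim τ = k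
    · let B := (stdOrthonormalBasis ℝ (spanImage E.ι (τ : Set X))).reindex
        (finCongr ((finrank_spanImage hP.2 τ).trans hd))
      refine ⟨fun i => B i, fun _ => ⟨?_, ?_⟩⟩
      · exact B.orthonormal.comp_linearIsometry (Submodule.subtypeₗᵢ _)
      · have h1 := congrArg (Submodule.map (Submodule.subtype _)) B.toBasis.span_eq
        rw [Submodule.map_span, Submodule.map_subtype_top, ← Set.range_comp] at h1
        refine h1.symm.trans ?_
        congr 2
    · exact ⟨0, fun h => absurd h hd⟩
  choose f hf using hf
  -- The form w ↦ det(w, p f₁, …, p f_k) vanishes on the image of the span of `τ`, and its absolute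
  -- value at a projected unit normal is the multiplicity of the adjacent cone.
  let ν : P.cones → (Fin (k + 1) → ℝ) →ₗ[ℝ] ℝ := fun τ =>
    (Matrix.detRowAlternating (R := ℝ) (n := Fin (k + 1))).toMultilinearMap.toLinearMap
      (Fin.cons 0 fun i => p (f τ i)) 0
  have hν : ∀ τ w, ν τ w = Matrix.detRowAlternating
      (Fin.cons w fun i => p (f τ i) : Fin (k + 1) → Fin (k + 1) → ℝ) := by
    intro τ w
    change Matrix.detRowAlternating (Function.update _ _ _) = _
    rw [Fin.update_cons_zero]
  have hν0 : ∀ τ : P.cones, P.dim τ = k → ∀ u ∈ spanImage E.ι (τ : Set X), ν τ (p u) = 0 := by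
    intro τ hd
    have h1 : spanImage E.ι (τ : Set X) ≤ LinearMap.ker (ν τ ∘ₗ p) := by
      rw [(hf τ hd).2, Submodule.span_le]
      rintro _ ⟨i, rfl⟩
      change ν τ (p (f τ i)) = 0
      rw [hν]
      exact AlternatingMap.map_eq_zero_of_eq _ _ (i := 0) (j := i.succ) (by simp)
        (Fin.succ_ne_zero i).symm
    exact h1
  have habs : ∀ σ τ : P.cones, P.dim σ = k + 1 → P.dim τ = k → P.Face τ σ →
      |ν τ (p (E.normalVec σ τ))| = mu (spanImage E.ι (σ : Set X)) := by
    intro σ τ hσ hτ hface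
    obtain ⟨hv, hv1, hv0, -⟩ := isNormalVec_normalVec hP.2 hface (by omega)
    have horth : ∀ u ∈ spanImage E.ι (τ : Set X), inner ℝ (E.normalVec σ τ) u = 0 := by
      have : spanImage E.ι (τ : Set X) ≤ LinearMap.ker (innerₛₗ ℝ (E.normalVec σ τ)) := by
        refine Submodule.span_le.2 ?_
        rintro _ ⟨x, hx, rfl⟩
        exact hv0 x hx
      exact this
    have hfmem : ∀ i, f τ i ∈ spanImage E.ι (τ : Set X) := fun i => by
      rw [(hf τ hτ).2]
      exact Submodule.subset_span ⟨i, rfl⟩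
    rw [hν, ← (hmu σ hσ).2 (Fin.cons (E.normalVec σ τ) (f τ)) ?_ ?_]
    · congr 2
      funext i
      refine Fin.cases ?_ (fun i => ?_) i <;> simp
    · constructor
      · intro i
        refine Fin.cases ?_ (fun i => ?_) i
        · simpa using hv1
        · simpa using (hf τ hτ).1.1 i
      · intro i i'
        refine Fin.cases ?_ (fun i => ?_) i <;> refine Fin.cases ?_ (fun i' => ?_) i'
        · exact fun h => absurd rfl h
        · intro _
          simpa using horth _ (hfmem i')
        · intro _
          simpa [real_inner_comm] using horth _ (hfmem i)
        · intro h
          simpa using (hf τ hτ).1.2 fun h' => h (congrArg Fin.succ h')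
    · intro i
      refine Fin.cases ?_ (fun i => ?_) i
      · exact hv
      · exact spanImage_mono hface.subset (hfmem i)
  have hdec : ∀ σ τ : P.cones, P.dim σ = k + 1 → P.dim τ = k → P.Face τ σ →
      ∀ w ∈ spanImage E.ι (σ : Set X),
        ν τ (p w) = inner ℝ (E.normalVec σ τ) w * ν τ (p (E.normalVec σ τ)) := by
    intro σ τ hσ hτ hface w hw
    have := hν0 τ hτ _ (span_eq_sup_normalVec hP.2 hface (by omega) hw)
    rw [map_sub, map_sub, map_smul, map_smul, smul_eq_mul] at this
    linarith
  -- The factor orients `ν τ` to be non-negative on `σ`.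
  refine ⟨fun σ τ => ν τ (p (E.normalVec σ τ)) • ν τ, Φ, ?_, hΦ, ?_⟩
  · intro σ τ hσ hτ hface
    rw [hW] at hσ hτ
    have hτ' : P.dim τ = k := by omega
    have hne : ν τ (p (E.normalVec σ τ)) ≠ 0 := by
      rw [← abs_pos, habs σ τ hσ hτ' hface]
      exact (hmu σ hσ).1
    have hnv := isNormalVec_normalVec hP.2 hface (by omega)
    constructor
    · intro x hx
      have h1 := hdec σ τ hσ hτ' hface _ (apply_mem_spanImage hx)
      simp only [Function.comp_apply, LinearMap.smul_apply, smul_eq_mul, h1]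
      have h2 := hnv.2.2.2 x hx
      have h3 := mul_nonneg h2 (mul_self_nonneg (ν τ (p (E.normalVec σ τ))))
      linarith
    · intro w
      simp only [LinearMap.smul_apply, smul_eq_mul, mul_eq_zero, hne, false_or]
      rw [spanImage_comp]
      constructor
      · intro h0
        have h1 : w ∈ spanImage (p ∘ E.ι) (σ : Set X) := by
          rw [spanImage_eq_top hj (hσ.trans hW.symm)]
          trivial
        rw [spanImage_comp] at h1
        obtain ⟨w', hw', rfl⟩ := h1
        rw [hdec σ τ hσ hτ' hface _ hw', mul_eq_zero, or_iff_left hne] at h0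
        have h2 := span_eq_sup_normalVec hP.2 hface (by omega) hw'
        rw [h0, zero_smul, sub_zero] at h2
        exact Submodule.mem_map_of_mem h2
      · rintro ⟨u, hu, rfl⟩
        exact hν0 τ hτ' u hu
  · intro τ hτ b hb x hx t ht κ
    rw [hW] at hτ ⊢
    have hτ' : P.dim τ = k := by omega
    let A := Finset.univ.filter fun σ : P.cones => P.dim σ = k + 1 ∧ P.Face τ σ
    have hA : ∀ σ ∈ A, P.dim σ = k + 1 ∧ P.Face τ σ := fun σ h => (Finset.mem_filter.1 h).2
    rw [← Finset.sum_filter]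
    change 0 ≤ ∑ σ ∈ A, _
    let v : P.cones → N := fun σ => E.normalVec σ τ
    have hbal : ∑ σ ∈ A, c σ • v σ = 0 := hc.2 τ hτ
    have hint : 0 ≤ ∑ σ ∈ A, -(E.linExt φ σ (v σ)) * c σ := by
      have := hpos τ
      rw [inter, if_pos hτ] at this
      exact this
    have hΦv : ∀ σ ∈ A, Φ σ (p (v σ)) = E.linExt φ σ (v σ) := by
      intro σ hσ
      have h1 : spanImage E.ι (σ : Set X) ≤ LinearMap.eqLocus (Φ σ ∘ₗ p) (E.linExt φ σ) := by
        refine Submodule.span_le.2 ?_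
        rintro _ ⟨y, hy, rfl⟩
        exact (hΦ σ y hy).symm.trans (linExt_spec hP.2 hφ σ y hy)
      have h2 := isNormalVec_normalVec hP.2 (hA σ hσ).2 (by have := (hA σ hσ).1; omega)
      exact h1 h2.1
    have hker : ∀ w, ν τ w = 0 → A.Nonempty → w ∈ spanImage (p ∘ E.ι) (τ : Set X) := by
      rintro w hw ⟨σ, hσ⟩
      obtain ⟨hd, hface⟩ := hA σ hσ
      have hne : ν τ (p (E.normalVec σ τ)) ≠ 0 := by
        rw [← abs_pos, habs σ τ hd hτ' hface]
        exact (hmu σ hd).1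
      have h1 : w ∈ spanImage (p ∘ E.ι) (σ : Set X) := by
        rw [spanImage_eq_top hj (hd.trans hW.symm)]
        trivial
      rw [spanImage_comp] at h1 ⊢
      obtain ⟨w', hw', rfl⟩ := h1
      rw [hdec σ τ hd hτ' hface _ hw', mul_eq_zero, or_iff_left hne] at hw
      have h2 := span_eq_sup_normalVec hP.2 hface (by omega) hw'
      rw [hw, zero_smul, sub_zero] at h2
      exact Submodule.mem_map_of_mem h2
    have hcross : ∑ σ ∈ A, c σ * ν τ (p (v σ)) * Φ σ b =
        ν τ b * ∑ σ ∈ A, c σ * Φ σ (p (v σ)) := by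
      rcases A.eq_empty_or_nonempty with hA0 | hA0
      · simp [hA0]
      obtain ⟨σ₀, hσ₀⟩ := hA0
      -- The vector `ν(p v) b - ν(b) p v` is in the kernel of `ν τ`, which is the span of `τ`, where
      -- all the `Φ σ` agree. One form `Φ σ₀` thus serves for all sheets and the sum vanishes by
      -- balancing.
      have h1 : ∀ σ ∈ A, ν τ (p (v σ)) * Φ σ b - ν τ b * Φ σ (p (v σ)) =
          Φ σ₀ (ν τ (p (v σ)) • b - ν τ b • p (v σ)) := by
        intro σ hσ
        have h2 := hker (ν τ (p (v σ)) • b - ν τ b • p (v σ))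
          (by simp only [map_sub, map_smul, smul_eq_mul]; ring) ⟨σ, hσ⟩
        have h3 : spanImage (p ∘ E.ι) (τ : Set X) ≤ LinearMap.eqLocus (Φ σ) (Φ σ₀) := by
          refine Submodule.span_le.2 ?_
          rintro _ ⟨y, hy, rfl⟩
          exact (hΦ σ y ((hA σ hσ).2.subset hy)).symm.trans (hΦ σ₀ y ((hA σ₀ hσ₀).2.subset hy))
        have h4 : Φ σ (ν τ (p (v σ)) • b - ν τ b • p (v σ)) = Φ σ₀ _ := h3 h2
        rw [← h4]
        simp only [map_sub, map_smul, smul_eq_mul]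
      rw [Finset.mul_sum, ← sub_eq_zero, ← Finset.sum_sub_distrib]
      have h5 : ∀ σ ∈ A, c σ * ν τ (p (v σ)) * Φ σ b - ν τ b * (c σ * Φ σ (p (v σ))) =
          Φ σ₀ (ν τ (p (c σ • v σ)) • b - ν τ b • p (c σ • v σ)) := by
        intro σ hσ
        have := h1 σ hσ
        simp only [map_sub, map_smul, smul_eq_mul] at this ⊢
        linear_combination c σ * this
      rw [Finset.sum_congr rfl h5, ← map_sum, Finset.sum_sub_distrib, ← Finset.sum_smul,
        ← Finset.smul_sum, ← map_sum, ← map_sum, hbal]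
      simp
    have hterm : ∀ σ ∈ A, c σ * mu (spanImage E.ι (σ : Set X)) *
        signOf ((ν τ (p (E.normalVec σ τ)) • ν τ) b) * (Φ σ ((p ∘ E.ι) x - t • b) - κ) =
        signOf (ν τ b) * ((φ x - κ) * ν τ (p (c σ • v σ)) -
          t * (c σ * ν τ (p (v σ)) * Φ σ b)) := by
      intro σ hσ
      obtain ⟨hd, hface⟩ := hA σ hσ
      rw [← habs σ τ hd hτ' hface, mul_assoc (c σ), LinearMap.smul_apply, smul_eq_mul,
        abs_mul_signOf, map_sub, ← hΦ σ x (hface.subset hx)]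
      simp only [map_smul, smul_eq_mul, v]
      ring
    -- Balancing kills the part with `φ x - κ`; what remains is `t * |ν τ b|` times the intersection
    -- number at `τ`.
    rw [Finset.sum_congr rfl hterm, ← Finset.mul_sum, Finset.sum_sub_distrib, ← Finset.mul_sum,
      ← Finset.mul_sum, ← map_sum, ← map_sum, hbal, hcross]
    have h6 : ∑ σ ∈ A, -(E.linExt φ σ (v σ)) * c σ = -∑ σ ∈ A, c σ * Φ σ (p (v σ)) := by
      rw [← Finset.sum_neg_distrib]
      refine Finset.sum_congr rfl fun σ hσ => ?_
      rw [hΦv σ hσ]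
      ring
    rw [h6] at hint
    have h7 := mul_nonneg (mul_nonneg ht (abs_nonneg (ν τ b))) hint
    rw [← signOf_mul_self] at h7
    simp only [map_zero, mul_zero, zero_sub]
    linarith

end EuclideanConicalSpace

end

section

open Topology Filter

/-! ### Local estimates -/

namespace ConicalStructure

set_option linter.unusedSectionVars false

variable {X : Type*} [TopologicalSpace X] {P R : ConicalStructure X}
  {W : Type*} [NormedAddCommGroup W] [NormedSpace ℝ W] [FiniteDimensional ℝ W] {j : X → W}

/-- A form that is non-negative around `j x` and zero at `j x` is zero. -/
theorem IsFaceOf.eq_of_mem_interior (hR : R.IsQuasiEmbedding j) {σ ρ : R.cones} {x : X}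
    (hx : j x ∈ interior (imageCone hR σ : Set W)) (hρ : R.Face ρ σ) (hxρ : x ∈ (ρ : Set X)) :
    ρ = σ := by
  obtain ⟨l, hl, hρl⟩ := (isFaceOf_iff hR).1 hρ
  have hx0 : l (j x) = 0 := by
    rw [hρl] at hxρ
    exact hxρ.2
  have hl0 : ∀ d : W, 0 ≤ l d := by
    intro d
    have h1 : ∀ᶠ s : ℝ in 𝓝 0, j x + s • d ∈ interior (imageCone hR σ : Set W) := by
      have : Continuous fun s : ℝ => j x + s • d := by fun_prop
      exact this.continuousAt.eventually (isOpen_interior.mem_nhds (by simpa using hx))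
    obtain ⟨s, hs, hs0⟩ := ((h1.filter_mono (nhdsWithin_le_nhds (s := Set.Ioi 0))).and
      (eventually_mem_nhdsWithin (s := Set.Ioi (0 : ℝ)))).exists
    obtain ⟨y, hy, hjy⟩ := (mem_imageCone hR).1 (interior_subset hs)
    have h2 := hl y hy
    rw [hjy, map_add, map_smul, hx0, zero_add, smul_eq_mul] at h2
    exact nonneg_of_mul_nonneg_right h2 hs0
  refine Subtype.ext (hρ.subset.antisymm fun y hy => ?_)
  rw [hρl]
  refine ⟨hy, le_antisymm ?_ (hl0 _)⟩
  have := hl0 (-j y)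
  rw [map_neg] at this
  linarith

theorem eq_of_mem_interior (hR : R.IsQuasiEmbedding j) {σ σ' : R.cones} {x : X}
    (hd : R.dim σ' ≤ R.dim σ) (hxσ : x ∈ (σ : Set X)) (hxσ' : x ∈ (σ' : Set X))
    (hx : j x ∈ interior (imageCone hR σ : Set W)) : σ = σ' := by
  obtain ⟨ρ, hxρ, h1, h2⟩ := exists_common_face hxσ hxσ'
  have h3 := IsFaceOf.eq_of_mem_interior hR hx h1 hxρ
  subst h3
  exact h2.eq_of_dim_le hR hd

theorem eq_of_forall_notMem_walls (hP : P.IsQuasiEmbedding j) {σ σ' : P.cones} {x : X}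
    (hd : P.dim σ = Module.finrank ℝ W) (hd' : P.dim σ' = Module.finrank ℝ W)
    (hxσ : x ∈ (σ : Set X)) (hxσ' : x ∈ (σ' : Set X)) (hx : ∀ H ∈ P.walls j, j x ∉ H) :
    σ = σ' := by
  obtain ⟨ρ, hxρ, h1, h2⟩ := exists_common_face hxσ hxσ'
  have h3 : Module.finrank ℝ W ≤ P.dim ρ := by
    by_contra hlt
    exact hx _ (spanImage_mem_walls (not_le.1 hlt)) (apply_mem_spanImage hxρ)
  rw [← h1.eq_of_dim_le hP (hd.le.trans h3), ← h2.eq_of_dim_le hP (hd'.le.trans h3)]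

theorem interior_imageCone_nonempty (hR : R.IsQuasiEmbedding j) {σ : R.cones}
    (hd : R.dim σ = Module.finrank ℝ W) : (interior (imageCone hR σ : Set W)).Nonempty := by
  rw [(imageCone hR σ).convex.interior_nonempty_iff_affineSpan_eq_top]
  have h0 : (0 : W) ∈ (imageCone hR σ : Set W) := (imageCone hR σ).zero_mem
  refine (AffineSubspace.direction_eq_top_iff_of_nonempty ⟨0, subset_affineSpan ℝ _ h0⟩).1 ?_
  rw [direction_affineSpan, vectorSpan_eq_span_vsub_set_right ℝ h0, ← top_le_iff,
    ← spanImage_eq_top hR hd, spanImage_eq hR]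
  refine Submodule.span_mono ?_
  intro w hw
  exact ⟨w, hw, by simp⟩

open Classical in
/-- A function on a cone, as a function on its image. -/
noncomputable def transport (j : X → W) (σ : Set X) (φ : X → ℝ) (y : W) : ℝ :=
  if h : ∃ x ∈ σ, j x = y then φ h.choose else 0

theorem transport_apply (hR : R.IsQuasiEmbedding j) (σ : R.cones) (φ : X → ℝ) {x : X}
    (hx : x ∈ (σ : Set X)) : transport j σ φ (j x) = φ x := by
  have h : ∃ x' ∈ (σ : Set X), j x' = j x := ⟨x, hx, rfl⟩
  rw [transport, dif_pos h, injOn_cone hR σ h.choose_spec.1 hx h.choose_spec.2]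

theorem continuousOn_transport (hR : R.IsQuasiEmbedding j) (σ : R.cones) {φ : X → ℝ}
    (hφ : Continuous φ) : ContinuousOn (transport j σ φ) (imageCone hR σ) := by
  intro y hy
  obtain ⟨x, hx, rfl⟩ := (mem_imageCone hR).1 hy
  have h1 : Tendsto φ (𝓝[(σ : Set X)] x) (𝓝 (φ x)) := hφ.continuousAt.continuousWithinAt
  rw [ContinuousWithinAt, transport_apply hR σ φ hx]
  intro V hV
  have h2 := h1 hV
  rw [Filter.mem_map, mem_nhdsWithin_iff_exists_mem_nhds_inter] at h2
  obtain ⟨O, hO, hOV⟩ := h2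
  have h3 : (fun z : (σ : Set X) => (z : X)) ⁻¹' O ∈ 𝓝 (⟨x, hx⟩ : (σ : Set X)) :=
    continuous_subtype_val.continuousAt hO
  rw [(isEmbedding_restrict_cone hR σ).nhds_eq_comap, Filter.mem_comap] at h3
  obtain ⟨U, hU, hUO⟩ := h3
  rw [Filter.mem_map, mem_nhdsWithin_iff_exists_mem_nhds_inter]
  refine ⟨U, hU, ?_⟩
  rintro w ⟨hwU, hw⟩
  obtain ⟨z, hz, rfl⟩ := (mem_imageCone hR).1 hw
  change transport j σ φ (j z) ∈ V
  rw [transport_apply hR σ φ hz]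
  exact hOV ⟨hUO (show (⟨z, hz⟩ : (σ : Set X)) ∈ _ from hwU), hz⟩

/-- `φ` is continuous and concave across the walls of some conical structure of full dimension,
with multiplicities among those of the reference structure `R`. -/
def IsSuperharmonic (R : ConicalStructure X) (j : X → W) (mR : R.cones → ℝ) (φ : X → ℝ) : Prop :=
  Continuous φ ∧ ∃ (P : ConicalStructure X) (m : P.cones → ℝ) (l : P.cones → P.cones → W →ₗ[ℝ] ℝ)
    (Φ : P.cones → W →ₗ[ℝ] ℝ), P.IsQuasiEmbedding j ∧
    (∀ x, ∃ σ : P.cones, x ∈ (σ : Set X) ∧ P.dim σ = Module.finrank ℝ W) ∧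
    P.IsConcaveAcrossWalls j φ m l Φ ∧
    ∀ σ : P.cones, P.dim σ = Module.finrank ℝ W → ∀ x ∈ (σ : Set X), ∃ ρ : R.cones,
      x ∈ (ρ : Set X) ∧ R.dim ρ = Module.finrank ℝ W ∧ m σ = mR ρ

theorem isClosed_biUnion_cones (R : ConicalStructure X) (S : Set R.cones) :
    IsClosed (⋃ σ ∈ S, (σ : Set X)) :=
  (Set.toFinite S).isClosed_biUnion fun σ _ => R.isClosed_cone σ σ.2

variable {mR : R.cones → ℝ} {φ : X → ℝ}

/-- Midpoint concavity in the interior of a cone, along generic lines. -/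
theorem IsSuperharmonic.transport_interior (hφ : R.IsSuperharmonic j mR φ)
    (hR : R.IsQuasiEmbedding j)
    (hcov : ∀ x, ∃ σ : R.cones, x ∈ (σ : Set X) ∧ R.dim σ = Module.finrank ℝ W)
    (hmR : ∀ σ : R.cones, R.dim σ = Module.finrank ℝ W → 0 < mR σ)
    {σ₀ : R.cones} (hd₀ : R.dim σ₀ = Module.finrank ℝ W) {a c : W}
    (ha : a ∈ interior (imageCone hR σ₀ : Set W))
    (hc : (2 : ℝ) • c - a ∈ interior (imageCone hR σ₀ : Set W)) :
    transport j σ₀ φ a + transport j σ₀ φ ((2 : ℝ) • c - a) ≤ 2 * transport j σ₀ φ c := by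
  classical
  obtain ⟨hφc, P, m, l, Φ, hP, hPcov, hcon, hm⟩ := hφ
  have hK : Convex ℝ (interior (imageCone hR σ₀ : Set W)) := (imageCone hR σ₀).convex.interior
  have hmid : ∀ a c : W, a ∈ interior (imageCone hR σ₀ : Set W) →
      (2 : ℝ) • c - a ∈ interior (imageCone hR σ₀ : Set W) →
      ∀ t ∈ Set.Icc (0 : ℝ) 2, a + t • (c - a) ∈ interior (imageCone hR σ₀ : Set W) := by
    intro a c ha hc t ht
    have := hK ha hc (a := 1 - t / 2) (b := t / 2) (by linarith [ht.2]) (by linarith [ht.1])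
      (by ring)
    convert this using 1
    module
  have hcont := continuousOn_transport hR σ₀ hφc
  -- A strict violation is an open condition on `(a, c)` by continuity, so it persists on a line
  -- that is generic for the walls of `P`.
  by_contra! hcontra
  let f : W × W → ℝ := fun q =>
    transport j σ₀ φ q.1 + transport j σ₀ φ ((2 : ℝ) • q.2 - q.1) - 2 * transport j σ₀ φ q.2
  have hat : ∀ y ∈ interior (imageCone hR σ₀ : Set W), ContinuousAt (transport j σ₀ φ) y :=
    fun y hy => (hcont.mono interior_subset).continuousAt (isOpen_interior.mem_nhds hy)
  have hf : ContinuousAt f (a, c) := by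
    have h1 : ContinuousAt (fun q : W × W => transport j σ₀ φ q.1) (a, c) :=
      ContinuousAt.comp (f := fun q : W × W => q.1) (x := (a, c)) (hat a ha) continuousAt_fst
    have h2 : ContinuousAt (fun q : W × W => transport j σ₀ φ ((2 : ℝ) • q.2 - q.1)) (a, c) :=
      ContinuousAt.comp (f := fun q : W × W => (2 : ℝ) • q.2 - q.1) (hat _ hc) (by fun_prop)
    have h3 : ContinuousAt (fun q : W × W => transport j σ₀ φ q.2) (a, c) :=
      ContinuousAt.comp (f := fun q : W × W => q.2) (hat _ (by
        have := hmid a c ha hc 1 (by norm_num)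
        simpa using this)) continuousAt_snd
    exact (h1.add h2).sub (h3.const_mul 2)
  have hev : ∀ᶠ q : W × W in 𝓝 (a, c), 0 < f q ∧ q.1 ∈ interior (imageCone hR σ₀ : Set W) ∧
      (2 : ℝ) • q.2 - q.1 ∈ interior (imageCone hR σ₀ : Set W) := by
    refine (hf.eventually (lt_mem_nhds (show 0 < f (a, c) by simp only [f]; linarith))).and
      (Filter.Eventually.and ?_ ?_)
    · exact continuousAt_fst.eventually (isOpen_interior.mem_nhds ha)
    · have h2 : ContinuousAt (fun q : W × W => (2 : ℝ) • q.2 - q.1) (a, c) := by fun_prop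
      exact h2.eventually (isOpen_interior.mem_nhds hc)
  rw [nhds_prod_eq, Filter.eventually_prod_iff] at hev
  obtain ⟨pa, hpa, pb, hpb, hall⟩ := hev
  obtain ⟨U, hU, hUo, haU⟩ := mem_nhds_iff.1 hpa
  obtain ⟨V, hV, hVo, hcV⟩ := mem_nhds_iff.1 hpb
  obtain ⟨a', b', hgen, ha', hc'⟩ := exists_isGenericLine finite_walls (ne_top_of_mem_walls hP)
    hUo hVo ⟨a, haU⟩ ⟨c, hcV⟩
  obtain ⟨hf', hi1, hi2⟩ := hall (hU ha') (hV hc')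
  simp only at hi1 hi2
  have e2 : (2 : ℝ) • (a' + b') - a' = a' + (2 : ℝ) • b' := by module
  have hseg : ∀ t ∈ Set.Icc (0 : ℝ) 2, a' + t • b' ∈ interior (imageCone hR σ₀ : Set W) := by
    intro t ht
    simpa using hmid a' (a' + b') hi1 hi2 t ht
  let Z' : Set X := ⋃ σ ∈ {σ : R.cones | σ ≠ σ₀ ∧ R.dim σ = Module.finrank ℝ W}, (σ : Set X)
  -- The region is `σ₀` alone: over its interior no other top cone of `R` shares a point with it.
  have hmain := hcon.sum_fiberValue_le hP hgen (R.isClosed_cone σ₀ σ₀.2)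
    (isClosed_biUnion_cones R {σ | σ ≠ σ₀ ∧ R.dim σ = Module.finrank ℝ W}) (by
      intro x
      obtain ⟨σ, hxσ, hd⟩ := hcov x
      by_cases h : σ = σ₀
      · exact Or.inl (h ▸ hxσ)
      · exact Or.inr (Set.mem_biUnion (show σ ∈ {σ : R.cones | σ ≠ σ₀ ∧ _} from ⟨h, hd⟩) hxσ)) (by
      rintro x ⟨hx, hx'⟩ t ht hjx
      simp only [Set.mem_iUnion] at hx'
      obtain ⟨σ, ⟨hne, hd⟩, hxσ⟩ := hx'
      exact hne (eq_of_mem_interior hR (hd.trans hd₀.symm).le hx hxσ (hjx ▸ hseg t ht)).symm) 0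
  -- Over a point off the walls exactly one top cone of `P` contributes, with multiplicity `mR σ₀`.
  have hone : ∀ t ∈ Set.Icc (0 : ℝ) 2, (∀ H ∈ P.walls j, a' + t • b' ∉ H) →
      ∑ σ : P.cones, (if P.dim σ = Module.finrank ℝ W then
        m σ * fiberValue j Φ (σ₀ : Set X) 0 σ (a' + t • b') else 0) =
      mR σ₀ * transport j σ₀ φ (a' + t • b') := by
    intro t ht hwall
    have hint := hseg t ht
    obtain ⟨x, hx, hjx⟩ := (mem_imageCone hR).1 (interior_subset hint)
    rw [← hjx] at hwall hint ⊢
    obtain ⟨σ, hxσ, hd⟩ := hPcov x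
    rw [Finset.sum_eq_single_of_mem σ (Finset.mem_univ _)]
    · obtain ⟨ρ, hxρ, hdρ, hmρ⟩ := hm σ hd x hxσ
      rw [if_pos hd, hmρ, ← eq_of_mem_interior hR (hdρ.trans hd₀.symm).le hx hxρ hint,
        transport_apply hR σ₀ φ hx, fiberValue, if_pos ⟨x, hxσ, hx, rfl⟩, sub_zero,
        hcon.form σ x hxσ]
    · intro σ' _ hne
      by_cases hd' : P.dim σ' = Module.finrank ℝ W
      · rw [if_pos hd', fiberValue, if_neg, mul_zero]
        rintro ⟨x', hx'σ', hx', hjx'⟩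
        have := injOn_cone hR σ₀ hx' hx hjx'
        subst this
        exact hne (eq_of_forall_notMem_walls hP hd' hd hx'σ' hxσ hwall)
      · rw [if_neg hd']
  have hsplit : ∑ σ : P.cones, (if P.dim σ = Module.finrank ℝ W then m σ *
      (fiberValue j Φ (σ₀ : Set X) 0 σ a' + fiberValue j Φ (σ₀ : Set X) 0 σ (a' + (2 : ℝ) • b') -
        2 * fiberValue j Φ (σ₀ : Set X) 0 σ (a' + b')) else 0) =
      mR σ₀ * transport j σ₀ φ a' + mR σ₀ * transport j σ₀ φ (a' + (2 : ℝ) • b') -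
        2 * (mR σ₀ * transport j σ₀ φ (a' + b')) := by
    have h0 := hone 0 (by norm_num) (by simpa using hgen.zero)
    have h1 := hone 1 (by norm_num) (by simpa using hgen.one)
    have h2 := hone 2 (by norm_num) hgen.two
    rw [zero_smul, add_zero] at h0
    rw [one_smul] at h1
    rw [← h0, ← h1, ← h2, Finset.mul_sum, ← Finset.sum_add_distrib, ← Finset.sum_sub_distrib]
    refine Finset.sum_congr rfl fun σ _ => ?_
    split_ifs <;> ring
  rw [hsplit] at hmain
  simp only [f, e2] at hf'
  have := mul_pos (hmR σ₀ hd₀) hf'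
  linarith

/-- Contract all points towards an interior point `q`, use the interior case, and let the
contraction tend to the identity. -/
theorem IsSuperharmonic.transport_midpoint (hφ : R.IsSuperharmonic j mR φ)
    (hR : R.IsQuasiEmbedding j)
    (hcov : ∀ x, ∃ σ : R.cones, x ∈ (σ : Set X) ∧ R.dim σ = Module.finrank ℝ W)
    (hmR : ∀ σ : R.cones, R.dim σ = Module.finrank ℝ W → 0 < mR σ)
    {σ₀ : R.cones} (hd₀ : R.dim σ₀ = Module.finrank ℝ W) {a c : W}
    (ha : a ∈ imageCone hR σ₀) (hc : (2 : ℝ) • c - a ∈ imageCone hR σ₀) :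
    transport j σ₀ φ a + transport j σ₀ φ ((2 : ℝ) • c - a) ≤ 2 * transport j σ₀ φ c := by
  obtain ⟨q, hq⟩ := interior_imageCone_nonempty hR hd₀
  have hcont := continuousOn_transport hR σ₀ hφ.1
  have hK := (imageCone hR σ₀).convex
  have hint : ∀ y ∈ imageCone hR σ₀, ∀ s ∈ Set.Ioo (0 : ℝ) 1,
      y + s • (q - y) ∈ interior (imageCone hR σ₀ : Set W) := by
    intro y hy s hs
    have := hK.combo_self_interior_mem_interior hy hq (a := 1 - s) (b := s)
      (by linarith [hs.2]) hs.1 (by ring)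
    convert this using 1
    module
  have htend : ∀ y ∈ imageCone hR σ₀, Tendsto (fun s : ℝ => transport j σ₀ φ (y + s • (q - y)))
      (𝓝[>] 0) (𝓝 (transport j σ₀ φ y)) := by
    intro y hy
    refine (hcont y hy).tendsto.comp (tendsto_nhdsWithin_iff.2 ⟨?_, ?_⟩)
    · have : Continuous fun s : ℝ => y + s • (q - y) := by fun_prop
      simpa using (this.tendsto 0).mono_left nhdsWithin_le_nhds
    · filter_upwards [Ioo_mem_nhdsGT (zero_lt_one' ℝ)] with s hs
      exact interior_subset (hint y hy s hs)
  have hcK : c ∈ imageCone hR σ₀ := by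
    have := hK ha hc (a := 1 / 2) (b := 1 / 2) (by norm_num) (by norm_num) (by norm_num)
    have h2 : c = (1 / 2 : ℝ) • a + (1 / 2 : ℝ) • ((2 : ℝ) • c - a) := by module
    rw [h2]
    exact this
  refine le_of_tendsto_of_tendsto ((htend a ha).add (htend _ hc)) ((htend c hcK).const_mul 2) ?_
  filter_upwards [Ioo_mem_nhdsGT (zero_lt_one' ℝ)] with s hs
  have h1 : (2 : ℝ) • c - a + s • (q - ((2 : ℝ) • c - a)) =
      (2 : ℝ) • (c + s • (q - c)) - (a + s • (q - a)) := by module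
  rw [h1]
  refine hφ.transport_interior hR hcov hmR hd₀ (hint a ha s hs) ?_
  rw [← h1]
  exact hint _ hc s hs

end ConicalStructure

end

/-! ### Homogeneity, the uniform lower bound, and bounded fibres. -/

section

open Topology Filter

namespace ConicalStructure

set_option linter.unusedSectionVars false

variable {X : Type*} [TopologicalSpace X] {R : ConicalStructure X}
  {W : Type*} [NormedAddCommGroup W] [NormedSpace ℝ W] [FiniteDimensional ℝ W] {j : X → W}

/-- `φ` is positively homogeneous on the cones of `R`. -/
def IsHomogeneous (R : ConicalStructure X) (j : X → W) (φ : X → ℝ) : Prop :=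
  ∀ σ : R.cones, ∀ x ∈ (σ : Set X), ∀ y ∈ (σ : Set X), ∀ r : ℝ, 0 ≤ r → j y = r • j x →
    φ y = r * φ x

theorem IsHomogeneous.transport_smul {φ : X → ℝ} (h : R.IsHomogeneous j φ)
    (hR : R.IsQuasiEmbedding j) {σ : R.cones} {a : W} (ha : a ∈ imageCone hR σ) {r : ℝ}
    (hr : 0 ≤ r) : transport j σ φ (r • a) = r * transport j σ φ a := by
  obtain ⟨x, hx, rfl⟩ := (mem_imageCone hR).1 ha
  obtain ⟨y, hy, hjy⟩ := (mem_imageCone hR).1 ((imageCone hR σ).smul_mem hr ha)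
  rw [← hjy, transport_apply hR σ φ hx, transport_apply hR σ φ hy, h σ x hx y hy r hr hjy]

variable {mR : R.cones → ℝ} {φ : X → ℝ}

/-- Midpoint concavity plus homogeneity is superadditivity. -/
theorem IsSuperharmonic.transport_add (hφ : R.IsSuperharmonic j mR φ)
    (hR : R.IsQuasiEmbedding j)
    (hcov : ∀ x, ∃ σ : R.cones, x ∈ (σ : Set X) ∧ R.dim σ = Module.finrank ℝ W)
    (hmR : ∀ σ : R.cones, R.dim σ = Module.finrank ℝ W → 0 < mR σ)
    (hh : R.IsHomogeneous j φ)
    {σ : R.cones} (hd : R.dim σ = Module.finrank ℝ W) {a b : W}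
    (ha : a ∈ imageCone hR σ) (hb : b ∈ imageCone hR σ) :
    transport j σ φ a + transport j σ φ b ≤ transport j σ φ (a + b) := by
  have h1 : b = (2 : ℝ) • ((1 / 2 : ℝ) • (a + b)) - a := by module
  have h2 : (1 / 2 : ℝ) • (a + b) ∈ imageCone hR σ :=
    (imageCone hR σ).smul_mem (by norm_num) ((imageCone hR σ).add_mem ha hb)
  have h3 := hφ.transport_midpoint hR hcov hmR hd ha (h1 ▸ hb)
  rw [← h1, ← hh.transport_smul hR h2 (by norm_num : (0 : ℝ) ≤ 2)] at h3
  convert h3 using 2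
  module

theorem IsSuperharmonic.sum_le_transport (hφ : R.IsSuperharmonic j mR φ)
    (hR : R.IsQuasiEmbedding j)
    (hcov : ∀ x, ∃ σ : R.cones, x ∈ (σ : Set X) ∧ R.dim σ = Module.finrank ℝ W)
    (hmR : ∀ σ : R.cones, R.dim σ = Module.finrank ℝ W → 0 < mR σ)
    (hh : R.IsHomogeneous j φ)
    {σ : R.cones} (hd : R.dim σ = Module.finrank ℝ W) (s : Finset W)
    (hs : ∀ i ∈ s, i ∈ imageCone hR σ) {b : W → ℝ} (hb : ∀ i ∈ s, 0 ≤ b i) :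
    ∑ i ∈ s, b i • i ∈ imageCone hR σ ∧
      ∑ i ∈ s, b i * transport j σ φ i ≤ transport j σ φ (∑ i ∈ s, b i • i) := by
  classical
  induction s using Finset.induction_on with
  | empty =>
    refine ⟨by simp, ?_⟩
    have := hh.transport_smul hR (imageCone hR σ).zero_mem (le_refl 0)
    rw [zero_smul, zero_mul] at this
    simp [this]
  | insert i s hi ih =>
    obtain ⟨h1, h2⟩ := ih (fun k hk => hs k (Finset.mem_insert_of_mem hk))
      (fun k hk => hb k (Finset.mem_insert_of_mem hk))
    have h3 := hs i (Finset.mem_insert_self _ _)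
    have h4 := hb i (Finset.mem_insert_self _ _)
    have h5 := (imageCone hR σ).smul_mem h4 h3
    rw [Finset.sum_insert hi, Finset.sum_insert hi]
    refine ⟨(imageCone hR σ).add_mem h5 h1, ?_⟩
    rw [← hh.transport_smul hR h3 h4]
    exact (add_le_add_right h2 _).trans (hφ.transport_add hR hcov hmR hh hd h5 h1)

/-- Uniform lower semicontinuity of homogeneous superharmonic functions with prescribed
approximate values on a finite set. -/
theorem exists_eventually_sub_le (hR : R.IsQuasiEmbedding j)
    (hcov : ∀ x, ∃ σ : R.cones, x ∈ (σ : Set X) ∧ R.dim σ = Module.finrank ℝ W)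
    (hmR : ∀ σ : R.cones, R.dim σ = Module.finrank ℝ W → 0 < mR σ)
    (f₀ : X → ℝ) (x₀ : X) {ε : ℝ} (hε : 0 < ε) :
    ∃ F : Finset X, ∀ᶠ x in 𝓝 x₀, ∀ φ : X → ℝ, R.IsSuperharmonic j mR φ → R.IsHomogeneous j φ →
      (∀ y ∈ F, |φ y - f₀ y| < 1) → φ x₀ - ε ≤ φ x := by
  classical
  have main : ∀ σ : R.cones, ∃ F : Finset X, ∀ᶠ x in 𝓝 x₀, x ∈ (σ : Set X) →
      R.dim σ = Module.finrank ℝ W → ∀ φ : X → ℝ, R.IsSuperharmonic j mR φ →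
      R.IsHomogeneous j φ → (∀ y ∈ F, |φ y - f₀ y| < 1) → φ x₀ - ε ≤ φ x := by
    intro σ
    by_cases hx₀ : x₀ ∈ (σ : Set X)
    swap
    · refine ⟨∅, ?_⟩
      filter_upwards [(R.isClosed_cone σ σ.2).isOpen_compl.mem_nhds hx₀] with x hx h
      exact absurd h hx
    have hgens : ∀ i : W, ∃ y : X, i ∈ gens hR σ → y ∈ (σ : Set X) ∧ j y = i := by
      intro i
      by_cases hi : i ∈ gens hR σ
      · obtain ⟨y, hy, hjy⟩ := (mem_imageCone hR (σ := σ)).1 (PointedCone.subset_hull hi)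
        exact ⟨y, fun _ => ⟨hy, hjy⟩⟩
      · exact ⟨x₀, fun h => absurd h hi⟩
    choose g hg using hgens
    -- `A` bounds the sum of `|φ|` over the chosen generators and `x₀` for every admissible `φ`. A
    -- perturbation of size `ε / A` therefore costs at most `ε` under superadditivity.
    let A : ℝ := ∑ i ∈ gens hR σ, (|f₀ (g i)| + 1) + (|f₀ x₀| + 1)
    have hA0 : 0 ≤ ∑ i ∈ gens hR σ, (|f₀ (g i)| + 1) :=
      Finset.sum_nonneg fun i _ => by positivity
    have hA : 0 < A := by positivity
    refine ⟨insert x₀ ((gens hR σ).image g), ?_⟩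
    have hev := eventually_eq_smul_add_small (gens hR σ) (j x₀) (div_pos hε hA)
    have htend : Tendsto j (𝓝[(σ : Set X)] x₀) (𝓝[(imageCone hR σ : Set W)] (j x₀)) :=
      tendsto_nhdsWithin_iff.2 ⟨(continuous_quasiEmbedding hR).continuousAt.continuousWithinAt,
        eventually_mem_nhdsWithin.mono fun x hx => apply_mem_imageCone hR hx⟩
    have hev' := htend.eventually hev
    rw [eventually_nhdsWithin_iff] at hev'
    filter_upwards [hev'] with x hx hxσ hd φ hφ hh hF
    obtain ⟨r, hr0, hrη, hr1, b, hb, hjx⟩ := hx hxσ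
    obtain ⟨hmem, hsum⟩ := hφ.sum_le_transport hR hcov hmR hh hd (gens hR σ)
      (fun i hi => PointedCone.subset_hull hi) (fun i hi => (hb i hi).1)
    have hx₀' := (imageCone hR σ).smul_mem (sub_nonneg.2 hr1) (apply_mem_imageCone hR hx₀)
    have h1 := hφ.transport_add hR hcov hmR hh hd hx₀' hmem
    rw [← hjx, transport_apply hR σ φ hxσ,
      hh.transport_smul hR (apply_mem_imageCone hR hx₀) (sub_nonneg.2 hr1),
      transport_apply hR σ φ hx₀] at h1
    have habs : ∀ y ∈ insert x₀ ((gens hR σ).image g), |φ y| ≤ |f₀ y| + 1 := by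
      intro y hy
      have h2 := (hF y hy).le
      have h3 := abs_add_le (φ y - f₀ y) (f₀ y)
      rw [sub_add_cancel] at h3
      linarith
    have h2 : ∑ i ∈ gens hR σ, -(ε / A * (|f₀ (g i)| + 1)) ≤
        ∑ i ∈ gens hR σ, b i * transport j σ φ i := by
      refine Finset.sum_le_sum fun i hi => ?_
      obtain ⟨hgσ, hgi⟩ := hg i hi
      have h3 : transport j σ φ i = φ (g i) := by
        conv_lhs => rw [← hgi]
        exact transport_apply hR σ φ hgσ
      rw [h3]
      have h4 := habs (g i) (Finset.mem_insert_of_mem (Finset.mem_image_of_mem g hi))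
      have h5 : b i * |φ (g i)| ≤ ε / A * (|f₀ (g i)| + 1) :=
        mul_le_mul (hb i hi).2 h4 (abs_nonneg _) (by positivity)
      have h6 := mul_le_mul_of_nonneg_left (neg_abs_le (φ (g i))) (hb i hi).1
      linarith
    have h3 : r * φ x₀ ≤ ε / A * (|f₀ x₀| + 1) := by
      have h4 := habs x₀ (Finset.mem_insert_self _ _)
      have h5 : r * |φ x₀| ≤ ε / A * (|f₀ x₀| + 1) :=
        mul_le_mul hrη h4 (abs_nonneg _) (by positivity)
      exact (mul_le_mul_of_nonneg_left (le_abs_self _) hr0).trans h5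
    rw [Finset.sum_neg_distrib, ← Finset.mul_sum] at h2
    have h4 : ε / A * (∑ i ∈ gens hR σ, (|f₀ (g i)| + 1)) + ε / A * (|f₀ x₀| + 1) = ε := by
      rw [← mul_add]
      exact div_mul_cancel₀ ε hA.ne'
    linarith
  choose F hF using main
  refine ⟨Finset.univ.biUnion F, ?_⟩
  filter_upwards [eventually_all.2 hF] with x hx φ hφ hh hFφ
  obtain ⟨σ, hxσ, hd⟩ := hcov x
  exact hx σ hxσ hd φ hφ hh fun y hy => hFφ y (Finset.mem_biUnion.2 ⟨σ, Finset.mem_univ _, hy⟩)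

open Classical in
/-- The total multiplicity of the reference structure. -/
noncomputable def totalMult (R : ConicalStructure X) (mR : R.cones → ℝ) (n : ℕ) : ℝ :=
  ∑ σ : R.cones, if R.dim σ = n then mR σ else 0

open Classical in
/-- Over a generic point, the total multiplicity of the fiber is bounded. -/
theorem sum_fiber_le (hR : R.IsQuasiEmbedding j)
    (hmR : ∀ σ : R.cones, R.dim σ = Module.finrank ℝ W → 0 < mR σ)
    {P : ConicalStructure X} (hP : P.IsQuasiEmbedding j) {m : P.cones → ℝ}
    (hm : ∀ σ : P.cones, P.dim σ = Module.finrank ℝ W → ∀ x ∈ (σ : Set X), ∃ ρ : R.cones,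
      x ∈ (ρ : Set X) ∧ R.dim ρ = Module.finrank ℝ W ∧ m σ = mR ρ)
    (Z : Set X) {y : W} (hy : ∀ H ∈ P.walls j, y ∉ H) :
    ∑ σ : P.cones, (if P.dim σ = Module.finrank ℝ W ∧ ∃ x ∈ (σ : Set X), x ∈ Z ∧ j x = y
      then m σ else 0) ≤ totalMult R mR (Module.finrank ℝ W) := by
  rw [totalMult, ← Finset.sum_filter, ← Finset.sum_filter]
  have hex : ∀ σ : P.cones, ∃ x : X, ∃ ρ : R.cones,
      (P.dim σ = Module.finrank ℝ W ∧ ∃ x ∈ (σ : Set X), x ∈ Z ∧ j x = y) →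
      x ∈ (σ : Set X) ∧ j x = y ∧ x ∈ (ρ : Set X) ∧ R.dim ρ = Module.finrank ℝ W ∧ m σ = mR ρ := by
    intro σ
    by_cases h : P.dim σ = Module.finrank ℝ W ∧ ∃ x ∈ (σ : Set X), x ∈ Z ∧ j x = y
    · obtain ⟨hd, x, hx, -, hjx⟩ := h
      obtain ⟨ρ, h1, h2, h3⟩ := hm σ hd x hx
      exact ⟨x, ρ, fun _ => ⟨hx, hjx, h1, h2, h3⟩⟩
    · obtain ⟨x, hx, -⟩ := exists_mem_generic hP σ
      obtain ⟨ρ, -⟩ := R.exists_mem_cone x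
      exact ⟨x, ρ, fun h' => absurd h' h⟩
  choose x ρ h using hex
  -- Two sheets with the same `ρ` carry the same point of the fibre, as `j` is injective on `ρ`; off
  -- the walls this point has a unique top cone of `P`.
  have hinj : Set.InjOn ρ (Finset.univ.filter fun σ : P.cones => P.dim σ = Module.finrank ℝ W ∧
      ∃ x ∈ (σ : Set X), x ∈ Z ∧ j x = y : Finset P.cones) := by
    intro σ hσ σ' hσ' heq
    have hσ := (Finset.mem_filter.1 hσ).2
    have hσ' := (Finset.mem_filter.1 hσ').2
    obtain ⟨h1, h2, h3, -, -⟩ := h σ hσ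
    obtain ⟨h1', h2', h3', -, -⟩ := h σ' hσ'
    have hxx : x σ = x σ' := injOn_cone hR (ρ σ) h3 (heq ▸ h3') (h2.trans h2'.symm)
    exact eq_of_forall_notMem_walls hP hσ.1 hσ'.1 h1 (hxx ▸ h1') (h2 ▸ hy)
  rw [Finset.sum_congr rfl fun σ hσ => (h σ (Finset.mem_filter.1 hσ).2).2.2.2.2,
    ← Finset.sum_image (f := mR) hinj]
  refine Finset.sum_le_sum_of_subset_of_nonneg ?_ fun σ hσ _ => (hmR σ (Finset.mem_filter.1 hσ).2).le
  intro τ hτ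
  obtain ⟨σ, hσ, rfl⟩ := Finset.mem_image.1 hτ
  exact Finset.mem_filter.2 ⟨Finset.mem_univ _, (h σ (Finset.mem_filter.1 hσ).2).2.2.2.1⟩

/-- Each cone through `x₀` is embedded by `j`, and finitely many cones share one radius. The
restriction to these cones matters, since other sheets may lie over the same ball. -/
theorem exists_ball_subset (hR : R.IsQuasiEmbedding j) (x₀ : X) {O : Set X} (hO : O ∈ 𝓝 x₀) :
    ∃ r : ℝ, 0 < r ∧ ∀ σ : R.cones, x₀ ∈ (σ : Set X) → ∀ x ∈ (σ : Set X),
      j x ∈ Metric.ball (j x₀) r → x ∈ O := by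
  have h1 : ∀ σ : R.cones, ∀ᶠ r : ℝ in 𝓝[>] 0, x₀ ∈ (σ : Set X) → ∀ x ∈ (σ : Set X),
      j x ∈ Metric.ball (j x₀) r → x ∈ O := by
    intro σ
    by_cases hx₀ : x₀ ∈ (σ : Set X)
    · have h3 : (fun z : (σ : Set X) => (z : X)) ⁻¹' O ∈ 𝓝 (⟨x₀, hx₀⟩ : (σ : Set X)) :=
        continuous_subtype_val.continuousAt hO
      rw [(isEmbedding_restrict_cone hR σ).nhds_eq_comap, Filter.mem_comap] at h3
      obtain ⟨U, hU, hUO⟩ := h3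
      obtain ⟨r₀, hr₀, hball⟩ := Metric.mem_nhds_iff.1 hU
      filter_upwards [Ioo_mem_nhdsGT hr₀] with r hr _ x hx hjx
      exact hUO (show (⟨x, hx⟩ : (σ : Set X)) ∈ _ from
        hball (Metric.ball_subset_ball hr.2.le hjx))
    · exact Eventually.of_forall fun _ h => absurd h hx₀
  obtain ⟨r, hr, h⟩ := ((eventually_mem_nhdsWithin (s := Set.Ioi (0 : ℝ))).and
    (eventually_all.2 h1)).exists
  exact ⟨r, hr, h⟩

end ConicalStructure

end

/-! ### The uniform upper bound. -/

section

open Topology Filter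

namespace ConicalStructure

set_option linter.unusedSectionVars false

variable {X : Type*} [TopologicalSpace X] {R : ConicalStructure X}
  {W : Type*} [NormedAddCommGroup W] [NormedSpace ℝ W] [FiniteDimensional ℝ W] {j : X → W}
  {mR : R.cones → ℝ}

/-- Superharmonic functions that are bounded below near `x₀` by their value at `x₀` are also bounded
above by it. -/
theorem exists_eventually_le (hR : R.IsQuasiEmbedding j)
    (hcov : ∀ x, ∃ σ : R.cones, x ∈ (σ : Set X) ∧ R.dim σ = Module.finrank ℝ W)
    (hmR : ∀ σ : R.cones, R.dim σ = Module.finrank ℝ W → 0 < mR σ) :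
    ∃ A : ℝ, 0 < A ∧ ∀ x₀ : X, ∀ O ∈ 𝓝 x₀, ∀ ε : ℝ, 0 < ε → ∀ᶠ x₁ in 𝓝 x₀, ∀ φ : X → ℝ,
      R.IsSuperharmonic j mR φ → (∀ x ∈ O, φ x₀ - ε ≤ φ x) → φ x₁ ≤ φ x₀ + A * ε := by
  classical
  obtain ⟨μ, hμ, hμle⟩ : ∃ μ : ℝ, 0 < μ ∧ ∀ σ : R.cones, R.dim σ = Module.finrank ℝ W →
      μ ≤ mR σ := by
    have h1 : ∀ σ : R.cones, ∀ᶠ μ : ℝ in 𝓝[>] 0, R.dim σ = Module.finrank ℝ W → μ ≤ mR σ := by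
      intro σ
      by_cases hd : R.dim σ = Module.finrank ℝ W
      · filter_upwards [Ioo_mem_nhdsGT (hmR σ hd)] with μ h _
        exact h.2.le
      · exact Eventually.of_forall fun _ h => absurd h hd
    exact ((eventually_mem_nhdsWithin (s := Set.Ioi (0 : ℝ))).and (eventually_all.2 h1)).exists
  set M := totalMult R mR (Module.finrank ℝ W) with hM
  have hM0 : 0 ≤ M := Finset.sum_nonneg fun σ _ => by
    split_ifs with h
    · exact (hmR σ h).le
    · exact le_rfl
  refine ⟨(2 * M + 1) / μ, by positivity, fun x₀ O hO ε hε => ?_⟩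
  let S : Set R.cones := {σ | x₀ ∈ (σ : Set X) ∧ R.dim σ = Module.finrank ℝ W}
  let S' : Set R.cones := {σ | x₀ ∉ (σ : Set X) ∧ R.dim σ = Module.finrank ℝ W}
  -- `Z` is the star of `x₀`. Over the ball of radius `r` found below, it is disjoint from `Z'`, the
  -- union of the remaining top cones.
  let Z : Set X := ⋃ σ ∈ S, (σ : Set X)
  let Z' : Set X := ⋃ σ ∈ S', (σ : Set X)
  have hZ : IsClosed Z := isClosed_biUnion_cones R S
  have hZ' : IsClosed Z' := isClosed_biUnion_cones R S'
  have hmemZ : ∀ {x}, x ∈ Z ↔ ∃ σ ∈ S, x ∈ (σ : Set X) := by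
    intro x
    simp only [Z, Set.mem_iUnion, exists_prop]
  have hZZ' : ∀ x, x ∈ Z ∪ Z' := by
    intro x
    obtain ⟨σ, hx, hd⟩ := hcov x
    by_cases h : x₀ ∈ (σ : Set X)
    · exact Or.inl (Set.mem_biUnion (show σ ∈ S from ⟨h, hd⟩) hx)
    · exact Or.inr (Set.mem_biUnion (show σ ∈ S' from ⟨h, hd⟩) hx)
  have hx₀Z' : x₀ ∉ Z' := by
    simp only [Z', Set.mem_iUnion, not_exists]
    exact fun σ hσ h => hσ.1 h
  have hZ'nhd : Z'ᶜ ∈ 𝓝 x₀ := hZ'.isOpen_compl.mem_nhds hx₀Z'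
  obtain ⟨r, hr, hball⟩ := exists_ball_subset hR x₀ (inter_mem hO hZ'nhd)
  have hcj := continuous_quasiEmbedding hR
  have hev : ∀ᶠ x₁ in 𝓝 x₀, j x₁ ∈ Metric.ball (j x₀) (r / 2) :=
    hcj.continuousAt.eventually (Metric.ball_mem_nhds _ (by positivity))
  filter_upwards [hev, hZ'nhd] with x₁ hx₁ hx₁Z' φ hφ hlow
  by_contra! hcontra
  obtain ⟨σ₁, ⟨hx₀σ₁, hd₁⟩, hx₁σ₁⟩ := hmemZ.1 ((hZZ' x₁).resolve_right hx₁Z')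
  -- The slack `g` pays for moving to a generic line. The error `η` at the midpoint is chosen so
  -- that `2 M η < μ g`.
  obtain ⟨g, hg, hgap⟩ : ∃ g : ℝ, 0 < g ∧ φ x₀ + (2 * M + 1) / μ * ε + g < φ x₁ :=
    ⟨(φ x₁ - (φ x₀ + (2 * M + 1) / μ * ε)) / 2, by linarith, by linarith⟩
  set η : ℝ := μ * g / (2 * M + 1) with hη
  have hη0 : 0 < η := by positivity
  have hcont := continuousOn_transport hR σ₁ hφ.1
  -- This radius depends on `φ`, but it only constrains the auxiliary line; the neighbourhood of
  -- `x₀` containing `x₁` was fixed through `r` before `φ`.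
  obtain ⟨r₂, hr₂, hball₂⟩ := exists_ball_subset hR x₀ (O := {x | |φ x - φ x₀| < η}) (by
    have : Continuous fun x => |φ x - φ x₀| := (hφ.1.sub continuous_const).abs
    exact this.continuousAt.eventually (gt_mem_nhds (by simpa using hη0)))
  obtain ⟨hφc, P, m, l, Φ, hP, hPcov, hcon, hm⟩ := hφ
  let U : Set W := {a ∈ interior (imageCone hR σ₁ : Set W) ∩ Metric.ball (j x₀) (r / 2) |
    φ x₀ + (2 * M + 1) / μ * ε + g < transport j σ₁ φ a}
  have hUo : IsOpen U := ((hcont.mono interior_subset).mono Set.inter_subset_left).isOpen_inter_preimage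
      (isOpen_interior.inter Metric.isOpen_ball) isOpen_Ioi
  have hUne : U.Nonempty := by
    obtain ⟨q, hq⟩ := interior_imageCone_nonempty hR hd₁
    have hx₁K := apply_mem_imageCone hR hx₁σ₁
    have h0 : Tendsto (fun s : ℝ => j x₁ + s • (q - j x₁)) (𝓝[>] 0) (𝓝 (j x₁)) := by
      have : Continuous fun s : ℝ => j x₁ + s • (q - j x₁) := by fun_prop
      simpa using (this.tendsto 0).mono_left nhdsWithin_le_nhds
    have h1 : ∀ᶠ s : ℝ in 𝓝[>] 0, j x₁ + s • (q - j x₁) ∈ interior (imageCone hR σ₁ : Set W) := by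
      filter_upwards [Ioo_mem_nhdsGT (zero_lt_one' ℝ)] with s hs
      have := (imageCone hR σ₁).convex.combo_self_interior_mem_interior hx₁K hq
        (a := 1 - s) (b := s) (by linarith [hs.2]) hs.1 (by ring)
      convert this using 1
      module
    have h2 : ∀ᶠ s : ℝ in 𝓝[>] 0, j x₁ + s • (q - j x₁) ∈ Metric.ball (j x₀) (r / 2) :=
      h0.eventually (Metric.isOpen_ball.mem_nhds hx₁)
    have h3 : ∀ᶠ s : ℝ in 𝓝[>] 0, φ x₀ + (2 * M + 1) / μ * ε + g <
        transport j σ₁ φ (j x₁ + s • (q - j x₁)) := by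
      have h4 := (hcont _ hx₁K).tendsto.comp (tendsto_nhdsWithin_iff.2
        ⟨h0, h1.mono fun s hs => interior_subset hs⟩)
      refine h4.eventually (lt_mem_nhds ?_)
      rw [transport_apply hR σ₁ φ hx₁σ₁]
      exact hgap
    obtain ⟨s, hs1, hs2, hs3⟩ := (h1.and (h2.and h3)).exists
    exact ⟨_, ⟨hs1, hs2⟩, hs3⟩
  -- The line starts near `j x₁` and has its midpoint near `j x₀`. Since `2 (r / 4) + r / 2 = r`,
  -- its far end is still in the ball.
  obtain ⟨a, b, hgen, haU, hcV⟩ := exists_isGenericLine finite_walls (ne_top_of_mem_walls hP)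
    hUo (Metric.isOpen_ball (x := j x₀) (ε := min r₂ (r / 4))) hUne
    ⟨j x₀, Metric.mem_ball_self (by positivity)⟩
  obtain ⟨⟨haint, haball⟩, hagap⟩ := haU
  have hab2 : a + (2 : ℝ) • b ∈ Metric.ball (j x₀) r := by
    rw [mem_ball_iff_norm] at haball hcV ⊢
    have h1 : a + (2 : ℝ) • b - j x₀ = (2 : ℝ) • (a + b - j x₀) - (a - j x₀) := by module
    have h2 := norm_sub_le ((2 : ℝ) • (a + b - j x₀)) (a - j x₀)
    rw [norm_smul, Real.norm_of_nonneg (by norm_num : (0 : ℝ) ≤ 2)] at h2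
    have h3 := hcV.trans_le (min_le_right _ _)
    rw [h1]
    linarith
  have haball' : a ∈ Metric.ball (j x₀) r := Metric.ball_subset_ball (by linarith) haball
  have hseg : ∀ t ∈ Set.Icc (0 : ℝ) 2, a + t • b ∈ Metric.ball (j x₀) r := by
    intro t ht
    have hconv : Convex ℝ (Metric.ball (j x₀) r) := convex_ball (j x₀) r
    have h1 := hconv haball' hab2 (show (0 : ℝ) ≤ 1 - t / 2 by linarith [ht.2])
      (show (0 : ℝ) ≤ t / 2 by linarith [ht.1]) (by ring)
    have h2 : a + t • b = (1 - t / 2) • a + (t / 2) • (a + (2 : ℝ) • b) := by module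
    rw [h2]
    exact h1
  have hmain := hcon.sum_fiberValue_le hP hgen hZ hZ' hZZ' (by
    rintro x ⟨hx, hx'⟩ t ht hjx
    obtain ⟨σ, hσ, hxσ⟩ := hmemZ.1 hx
    exact (hball σ hσ.1 x hxσ (hjx ▸ hseg t ht)).2 hx') (φ x₀)
  have hmpos : ∀ σ : P.cones, P.dim σ = Module.finrank ℝ W → 0 < m σ := by
    intro σ hd
    obtain ⟨x, hx, -⟩ := exists_mem_generic hP σ
    obtain ⟨ρ, -, h1, h2⟩ := hm σ hd x hx
    exact h2 ▸ hmR ρ h1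
  let ind : W → P.cones → ℝ := fun y σ =>
    if P.dim σ = Module.finrank ℝ W ∧ ∃ x ∈ (σ : Set X), x ∈ Z ∧ j x = y then m σ else 0
  have hind : ∀ y, (∀ H ∈ P.walls j, y ∉ H) → ∑ σ, ind y σ ≤ M := fun y hy =>
    sum_fiber_le hR hmR hP hm Z hy
  have hlower : ∀ t ∈ Set.Icc (0 : ℝ) 2, ∀ σ : P.cones, -ε * ind (a + t • b) σ ≤
      if P.dim σ = Module.finrank ℝ W then m σ * fiberValue j Φ Z (φ x₀) σ (a + t • b) else 0 := by
    intro t ht σ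
    simp only [ind]
    by_cases hd : P.dim σ = Module.finrank ℝ W
    · rw [if_pos hd, fiberValue]
      by_cases hex : ∃ x ∈ (σ : Set X), x ∈ Z ∧ j x = a + t • b
      · rw [if_pos ⟨hd, hex⟩, if_pos hex]
        obtain ⟨x, hx, hxZ, hjx⟩ := hex
        obtain ⟨ρ, hρ, hxρ⟩ := hmemZ.1 hxZ
        have h1 := hlow x (hball ρ hρ.1 x hxρ (hjx ▸ hseg t ht)).1
        rw [hcon.form σ x hx, hjx] at h1
        have h2 := mul_le_mul_of_nonneg_left h1 (hmpos σ hd).le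
        linarith
      · rw [if_neg hex, if_neg fun h => hex h.2]
        simp
    · rw [if_neg hd, if_neg fun h => hd h.1]
      simp
  have hupper : ∀ σ : P.cones, (if P.dim σ = Module.finrank ℝ W then
      m σ * fiberValue j Φ Z (φ x₀) σ (a + b) else 0) ≤ η * ind (a + b) σ := by
    intro σ
    simp only [ind]
    by_cases hd : P.dim σ = Module.finrank ℝ W
    · rw [if_pos hd, fiberValue]
      by_cases hex : ∃ x ∈ (σ : Set X), x ∈ Z ∧ j x = a + b
      · rw [if_pos hex, if_pos (⟨hd, hex⟩ : P.dim σ = _ ∧ _)]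
        obtain ⟨x, hx, hxZ, hjx⟩ := hex
        obtain ⟨ρ, hρ, hxρ⟩ := hmemZ.1 hxZ
        have h1 : |φ x - φ x₀| < η := hball₂ ρ hρ.1 x hxρ
          (hjx ▸ Metric.ball_subset_ball (min_le_left _ _) hcV)
        rw [hcon.form σ x hx, hjx] at h1
        have h2 := mul_le_mul_of_nonneg_left ((le_abs_self _).trans h1.le) (hmpos σ hd).le
        linarith
      · rw [if_neg hex, if_neg fun h => hex h.2]
        simp
    · rw [if_neg hd, if_neg fun h => hd h.1]
      simp
  obtain ⟨x, hxσ₁, hjx⟩ := (mem_imageCone hR).1 (interior_subset haint)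
  obtain ⟨σ, hxσ, hd⟩ := hPcov x
  have hxZ : x ∈ Z := Set.mem_biUnion (show σ₁ ∈ S from ⟨hx₀σ₁, hd₁⟩) hxσ₁
  have hactive : ∃ x ∈ (σ : Set X), x ∈ Z ∧ j x = a := ⟨x, hxσ, hxZ, hjx⟩
  -- One sheet over `a` exceeds `φ x₀` by the assumed gap; all others lose at most `ε` times their
  -- multiplicity.
  have hzero : μ * ((2 * M + 1) / μ * ε + g) - ε * M ≤
      ∑ σ : P.cones, if P.dim σ = Module.finrank ℝ W then
        m σ * fiberValue j Φ Z (φ x₀) σ a else 0 := by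
    have h1 : m σ * ((2 * M + 1) / μ * ε + g) ≤ (if P.dim σ = Module.finrank ℝ W then
        m σ * fiberValue j Φ Z (φ x₀) σ a else 0) + ε * ind a σ := by
      simp only [ind]
      rw [if_pos hd, if_pos ⟨hd, hactive⟩, fiberValue, if_pos hactive, ← hjx, ← hcon.form σ x hxσ]
      rw [← hjx, transport_apply hR σ₁ φ hxσ₁] at hagap
      have h2 := mul_le_mul_of_nonneg_left (show (2 * M + 1) / μ * ε + g ≤ φ x - φ x₀ by linarith)
        (hmpos σ hd).le
      have h3 := mul_nonneg hε.le (hmpos σ hd).le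
      linarith
    have h2 : (if P.dim σ = Module.finrank ℝ W then
        m σ * fiberValue j Φ Z (φ x₀) σ a else 0) + ε * ind a σ ≤
        ∑ σ : P.cones, ((if P.dim σ = Module.finrank ℝ W then
          m σ * fiberValue j Φ Z (φ x₀) σ a else 0) + ε * ind a σ) := by
      refine Finset.single_le_sum (f := fun σ : P.cones => (if P.dim σ = Module.finrank ℝ W then
          m σ * fiberValue j Φ Z (φ x₀) σ a else 0) + ε * ind a σ) (fun σ _ => ?_)
          (Finset.mem_univ σ)
      have := hlower 0 (by norm_num) σ
      rw [zero_smul, add_zero] at this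
      linarith
    rw [Finset.sum_add_distrib, ← Finset.mul_sum] at h2
    have h3 := mul_le_mul_of_nonneg_left (hind a hgen.zero) hε.le
    obtain ⟨ρ, -, hdρ, hmρ⟩ := hm σ hd x hxσ
    have h4 : μ * ((2 * M + 1) / μ * ε + g) ≤ m σ * ((2 * M + 1) / μ * ε + g) :=
      mul_le_mul_of_nonneg_right (hmρ ▸ hμle ρ hdρ) (by positivity)
    linarith
  have htwo : -ε * M ≤ ∑ σ : P.cones, if P.dim σ = Module.finrank ℝ W then
        m σ * fiberValue j Φ Z (φ x₀) σ (a + (2 : ℝ) • b) else 0 := by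
    have h1 := Finset.sum_le_sum fun σ (_ : σ ∈ Finset.univ) => hlower 2 (by norm_num) σ
    rw [← Finset.mul_sum] at h1
    have h3 := mul_le_mul_of_nonneg_left (hind _ hgen.two) hε.le
    linarith
  have hone : ∑ σ : P.cones, (if P.dim σ = Module.finrank ℝ W then
        m σ * fiberValue j Φ Z (φ x₀) σ (a + b) else 0) ≤ η * M := by
    have h1 := Finset.sum_le_sum fun σ (_ : σ ∈ Finset.univ) => hupper σ
    rw [← Finset.mul_sum] at h1
    exact h1.trans (mul_le_mul_of_nonneg_left (hind _ hgen.one) hη0.le)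
  have hsplit : ∑ σ : P.cones, (if P.dim σ = Module.finrank ℝ W then m σ *
      (fiberValue j Φ Z (φ x₀) σ a + fiberValue j Φ Z (φ x₀) σ (a + (2 : ℝ) • b) -
        2 * fiberValue j Φ Z (φ x₀) σ (a + b)) else 0) =
      (∑ σ : P.cones, if P.dim σ = Module.finrank ℝ W then
        m σ * fiberValue j Φ Z (φ x₀) σ a else 0) +
      (∑ σ : P.cones, if P.dim σ = Module.finrank ℝ W then
        m σ * fiberValue j Φ Z (φ x₀) σ (a + (2 : ℝ) • b) else 0) -
      2 * ∑ σ : P.cones, if P.dim σ = Module.finrank ℝ W then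
        m σ * fiberValue j Φ Z (φ x₀) σ (a + b) else 0 := by
    rw [Finset.mul_sum, ← Finset.sum_add_distrib, ← Finset.sum_sub_distrib]
    refine Finset.sum_congr rfl fun σ _ => ?_
    split_ifs <;> ring
  rw [hsplit] at hmain
  have e1 : μ * ((2 * M + 1) / μ * ε + g) = (2 * M + 1) * ε + μ * g := by
    field_simp
  have e2 : η * (2 * M + 1) = μ * g := div_mul_cancel₀ _ (by positivity)
  rw [e1] at hzero
  -- The inequalities combine to `(2M + 1) ε + μ g - 2 M ε ≤ 2 M η`, impossible as `2 M η < μ g`.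
  nlinarith

end ConicalStructure

end

section

open Topology Filter

/-! ### Equicontinuity -/

namespace ConicalStructure

set_option linter.unusedSectionVars false

variable {X : Type*} [TopologicalSpace X] {R : ConicalStructure X}
  {W : Type*} [NormedAddCommGroup W] [NormedSpace ℝ W] [FiniteDimensional ℝ W] {j : X → W}
  {mR : R.cones → ℝ}

/-- The neighbourhood from the lower bound serves as `O` in the upper bound, with `min ε (ε / A)`
absorbing the factor `A`. -/
theorem exists_eventually_abs_sub_le (hR : R.IsQuasiEmbedding j)
    (hcov : ∀ x, ∃ σ : R.cones, x ∈ (σ : Set X) ∧ R.dim σ = Module.finrank ℝ W)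
    (hmR : ∀ σ : R.cones, R.dim σ = Module.finrank ℝ W → 0 < mR σ)
    (f₀ : X → ℝ) (x₀ : X) {ε : ℝ} (hε : 0 < ε) :
    ∃ F : Finset X, ∀ᶠ x in 𝓝 x₀, ∀ φ : X → ℝ, R.IsSuperharmonic j mR φ → R.IsHomogeneous j φ →
      (∀ y ∈ F, |φ y - f₀ y| < 1) → |φ x - φ x₀| ≤ ε := by
  obtain ⟨A, hA, hup⟩ := exists_eventually_le hR hcov hmR
  have hδ : 0 < min ε (ε / A) := lt_min hε (by positivity)
  obtain ⟨F, hF⟩ := exists_eventually_sub_le hR hcov hmR f₀ x₀ hδ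
  refine ⟨F, ?_⟩
  filter_upwards [hF, hup x₀ _ hF _ hδ] with x h1 h2 φ hφ hh hclose
  have h3 := h1 φ hφ hh hclose
  have h4 := h2 φ hφ fun y hy => hy φ hφ hh hclose
  have h5 : A * min ε (ε / A) ≤ ε :=
    (mul_le_mul_of_nonneg_left (min_le_right _ _) hA.le).trans_eq (by field_simp)
  have h6 := min_le_left ε (ε / A)
  rw [abs_le]
  constructor <;> linarith

/-- On the set of homogeneous superharmonic functions, closeness at finitely many points implies
uniform closeness on compact sets. -/
theorem exists_finset_abs_sub_le (hR : R.IsQuasiEmbedding j)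
    (hcov : ∀ x, ∃ σ : R.cones, x ∈ (σ : Set X) ∧ R.dim σ = Module.finrank ℝ W)
    (hmR : ∀ σ : R.cones, R.dim σ = Module.finrank ℝ W → 0 < mR σ)
    {K : Set X} (hK : IsCompact K) (f₀ : X → ℝ) {ε : ℝ} (hε : 0 < ε) :
    ∃ (F : Finset X) (δ : ℝ), 0 < δ ∧ ∀ φ ψ : X → ℝ,
      R.IsSuperharmonic j mR φ → R.IsHomogeneous j φ →
      R.IsSuperharmonic j mR ψ → R.IsHomogeneous j ψ →
      (∀ y ∈ F, |φ y - f₀ y| < δ) → (∀ y ∈ F, |ψ y - f₀ y| < δ) →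
      ∀ x ∈ K, |φ x - ψ x| ≤ ε := by
  classical
  have hε4 : 0 < ε / 4 := by positivity
  choose F hF using fun x₀ => exists_eventually_abs_sub_le hR hcov hmR f₀ x₀ hε4
  obtain ⟨t, -, ht⟩ := hK.elim_nhds_subcover _ fun x _ => hF x
  refine ⟨t ∪ t.biUnion F, min 1 (ε / 4), by positivity, ?_⟩
  intro φ ψ hφ hφ' hψ hψ' h1 h2 x hx
  obtain ⟨x₀, hx₀, hxx₀⟩ := Set.mem_iUnion₂.1 (ht hx)
  have hsub : ∀ y ∈ F x₀, y ∈ t ∪ t.biUnion F := fun y hy =>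
    Finset.mem_union_right _ (Finset.mem_biUnion.2 ⟨x₀, hx₀, hy⟩)
  have h3 := hxx₀ φ hφ hφ' fun y hy => (h1 y (hsub y hy)).trans_le (min_le_left _ _)
  have h4 := hxx₀ ψ hψ hψ' fun y hy => (h2 y (hsub y hy)).trans_le (min_le_left _ _)
  have h5 := (h1 x₀ (Finset.mem_union_left _ hx₀)).trans_le (min_le_right _ _)
  have h6 := (h2 x₀ (Finset.mem_union_left _ hx₀)).trans_le (min_le_right _ _)
  rw [abs_le] at h3 h4 ⊢
  rw [abs_lt] at h5 h6
  constructor <;> linarith [h3.1, h3.2, h4.1, h4.2, h5.1, h5.2, h6.1, h6.2]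

end ConicalStructure

/-! ### Comparison of the two topologies on the sphere. -/

namespace EuclideanConicalSpace

open ConicalStructure

set_option linter.unusedSectionVars false

variable {X : Type*} [TopologicalSpace X] {N : Type*} [NormedAddCommGroup N]
  [InnerProductSpace ℝ N] [FiniteDimensional ℝ N] {E : EuclideanConicalSpace X N}
  {P : ConicalStructure X} {n : ℕ}

theorem isCompact_sphere : IsCompact E.sphere := by
  have h1 : E.sphere = ⋃ σ : E.base.cones,
      Subtype.val '' ((fun x : (σ : Set X) => E.ι x) ⁻¹' Metric.sphere (0 : N) 1) := by
    ext x
    simp only [sphere, Set.mem_ofPred_eq, Set.mem_iUnion, Set.mem_image, Set.mem_preimage,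
      mem_sphere_zero_iff_norm]
    constructor
    · intro hx
      obtain ⟨σ, hσ⟩ := E.base.exists_mem_cone x
      exact ⟨σ, ⟨x, hσ⟩, hx, rfl⟩
    · rintro ⟨σ, y, hy, rfl⟩
      exact hy
  rw [h1]
  exact isCompact_iUnion fun σ => ((isClosedEmbedding_restrict_cone E.quasi σ).isCompact_preimage
    (_root_.isCompact_sphere (0 : N) 1)).image continuous_subtype_val

theorem isSMul_iff {x y : X} {r : ℝ} : E.base.IsSMul r x y ↔
    ∃ σ : E.base.cones, x ∈ (σ : Set X) ∧ y ∈ (σ : Set X) ∧ E.ι y = r • E.ι x := by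
  constructor
  · rintro ⟨σ, hx, hy, h⟩
    refine ⟨σ, hx, hy, ?_⟩
    rw [← sub_eq_zero, ← inner_self_eq_zero (𝕜 := ℝ)]
    obtain ⟨u, hu, hul⟩ := exists_mem_of_form E.quasi σ (innerₛₗ ℝ (E.ι y - r • E.ι x))
    have := h u hu
    rw [hul, hul] at this
    simp only [innerₛₗ_apply_apply] at this
    rw [inner_sub_right, inner_smul_right, this, sub_self]
  · rintro ⟨σ, hx, hy, h⟩
    refine ⟨σ, hx, hy, fun u hu => ?_⟩
    obtain ⟨l, hl⟩ := ConicalStructure.exists_form E.quasi σ hu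
    rw [hl, hl, h, map_smul, smul_eq_mul]

theorem exists_isSMul (x : X) {r : ℝ} (hr : 0 ≤ r) :
    ∃ y, E.base.IsSMul r x y ∧ E.ι y = r • E.ι x := by
  obtain ⟨σ, hx⟩ := E.base.exists_mem_cone x
  obtain ⟨y, hy, h⟩ := (mem_imageCone E.quasi).1
    ((imageCone E.quasi σ).smul_mem hr (apply_mem_imageCone E.quasi hx))
  exact ⟨y, isSMul_iff.2 ⟨σ, hx, hy, h⟩, h⟩

/-- A cone of the common subdivision through `x` contains the multiple; the common face `ρ` and
injectivity of `ι` identify it with `y`. -/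
theorem IsComplex.isSMul (hP : E.IsComplex P) {σ : P.cones} {x y : X} (hx : x ∈ (σ : Set X))
    (hy : y ∈ (σ : Set X)) {r : ℝ} (hr : 0 ≤ r) (h : E.ι y = r • E.ι x) :
    E.base.IsSMul r x y := by
  obtain ⟨⟨Q, hQ1, hQ2⟩, hPι⟩ := hP
  have hQι := hQ2.isQuasiEmbedding hPι
  obtain ⟨q, hxq⟩ := Q.exists_mem_cone x
  obtain ⟨z, hzq, hz⟩ := (mem_imageCone hQι).1
    ((imageCone hQι q).smul_mem hr (apply_mem_imageCone hQι hxq))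
  obtain ⟨σ', hqσ', -⟩ := hQ2 q
  obtain ⟨ρ, hxρ, h1, h2⟩ := exists_common_face hx (hqσ' hxq)
  obtain ⟨w, hwρ, hw⟩ := (mem_imageCone hPι).1
    ((imageCone hPι ρ).smul_mem hr (apply_mem_imageCone hPι hxρ))
  have hwy : w = y := injOn_cone hPι σ (h1.subset hwρ) hy (hw.trans h.symm)
  have hwz : w = z := injOn_cone hPι σ' (h2.subset hwρ) (hqσ' hzq) (hw.trans hz.symm)
  obtain ⟨τ, hqτ, -⟩ := hQ1 q
  exact isSMul_iff.2 ⟨τ, hqτ hxq, hqτ (hwy ▸ hwz ▸ hzq), h⟩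

theorem IsComplex.isHomogeneous {W : Type*} [NormedAddCommGroup W] [NormedSpace ℝ W]
    [FiniteDimensional ℝ W] {p : N →ₗ[ℝ] W} (hP : E.IsComplex P)
    (hp : P.IsQuasiEmbedding (p ∘ E.ι)) {φ : X → ℝ} (hφ : φ ∈ E.Conic) :
    P.IsHomogeneous (p ∘ E.ι) φ := by
  intro σ x hx y hy r hr h
  refine hφ r x y hr (hP.isSMul hx hy hr ?_)
  obtain ⟨z, hz, hzr⟩ := (mem_imageCone hP.2).1
    ((imageCone hP.2 σ).smul_mem hr (apply_mem_imageCone hP.2 hx))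
  have hzy : z = y := injOn_cone hp σ hz hy (by
    rw [h, Function.comp_apply, hzr, map_smul]
    rfl)
  rw [← hzy, hzr]

/-- A generic projection makes all piecewise linear functions with positive product with the
balancing cycle superharmonic. -/
theorem exists_projection {k : ℕ} (hn : E.PureDim (k + 1)) (B : E.Balancing (k + 1)) :
    ∃ (p : N →ₗ[ℝ] (Fin (k + 1) → ℝ)) (mR : B.complex.cones → ℝ),
      B.complex.IsQuasiEmbedding (p ∘ E.ι) ∧
      (∀ σ : B.complex.cones, B.complex.dim σ = k + 1 → 0 < mR σ) ∧
      ∀ φ : X → ℝ, E.ProductPositive B [φ] →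
        B.complex.IsSuperharmonic (p ∘ E.ι) mR φ := by
  classical
  -- Only spans from the balancing complex are needed: top cones of any other complex carrying `[X]`
  -- have one of these spans. Thus `p` and `mu` are chosen before `φ`.
  set S : Set (Submodule ℝ N) :=
    (fun σ : B.complex.cones => spanImage E.ι (σ : Set X)) '' {σ | B.complex.dim σ = k + 1}
  have hS : ∀ V ∈ S, Module.finrank ℝ V = k + 1 := by
    rintro _ ⟨σ, hσ, rfl⟩
    exact (finrank_spanImage B.isComplex.2 σ).trans hσ
  obtain ⟨p, hp⟩ := exists_linearMap_injOn (k + 1) ((Set.toFinite _).image _ : S.Finite)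
    fun V hV => (hS V hV).le
  choose! mu hmu using fun V (hV : V ∈ S) => exists_multiplicity p V (hS V hV) (hp V hV)
  have hmem : ∀ σ : B.complex.cones, B.complex.dim σ = k + 1 →
      spanImage E.ι (σ : Set X) ∈ S := fun σ hσ => ⟨σ, hσ, rfl⟩
  refine ⟨p, fun σ => B.weight σ * mu (spanImage E.ι (σ : Set X)),
    isQuasiEmbedding_comp hn B.isComplex fun σ hσ => hp _ (hmem σ hσ),
    fun σ hσ => mul_pos (B.pos σ hσ) (hmu _ (hmem σ hσ)).1, ?_⟩
  rintro φ ⟨P, c, hP, hc, hsame, hPL, hpos⟩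
  have hφ : P.PL φ := hPL φ (by simp)
  have hmemP : ∀ σ : P.cones, P.dim σ = k + 1 → spanImage E.ι (σ : Set X) ∈ S := by
    intro σ hσ
    obtain ⟨x, hx, -⟩ := exists_mem_generic hP.2 σ
    obtain ⟨ρ, -, hd, h, -⟩ := hsame.exists_eq hn B.isComplex hP hx hσ
    exact ⟨ρ, hd, h⟩
  obtain ⟨l, Φ, hcon⟩ := exists_isConcaveAcrossWalls hn hP hc hφ
    (fun τ => hpos.nonneg hP.2 τ) p (fun σ hσ => hp _ (hmemP σ hσ)) mu
    fun σ hσ => hmu _ (hmemP σ hσ)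
  refine ⟨hφ.continuous, P, _, l, Φ,
    isQuasiEmbedding_comp hn hP fun σ hσ => hp _ (hmemP σ hσ), ?_, hcon, ?_⟩
  · rw [Module.finrank_fin_fun]
    exact hn.exists_mem hP
  · rw [Module.finrank_fin_fun]
    intro σ hσ x hx
    obtain ⟨ρ, hxρ, hd, h, hw⟩ := hsame.exists_eq hn B.isComplex hP hx hσ
    exact ⟨ρ, hxρ, hd, by simp only [h, hw]⟩

theorem sphere_eq_empty (hn : E.PureDim 0) : E.sphere = ∅ := by
  refine Set.eq_empty_of_forall_notMem fun x hx => ?_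
  obtain ⟨σ, hσ⟩ := E.base.exists_mem_cone x
  have h1 : spanImage E.ι (σ : Set X) = ⊥ := by
    rw [← Submodule.finrank_eq_zero, finrank_spanImage E.quasi]
    exact Nat.le_zero.1 (hn.base_dim_le σ)
  have h2 : E.ι x ∈ spanImage E.ι (σ : Set X) := apply_mem_spanImage hσ
  rw [h1, Submodule.mem_bot] at h2
  simp [sphere, h2] at hx

variable {B : E.Balancing n} {C : Set (X → ℝ)}

/-- In dimension zero the sphere is empty; otherwise equicontinuity applies to the projected
functions. -/
theorem exists_finset_forall_sphere (hn : E.PureDim n)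
    (hC : ∀ φ ∈ C, 1 ≤ n → E.ProductPositive B [φ]) (f₀ : X → ℝ) {ε : ℝ} (hε : 0 < ε) :
    ∃ (F : Finset X) (δ : ℝ), 0 < δ ∧ ∀ φ ∈ C ∩ E.Conic, ∀ ψ ∈ C ∩ E.Conic,
      (∀ y ∈ F, |φ y - f₀ y| < δ) → (∀ y ∈ F, |ψ y - f₀ y| < δ) →
      ∀ x ∈ E.sphere, |φ x - ψ x| ≤ ε := by
  cases n with
  | zero => exact ⟨∅, 1, one_pos, fun φ _ ψ _ _ _ x hx => by simp [sphere_eq_empty hn] at hx⟩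
  | succ k =>
    obtain ⟨p, mR, hR, hmR, hsuper⟩ := exists_projection hn B
    obtain ⟨F, δ, hδ, h⟩ := exists_finset_abs_sub_le hR
      (by rw [Module.finrank_fin_fun]; exact hn.exists_mem B.isComplex)
      (by rw [Module.finrank_fin_fun]; exact hmR) (isCompact_sphere (E := E)) f₀ hε
    have h1 : 1 ≤ k + 1 := Nat.le_add_left _ _
    exact ⟨F, δ, hδ, fun φ hφ ψ hψ => h φ ψ (hsuper φ (hC φ hφ.1 h1))
      (B.isComplex.isHomogeneous hR hφ.2) (hsuper ψ (hC ψ hψ.1 h1))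
      (B.isComplex.isHomogeneous hR hψ.2)⟩

/-- For two elements of the closure of `C`, closeness at finitely many points implies uniform
closeness on the sphere. -/
theorem exists_finset_conicConcave (hn : E.PureDim n)
    (hC : ∀ φ ∈ C, 1 ≤ n → E.ProductPositive B [φ]) {f₀ : E.Conic}
    (hf₀ : f₀ ∈ E.ConicConcave C) {ε : ℝ} (hε : 0 < ε) :
    ∃ (F : Finset X) (δ : ℝ), 0 < δ ∧ ∀ f ∈ E.ConicConcave C,
      (∀ y ∈ F, |f.1 y - f₀.1 y| < δ) → ∀ x ∈ E.sphere, |f.1 x - f₀.1 x| ≤ ε := by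
  classical
  obtain ⟨F, δ, hδ, h⟩ := exists_finset_forall_sphere hn hC f₀.1 (half_pos hε)
  have approx : ∀ f ∈ E.ConicConcave C, ∀ (G : Finset X) (η : ℝ), 0 < η →
      ∃ φ ∈ C ∩ E.Conic, ∀ y ∈ G, |φ y - f.1 y| < η := by
    intro f hf G η hη
    have hO : {g : E.Conic | ∀ y ∈ G, |g.1 y - f.1 y| < η} ∈ 𝓝 f := by
      have : ∀ y ∈ G, ∀ᶠ g : E.Conic in 𝓝 f, |g.1 y - f.1 y| < η := by
        intro y _
        have hc : Continuous fun g : E.Conic => |g.1 y - f.1 y| :=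
          (((continuous_apply y).comp continuous_subtype_val).sub continuous_const).abs
        exact hc.continuousAt.eventually (gt_mem_nhds (by simpa using hη))
      exact (Filter.eventually_all_finset G).2 this
    obtain ⟨g, hg, hgC⟩ := mem_closure_iff_nhds.1 hf _ hO
    exact ⟨g.1, ⟨hgC, g.2⟩, hg⟩
  refine ⟨F, δ, hδ, fun f hf hclose x hx => ?_⟩
  -- The approximants may depend on the point `x`, because `F` and `δ` do not. Each is controlled at
  -- `x` as well as on `F`.
  obtain ⟨ψ, hψ, hψ'⟩ := approx f₀ hf₀ (insert x F) (min δ (ε / 4)) (by positivity)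
  obtain ⟨η, hη, hη'⟩ : ∃ η : ℝ, 0 < η ∧ ∀ y ∈ F, η + |f.1 y - f₀.1 y| < δ := by
    have h1 : ∀ y ∈ F, ∀ᶠ η : ℝ in 𝓝[>] 0, η + |f.1 y - f₀.1 y| < δ := by
      intro y hy
      filter_upwards [Ioo_mem_nhdsGT (sub_pos.2 (hclose y hy))] with η hη
      linarith [hη.2]
    exact ((eventually_mem_nhdsWithin (s := Set.Ioi (0 : ℝ))).and
      ((Filter.eventually_all_finset F).2 h1)).exists
  obtain ⟨φ, hφ, hφ'⟩ := approx f hf (insert x F) (min η (ε / 4)) (by positivity)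
  have h1 := h φ hφ ψ hψ (fun y hy => by
    have h2 := (hφ' y (Finset.mem_insert_of_mem hy)).trans_le (min_le_left _ _)
    have h3 := abs_sub_le (φ y) (f.1 y) (f₀.1 y)
    linarith [hη' y hy])
    (fun y hy => (hψ' y (Finset.mem_insert_of_mem hy)).trans_le (min_le_left _ _)) x hx
  have h2 := (hφ' x (Finset.mem_insert_self _ _)).trans_le (min_le_right _ _)
  have h3 := (hψ' x (Finset.mem_insert_self _ _)).trans_le (min_le_right _ _)
  rw [abs_le] at h1 ⊢
  rw [abs_lt] at h2 h3
  constructor <;> linarith [h1.1, h1.2, h2.1, h2.2, h3.1, h3.2]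

theorem conic_eq_zero {f : X → ℝ} (hf : f ∈ E.Conic) {x : X} (hx : E.ι x = 0) : f x = 0 := by
  obtain ⟨σ, hσ⟩ := E.base.exists_mem_cone x
  have := hf 0 x x le_rfl (isSMul_iff.2 ⟨σ, hσ, hσ, by rw [hx, smul_zero]⟩)
  rw [this, zero_mul]

/-- A conical function is determined by its restriction to the sphere. -/
theorem exists_sphere_mul (x : X) : E.ι x = 0 ∨
    ∃ y : E.sphere, ∀ f ∈ E.Conic, f x = ‖E.ι x‖ * f y := by
  by_cases hx : E.ι x = 0
  · exact Or.inl hx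
  refine Or.inr ?_
  have h0 : 0 < ‖E.ι x‖ := norm_pos_iff.2 hx
  obtain ⟨y, hy, hyι⟩ := exists_isSMul (E := E) x (inv_pos.2 h0).le
  refine ⟨⟨y, ?_⟩, fun f hf => ?_⟩
  · change ‖E.ι y‖ = 1
    rw [hyι, norm_smul, norm_inv, norm_norm, inv_mul_cancel₀ h0.ne']
  · rw [hf _ _ _ (inv_pos.2 h0).le hy, mul_inv_cancel_left₀ h0.ne']

theorem injective_toSphere : Function.Injective (E.toSphere C) := by
  intro f g hfg
  refine Subtype.ext (Subtype.ext (funext fun x => ?_))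
  rcases exists_sphere_mul (E := E) x with hx | ⟨y, hy⟩
  · rw [conic_eq_zero f.1.2 hx, conic_eq_zero g.1.2 hx]
  · rw [hy _ f.1.2, hy _ g.1.2]
    congr 1
    exact congrFun (congrArg UniformFun.toFun hfg) y

theorem continuous_toSphere (hn : E.PureDim n)
    (hC : ∀ φ ∈ C, 1 ≤ n → E.ProductPositive B [φ]) : Continuous (E.toSphere C) := by
  refine continuous_iff_continuousAt.2 fun f₀ => ?_
  rw [ContinuousAt, UniformFun.tendsto_iff_tendstoUniformly, Metric.tendstoUniformly_iff]
  intro ε hε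
  obtain ⟨F, δ, hδ, h⟩ := exists_finset_conicConcave hn hC f₀.2 (half_pos hε)
  have hev : ∀ᶠ f : E.ConicConcave C in 𝓝 f₀, ∀ y ∈ F, |f.1.1 y - f₀.1.1 y| < δ := by
    refine (Filter.eventually_all_finset F).2 fun y _ => ?_
    have hc : Continuous fun f : E.ConicConcave C => |f.1.1 y - f₀.1.1 y| :=
      (((continuous_apply y).comp (continuous_subtype_val.comp continuous_subtype_val)).sub
        continuous_const).abs
    exact hc.continuousAt.eventually (gt_mem_nhds (by simpa using hδ))
  filter_upwards [hev] with f hf x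
  rw [dist_comm, Real.dist_eq]
  exact (h f.1 f.2 hf x x.2).trans_lt (half_lt_self hε)

/-- Equicontinuity gives one direction; conversely, evaluation at any point is zero or a multiple of
evaluation on the sphere, which is uniformly continuous. -/
theorem isEmbedding_toSphere (hn : E.PureDim n)
    (hC : ∀ φ ∈ C, 1 ≤ n → E.ProductPositive B [φ]) : IsEmbedding (E.toSphere C) := by
  have hval : IsInducing fun f : E.ConicConcave C => f.1.1 :=
    IsInducing.subtypeVal.comp IsInducing.subtypeVal
  refine ⟨⟨le_antisymm (continuous_toSphere hn hC).le_induced ?_⟩, injective_toSphere⟩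
  rw [hval.eq_induced]
  generalize ht : TopologicalSpace.induced (E.toSphere C) _ = t
  refine continuous_iff_le_induced.1 (@continuous_pi _ _ _ t _ _ fun x => ?_)
  have hc : @Continuous _ _ t _ (E.toSphere C) := ht ▸ continuous_induced_dom
  rcases exists_sphere_mul (E := E) x with hx | ⟨y, hy⟩
  · have : (fun f : E.ConicConcave C => f.1.1 x) = fun _ => 0 :=
      funext fun f => conic_eq_zero f.1.2 hx
    rw [this]
    exact @continuous_const _ _ t _ _
  · have : (fun f : E.ConicConcave C => f.1.1 x) =
        (fun g : UniformFun E.sphere ℝ => ‖E.ι x‖ * UniformFun.toFun g y) ∘ E.toSphere C :=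
      funext fun f => hy _ f.1.2
    rw [this]
    refine Continuous.comp ?_ hc
    exact continuous_const.mul (UniformFun.uniformContinuous_eval ℝ y).continuous

/-- Uniform limits of elements of `C`, which are continuous. -/
theorem continuous_sphere (hn : E.PureDim n)
    (hC : ∀ φ ∈ C, 1 ≤ n → E.ProductPositive B [φ]) (hPL : ∀ φ ∈ C, Continuous φ) {f : E.Conic}
    (hf : f ∈ E.ConicConcave C) : Continuous fun x : E.sphere => f.1 x := by
  refine continuous_of_uniform_approx_of_continuous fun u hu => ?_
  obtain ⟨ε, hε, hεu⟩ := Metric.mem_uniformity_dist.1 hu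
  obtain ⟨F, δ, hδ, h⟩ := exists_finset_conicConcave hn hC hf (half_pos hε)
  have hO : ∀ᶠ g : E.Conic in 𝓝 f, ∀ y ∈ F, |g.1 y - f.1 y| < δ := by
    refine (Filter.eventually_all_finset F).2 fun y _ => ?_
    have hc : Continuous fun g : E.Conic => |g.1 y - f.1 y| :=
      (((continuous_apply y).comp continuous_subtype_val).sub continuous_const).abs
    exact hc.continuousAt.eventually (gt_mem_nhds (by simpa using hδ))
  obtain ⟨g, hg, hgC⟩ := mem_closure_iff_nhds.1 hf _ hO
  refine ⟨fun x => g.1 x, (hPL _ hgC).comp continuous_subtype_val, fun x => hεu ?_⟩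
  rw [dist_comm, Real.dist_eq]
  exact (h g (subset_closure hgC) hg x x.2).trans_lt (half_lt_self hε)

end EuclideanConicalSpace

end

theorem mainTheorem5 {X : Type*} [TopologicalSpace X] [SecondCountableTopology X]
    {N : Type*} [NormedAddCommGroup N] [InnerProductSpace ℝ N] [FiniteDimensional ℝ N]
    (E : EuclideanConicalSpace X N) (n : ℕ) (hn : E.PureDim n) (B : E.Balancing n)
    (C : Set (X → ℝ)) (hC : E.IsAdmissible B C) :
    (∀ f ∈ E.ConicConcave C, Continuous fun x : E.sphere => f.1 x) ∧
    Function.Injective (E.toSphere C) ∧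
    (inferInstance : TopologicalSpace (E.ConicConcave C)) =
      TopologicalSpace.induced (E.toSphere C)
        (UniformFun.uniformSpace E.sphere ℝ).toTopologicalSpace ∧
    TopologicalSpace.MetrizableSpace (E.ConicConcave C) ∧
    FrechetUrysohnSpace (E.ConicConcave C) := by
  have hpos : ∀ φ ∈ C, 1 ≤ n → E.ProductPositive B [φ] := fun φ hφ h =>
    hC.positive [φ] (by simpa using hφ) h
  have hemb := EuclideanConicalSpace.isEmbedding_toSphere hn hpos
  have hmet : TopologicalSpace.MetrizableSpace (E.ConicConcave C) := by
    have : TopologicalSpace.MetrizableSpace (UniformFun E.sphere ℝ) :=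
      UniformSpace.metrizableSpace
    exact hemb.metrizableSpace
  refine ⟨fun f hf => EuclideanConicalSpace.continuous_sphere hn hpos (fun φ hφ => ?_) hf,
    hemb.injective, hemb.eq_induced, hmet, inferInstance⟩
  obtain ⟨P, -, hP⟩ := hC.isPL φ hφ
  exact hP.continuous
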